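/- Let $n\ge 3$ and let $(M,g)$ be a smooth connected Riemannian $n$-manifold, possibly with compact boundary. A coordinate system at infinity is a diffeomorphism $x=(x^1,\dots,x^n)\colon M\setminus K\to\mathbb R^n\setminus B$ with $K$ compact and $B$ a closed ball; $g_{ij}$ are the components of $g$ in it, $\partial$ denotes partial derivatives in it, and $S_r=\{|x|=r\}$. Let $\omega_{n-1}$ be the area of the unit sphere in $\mathbb R^n$. The ADM mass (computed in these coordinates) is $$m_{ADM}(M,g)=\frac1{2(n-1)\omega_{n-1}}\lim_{r\to\infty}\int_{S_r}\sum_{i,j}(\partial_ig_{ij}-\partial_jg_{ii})\frac{x^j}{r}\,dA,$$ where $dA$ is the Euclidean area element. Put $$F_g(S_r)=\frac12\left(\frac{|S_r|}{\omega_{n-1}}\right)^{\frac{n-2}{n-1}}\left(1-\frac{n-2}{n-1}\cdot\frac{\max_{S_r}H^2}{\min_{S_r}\rho}\right),$$ where $|S_r|$, $H$ and $\rho$ are the area of $S_r$, its mean curvature (with respect to the outward unit normal) and its intrinsic scalar curvature, all with respect to $g$. (1) Suppose the coordinate system is asymptotically Schwarzschild, that is, for some real constant $m$, $$g_{ij}=\Big(1+\frac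 m{2|x|^{n-2}}\Big)^{\frac4{n-2}}\delta_{ij}+h_{ij},\qquad h_{ij}=O(|x|^{1-n}),\quad \partial_kh_{ij}=O(|x|^{-n}),\quad \partial_k\partial_\ell h_{ij}=O(|x|^{-n-1})$$ as $|x|\to\infty$. Then the ADM mass exists and equals $m$, and $$m_{ADM}(M,g)=\lim_{r\to\infty}F_g(S_r).$$ Moreover, uniformly on $S_r$ as $r\to\infty$, $$\rho=\frac{(n-1)(n-2)}{r^2}-\frac{2(n-1)m}{r^n}+O(r^{-n-1}),\qquad H=\frac{n-1}r-\frac{(n-1)^2m}{(n-2)r^{n-1}}+O(r^{-n}).$$ (2) Suppose the coordinate system is harmonically flat, that is, $g_{ij}=U^{\frac4{n-2}}\delta_{ij}$ on $M\setminus K$ for a positive function $U$ that is harmonic with respect to the Euclidean Laplacian and satisfies $U(x)\to1$ as $|x|\to\infty$. Then the ADM mass exists and $m_{ADM}(M,g)=\lim_{r\to\infty}F_g(S_r)$. -/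

import Mathlib

open scoped Manifold ContDiff Topology
open Filter MeasureTheory

noncomputable section

namespace ADM

/-- Coordinate space `ℝᵐ` with its Euclidean norm. -/
abbrev Eu (m : ℕ) : Type := EuclideanSpace ℝ (Fin m)

/-- The unit sphere of `ℝᵈ⁺¹`, a smooth manifold of dimension `d`. -/
abbrev USphere (d : ℕ) : Type := Metric.sphere (0 : Eu (d + 1)) 1

/-- The `k`-th partial derivative `∂ₖ f`. -/
def pd {m : ℕ} (k : Fin m) (f : Eu m → ℝ) (x : Eu m) : ℝ :=
  fderiv ℝ f x (EuclideanSpace.single k 1)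

/-! ### Riemannian geometry in coordinates

A Riemannian metric on (an open set of) `ℝᵐ` is given by its matrix of components
`G x i j = g_{ij}(x)`. -/

/-- The field of components of a symmetric 2-tensor on `ℝᵐ`. -/
abbrev MetricField (m : ℕ) : Type := Eu m → Matrix (Fin m) (Fin m) ℝ

/-- Christoffel symbols
`Γᵏ_{ij} = ½ ∑ₗ gᵏˡ (∂ᵢ g_{jl} + ∂ⱼ g_{il} - ∂ₗ g_{ij})` of the Levi-Civita connection. -/
def christoffel {m : ℕ} (G : MetricField m) (k i j : Fin m) (x : Eu m) : ℝ :=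
  (1 / 2) * ∑ l, (G x)⁻¹ k l *
    (pd i (fun y => G y j l) x + pd j (fun y => G y i l) x - pd l (fun y => G y i j) x)

/-- Ricci curvature
`R_{ij} = ∂ₖ Γᵏ_{ij} - ∂ⱼ Γᵏ_{ik} + Γᵏ_{kl} Γˡ_{ij} - Γᵏ_{jl} Γˡ_{ik}` (summed over `k, l`). -/
def ricci {m : ℕ} (G : MetricField m) (i j : Fin m) (x : Eu m) : ℝ :=
  ∑ k, (pd k (christoffel G k i j) x - pd j (christoffel G k i k) x
    + ∑ l, (christoffel G k k l x * christoffel G l i j x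
      - christoffel G k j l x * christoffel G l i k x))

/-- Scalar curvature `gⁱʲ R_{ij}`; positive on round spheres of dimension at least two. -/
def scalarCurvature {m : ℕ} (G : MetricField m) (x : Eu m) : ℝ :=
  ∑ i, ∑ j, (G x)⁻¹ i j * ricci G i j x

/-- The components `γ_{ab} = ∑ g_{ij}(ψ) ∂ₐψⁱ ∂_bψʲ` of the pull-back `ψ^* g`; when `ψ` is a local
parametrization of a hypersurface this is the induced metric. -/
def pullback {d m : ℕ} (G : MetricField m) (ψ : Eu d → Eu m) : MetricField d :=
  fun y => Matrix.of fun a b =>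
    ∑ i, ∑ j, G (ψ y) i j * pd a (fun z => ψ z i) y * pd b (fun z => ψ z j) y

/-! ### Coordinate spheres

The points of `S_r = {|x| = r}` are written `r • θ` with `θ` in the unit sphere. -/

/-- The local parametrization of `S_r` near `r • θ`: the inverse of the stereographic chart at `θ`
of the unit sphere, followed by the dilation by `r`. -/
def sphereParam {d : ℕ} (r : ℝ) (θ : USphere d) : Eu d → Eu (d + 1) :=
  fun y => r • ((chartAt (Eu d) θ).symm y : Eu (d + 1))

/-- The intrinsic scalar curvature `ρ` at the point `r • θ` of `S_r`, for the metric induced on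
`S_r` by the ambient metric. -/
def sphereScalarCurvature {d : ℕ} (G : MetricField (d + 1)) (r : ℝ) (θ : USphere d) : ℝ :=
  scalarCurvature (pullback G (sphereParam r θ)) (chartAt (Eu d) θ θ)

/-- The components `νⁱ` of the outward `g`-unit normal field of the coordinate spheres: the
normalization of the vector that is `g`-dual to the conormal `∑ xⱼ dxʲ`. -/
def unitNormal {m : ℕ} (G : MetricField m) (i : Fin m) (x : Eu m) : ℝ :=
  (∑ j, (G x)⁻¹ i j * x j) / √(∑ k, ∑ l, (G x)⁻¹ k l * x k * x l)

/-- The components `(∇ᵢ ν)_l = ∑ₖ g_{lk} (∂ᵢ νᵏ + ∑ⱼ Γᵏ_{ij} νʲ)` of the covariant derivative of the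
unit normal field. On tangent vectors of a coordinate sphere, this is its second fundamental
form. -/
def covDerivNormal {m : ℕ} (G : MetricField m) (i l : Fin m) (x : Eu m) : ℝ :=
  ∑ k, G x l k * (pd i (unitNormal G k) x + ∑ j, christoffel G k i j x * unitNormal G j x)

/-- The mean curvature at `x` of the coordinate sphere through `x`: the trace of the second
fundamental form with respect to the induced metric (whose inverse, as a contravariant tensor of the
ambient space, is `gⁱˡ - νⁱ νˡ`). With this sign round spheres have positive mean curvature. -/
def meanCurvature {m : ℕ} (G : MetricField m) (x : Eu m) : ℝ :=
  ∑ i, ∑ l, ((G x)⁻¹ i l - unitNormal G i x * unitNormal G l x) * covDerivNormal G i l x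

/-- The standard (Euclidean) surface measure of the unit sphere. -/
def sphereMeasure (d : ℕ) : Measure (USphere d) := (volume : Measure (Eu (d + 1))).toSphere

/-- `ω_d`, the Euclidean area of the unit sphere of dimension `d`. -/
def unitSphereArea (d : ℕ) : ℝ := (sphereMeasure d).real Set.univ

/-- The integral `∫_{S_r} f dA` with respect to the Euclidean area element `dA` of `S_r`. -/
def sphereIntegral {d : ℕ} (r : ℝ) (f : Eu (d + 1) → ℝ) : ℝ :=
  r ^ d * ∫ θ : USphere d, f (r • (θ : Eu (d + 1))) ∂(sphereMeasure d)

/-- The density `dA_g / dA` at `x` of the area element which `g` induces on the coordinate sphere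
through `x`, relative to the Euclidean one: `√(det g · g⁻¹(n, n))` with `n = x / |x|`. By the cofactor
formula the radicand is the determinant of `g` on a Euclidean orthonormal basis of the tangent
space of the sphere. -/
def areaDensity {m : ℕ} (G : MetricField m) (x : Eu m) : ℝ :=
  √((G x).det * ∑ i, ∑ j, (G x)⁻¹ i j * (x i / ‖x‖) * (x j / ‖x‖))

/-- The `g`-area `|S_r|` of the coordinate sphere `S_r`. -/
def sphereArea {d : ℕ} (G : MetricField (d + 1)) (r : ℝ) : ℝ :=
  sphereIntegral r (areaDensity G)

/-- `F_g(S_r) = ½ (|S_r| / ω_{n-1})^{(n-2)/(n-1)} (1 - (n-2)/(n-1) · max H² / min ρ)`, with `n = d + 1`.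
(As soon as `S_r` lies in the domain of the coordinates and `ρ`, `H` are continuous on it, the
supremum and the infimum are a maximum and a minimum.) -/
def F {d : ℕ} (G : MetricField (d + 1)) (r : ℝ) : ℝ :=
  (1 / 2) * (sphereArea G r / unitSphereArea d) ^ (((d : ℝ) - 1) / d) *
    (1 - ((d : ℝ) - 1) / d *
      ((⨆ θ : USphere d, meanCurvature G (r • (θ : Eu (d + 1))) ^ 2) /
        (⨅ θ : USphere d, sphereScalarCurvature G r θ)))

/-- The ADM mass computed in the given coordinates exists and equals `μ`:
`μ = 1/(2(n-1)ω_{n-1}) lim_{r → ∞} ∫_{S_r} ∑_{i,j} (∂ᵢ g_{ij} - ∂ⱼ g_{ii}) xʲ/r dA`, `n = d + 1`. -/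
def HasADMMass {d : ℕ} (G : MetricField (d + 1)) (μ : ℝ) : Prop :=
  Tendsto (fun r : ℝ => 1 / (2 * (d : ℝ) * unitSphereArea d) *
    sphereIntegral (d := d) r (fun x => ∑ i, ∑ j,
      (pd i (fun y => G y i j) x - pd j (fun y => G y i i) x) * (x j / r)))
    atTop (𝓝 μ)

/-! ### Manifolds and coordinate systems at infinity -/

section Manifold

variable {d : ℕ} {H : Type*} [TopologicalSpace H] {I : ModelWithCorners ℝ (Eu (d + 1)) H}
  {M : Type*} [TopologicalSpace M] [ChartedSpace H M]

/-- `Φ` is a smooth coordinate system `M \ K → ℝⁿ \ B` at infinity: a diffeomorphism from the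
complement of a compact set onto the complement of a closed ball. -/
structure IsEndChart (I : ModelWithCorners ℝ (Eu (d + 1)) H)
    (Φ : OpenPartialHomeomorph M (Eu (d + 1))) : Prop where
  isCompact_compl : IsCompact Φ.sourceᶜ
  target_eq : ∃ (c : Eu (d + 1)) (R : ℝ), 0 < R ∧ Φ.target = (Metric.closedBall c R)ᶜ
  contMDiffOn : ContMDiffOn I (𝓡 (d + 1)) ∞ Φ Φ.source
  contMDiffOn_symm : ContMDiffOn (𝓡 (d + 1)) I ∞ Φ.symm Φ.target

/-- The components `g_{ij} = g(∂ᵢ, ∂ⱼ)` of the metric `g` of `M` in the coordinates `Φ`. -/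
def metricInChart [IsManifold I ∞ M]
    (g : Bundle.ContMDiffRiemannianMetric I ∞ (Eu (d + 1)) (fun p : M => TangentSpace I p))
    (Φ : OpenPartialHomeomorph M (Eu (d + 1))) : MetricField (d + 1) :=
  fun x => Matrix.of fun i j =>
    g.inner (Φ.symm x)
      (mfderiv (𝓡 (d + 1)) I Φ.symm x (EuclideanSpace.single i (1 : ℝ) : Eu (d + 1)))
      (mfderiv (𝓡 (d + 1)) I Φ.symm x (EuclideanSpace.single j (1 : ℝ) : Eu (d + 1)))

/-- The components `(1 + m / (2 |x|ⁿ⁻²))^{4/(n-2)} δ_{ij}` of the Schwarzschild metric of mass `m`,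
`n = d + 1`. -/
def schwarzschild (d : ℕ) (m : ℝ) : MetricField (d + 1) :=
  fun x => Matrix.of fun i j =>
    if i = j then (1 + m / (2 * ‖x‖ ^ (d - 1))) ^ (4 / ((d : ℝ) - 1)) else 0

/-- `Φ` is an asymptotically Schwarzschild coordinate system of `(M, g)` with constant `m`:
`h = g - g_Schwarzschild` satisfies, as `|x| → ∞`,
`h_{ij} = O(|x|¹⁻ⁿ)`, `∂ₖ h_{ij} = O(|x|⁻ⁿ)`, `∂ₖ ∂ₗ h_{ij} = O(|x|⁻ⁿ⁻¹)`, `n = d + 1`. -/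
structure IsAsymptoticallySchwarzschildChart [IsManifold I ∞ M]
    (g : Bundle.ContMDiffRiemannianMetric I ∞ (Eu (d + 1)) (fun p : M => TangentSpace I p))
    (Φ : OpenPartialHomeomorph M (Eu (d + 1))) (m : ℝ) : Prop where
  isEndChart : IsEndChart I Φ
  decay : ∀ i j, (fun x => metricInChart g Φ x i j - schwarzschild d m x i j)
    =O[Bornology.cobounded (Eu (d + 1))] fun x => ‖x‖ ^ (-(d : ℤ))
  decay_deriv : ∀ i j k, pd k (fun x => metricInChart g Φ x i j - schwarzschild d m x i j)
    =O[Bornology.cobounded (Eu (d + 1))] fun x => ‖x‖ ^ (-(d : ℤ) - 1)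
  decay_deriv₂ : ∀ i j k l,
    pd k (pd l (fun x => metricInChart g Φ x i j - schwarzschild d m x i j))
    =O[Bornology.cobounded (Eu (d + 1))] fun x => ‖x‖ ^ (-(d : ℤ) - 2)

/-- `Φ` is a harmonically flat coordinate system of `(M, g)`: `g_{ij} = U^{4/(n-2)} δ_{ij}` on `M \ K`
for a positive function `U`, harmonic for the Euclidean Laplacian, with `U(x) → 1` as `|x| → ∞`. -/
structure IsHarmonicallyFlatChart [IsManifold I ∞ M]
    (g : Bundle.ContMDiffRiemannianMetric I ∞ (Eu (d + 1)) (fun p : M => TangentSpace I p))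
    (Φ : OpenPartialHomeomorph M (Eu (d + 1))) : Prop where
  isEndChart : IsEndChart I Φ
  exists_factor : ∃ U : Eu (d + 1) → ℝ,
    InnerProductSpace.HarmonicOnNhd U Φ.target ∧ (∀ x ∈ Φ.target, 0 < U x) ∧
    Tendsto U (Bornology.cobounded (Eu (d + 1))) (𝓝 1) ∧
    ∀ x ∈ Φ.target, ∀ i j,
      metricInChart g Φ x i j = if i = j then U x ^ (4 / ((d : ℝ) - 1)) else 0

end Manifold

end ADM

end

noncomputable section

namespace ADM

/-! ### Smoothness of the metric components in a coordinate system at infinity. -/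

section Manifold

variable {d : ℕ} {H : Type*} [TopologicalSpace H] {I : ModelWithCorners ℝ (Eu (d + 1)) H}
  {M : Type*} [TopologicalSpace M] [ChartedSpace H M] [IsManifold I ∞ M]

/-! Write n = d + 1. Scalar and mean curvature are C¹ functions of finitely many derivatives of the
metric (`jetScalar`, `jetMean`). Rescale S_r to unit size: each derivative then costs a factor r,
which the decay hypotheses pay for exactly. So the rescaled jets of g differ from those of φ(|x|)δ,
with φ the Schwarzschild factor, by O(r^{-d}), and local Lipschitz bounds carry this error over to
the curvatures. The model is explicit. On S_r the factor φ(|x|) is constant, so the model induces a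
round metric and φr²ρ = d(d-1) + O(r^{-d}) (`ConformalDecay.isBigO_sphereScalarCurvature`). The
formula `meanCurvature_smul_one` gives rH = d(1 + rφ'/(2φ))/√φ + O(r^{-d})
(`ConformalDecay.isBigO_meanCurvature_sub`). Expanding in s = r^{-(d-1)}, where s² = O(r^{-d})
because d ≥ 2, yields both expansions.

In F the leading parts of max H² and min ρ cancel, and the bracket is 2ms + o(s)
(`ConformalDecay.tendsto_bracket`), so only the leading order ωr^d of the area matters. In the ADM
integrand the error is O(r^{-d-1}), while the radial model contributes -dφ' ~ 2dm r^{-d}.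

The harmonically flat case reduces to the asymptotically Schwarzschild one. Cut U - 1 off near the
core to get a global C² function W → 0 whose Laplacian has compact support. Green's identity against
a regularized and truncated Newtonian kernel shows that W is, up to a nonzero constant, the
Newtonian potential of its Laplacian (`newtonConst_mul_eq_integral`). Expanding the kernel at
infinity gives U = 1 + a|x|^{1-d} + O(|x|^{-d}) together with two derivatives
(`exists_decaysC2_of_harmonicAt`). Composing with t ↦ t^{4/(d-1)} keeps this decay
(`DecaysC2.comp_sub_comp`), so the metric is asymptotically Schwarzschild with m = 2a. -/

theorem contMDiffAt_mfderiv_const_apply {f : Eu (d + 1) → M} {x : Eu (d + 1)}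
    (hf : ContMDiffAt (𝓡 (d + 1)) I ∞ f x) (v : Eu (d + 1)) :
    ContMDiffAt (𝓡 (d + 1)) I.tangent ∞
      (fun y => (⟨f y, mfderiv (𝓡 (d + 1)) I f y v⟩ : TangentBundle I M)) x := by
  have h1 : ContMDiffAt (𝓡 (d + 1)) _ ∞ _ x := hf.mfderiv_const (m := ∞) (by simp)
  have h2 : ContMDiffAt (𝓡 (d + 1)) (𝓡 (d + 1)).tangent ∞
      (fun y : Eu (d + 1) => (⟨y, v⟩ : TangentBundle (𝓡 (d + 1)) (Eu (d + 1)))) x := by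
    rw [Bundle.contMDiffAt_totalSpace]
    refine ⟨contMDiffAt_id, ?_⟩
    simpa using contMDiffAt_const
  exact ContMDiffAt.clm_apply_of_inCoordinates (b₁ := id) (b₂ := f)
    (ϕ := fun y => mfderiv (𝓡 (d + 1)) I f y) h1 h2 hf

theorem IsEndChart.contDiffOn_metricInChart
    (g : Bundle.ContMDiffRiemannianMetric I ∞ (Eu (d + 1)) (fun p : M => TangentSpace I p))
    {Φ : OpenPartialHomeomorph M (Eu (d + 1))} (hΦ : IsEndChart I Φ) (i j : Fin (d + 1)) :
    ContDiffOn ℝ ∞ (fun x => metricInChart g Φ x i j) Φ.target := by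
  intro x hx
  have hs : ContMDiffAt (𝓡 (d + 1)) I ∞ Φ.symm x :=
    hΦ.contMDiffOn_symm.contMDiffAt (Φ.open_target.mem_nhds hx)
  have hg := g.contMDiff.contMDiffAt.comp x hs
  have h3 := ContMDiffAt.clm_bundle_apply₂ (F₁ := Eu (d + 1)) (F₂ := Eu (d + 1)) (F₃ := ℝ)
    (E₃ := Bundle.Trivial M ℝ) hg
    (contMDiffAt_mfderiv_const_apply hs (EuclideanSpace.single i (1 : ℝ)))
    (contMDiffAt_mfderiv_const_apply hs (EuclideanSpace.single j (1 : ℝ)))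
  rw [Bundle.contMDiffAt_totalSpace] at h3
  have h4 := h3.2
  exact (contMDiffAt_iff_contDiffAt.1 h4).contDiffWithinAt

end Manifold

/-! ### Calculus of partial derivatives -/

section PartialDerivatives

variable {m d : ℕ} {f g : Eu m → ℝ} {x : Eu m} {k : Fin m}

theorem pd_congr (h : f =ᶠ[𝓝 x] g) : pd k f x = pd k g x := by
  rw [pd, pd, h.fderiv_eq]

theorem pd_congr_nhds (h : f =ᶠ[𝓝 x] g) : pd k f =ᶠ[𝓝 x] pd k g :=
  h.eventually_nhds.mono fun _ => pd_congr

theorem pd_const (c : ℝ) : pd k (fun _ => c) x = 0 := by simp [pd]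

theorem pd_add (hf : DifferentiableAt ℝ f x) (hg : DifferentiableAt ℝ g x) :
    pd k (fun y => f y + g y) x = pd k f x + pd k g x := by
  simp [pd, fderiv_fun_add hf hg]

theorem pd_sub (hf : DifferentiableAt ℝ f x) (hg : DifferentiableAt ℝ g x) :
    pd k (fun y => f y - g y) x = pd k f x - pd k g x := by
  simp [pd, fderiv_fun_sub hf hg]

theorem pd_mul (hf : DifferentiableAt ℝ f x) (hg : DifferentiableAt ℝ g x) :
    pd k (fun y => f y * g y) x = pd k f x * g x + f x * pd k g x := by
  simp [pd, fderiv_fun_mul hf hg]; ring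

/-- No differentiability is needed: for c ≠ 0 both sides are differentiable or neither is, and then
both derivatives are the default value 0. This is why the scaling laws below hold for arbitrary
metric fields. -/
theorem pd_const_mul (c : ℝ) (f : Eu m → ℝ) (x : Eu m) :
    pd k (fun y => c * f y) x = c * pd k f x := by
  by_cases hc : c = 0
  · simp [hc, pd]
  by_cases hf : DifferentiableAt ℝ f x
  · simp [pd, fderiv_const_mul hf]
  · have : ¬ DifferentiableAt ℝ (fun y => c * f y) x := fun h => hf <| by
      simpa [hc] using h.const_mul c⁻¹
    simp [pd, fderiv_zero_of_not_differentiableAt, hf, this]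

theorem pd_sum {ι : Type*} (s : Finset ι) {f : ι → Eu m → ℝ}
    (hf : ∀ i ∈ s, DifferentiableAt ℝ (f i) x) :
    pd k (fun y => ∑ i ∈ s, f i y) x = ∑ i ∈ s, pd k (f i) x := by
  simp [pd, fderiv_fun_sum hf]

theorem pd_coord (i : Fin m) : pd k (fun y => y i) x = if i = k then 1 else 0 := by
  have : HasFDerivAt (fun y : Eu m => y i) (EuclideanSpace.proj i : Eu m →L[ℝ] ℝ) x :=
    (EuclideanSpace.proj i : Eu m →L[ℝ] ℝ).hasFDerivAt
  simp [pd, this.fderiv]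

theorem fderiv_apply_eq_sum_pd (f : Eu m → ℝ) (x v : Eu m) :
    fderiv ℝ f x v = ∑ k, v k * pd k f x := by
  conv_lhs => rw [← (EuclideanSpace.basisFun (Fin m) ℝ).sum_repr v]
  simp [pd, map_sum]

theorem pd_scomp {h : ℝ → ℝ} (hh : DifferentiableAt ℝ h (f x)) (hf : DifferentiableAt ℝ f x) :
    pd k (fun y => h (f y)) x = deriv h (f x) * pd k f x := by
  have := (hh.hasDerivAt.comp_hasFDerivAt x hf.hasFDerivAt).fderiv
  simp only [Function.comp_def] at this
  simp [pd, this]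

theorem pd_comp_smul (r : ℝ) (f : Eu m → ℝ) (x : Eu m) :
    pd k (fun y => f (r • y)) x = r * pd k f (r • x) := by
  simp [pd, fderiv_comp_smul]

theorem pd_norm_sq : pd k (fun y : Eu m => ‖y‖ ^ 2) x = 2 * x k := by
  have := (hasStrictFDerivAt_norm_sq x).hasFDerivAt.fderiv
  simp [pd, this, EuclideanSpace.inner_single_right]

theorem contDiffAt_pd {n : ℕ∞ω} {n' : ℕ∞ω} (hf : ContDiffAt ℝ n f x) (h : n' + 1 ≤ n)
    (k : Fin m) : ContDiffAt ℝ n' (pd k f) x :=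
  (hf.fderiv_right h).clm_apply contDiffAt_const

theorem pd_comp {ψ : Eu d → Eu m} {y : Eu d} (a : Fin d) (hf : DifferentiableAt ℝ f (ψ y))
    (hψ : DifferentiableAt ℝ ψ y) :
    pd a (fun z => f (ψ z)) y = ∑ l, pd l f (ψ y) * pd a (fun z => ψ z l) y := by
  have h1 := (hf.hasFDerivAt.comp y hψ.hasFDerivAt).fderiv
  simp only [Function.comp_def] at h1
  have h2 (l : Fin m) : pd a (fun z => ψ z l) y =
      fderiv ℝ ψ y (EuclideanSpace.single a 1) l := by
    have := ((EuclideanSpace.proj l : Eu m →L[ℝ] ℝ).hasFDerivAt.comp y hψ.hasFDerivAt).fderiv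
    simp only [Function.comp_def, PiLp.proj_apply] at this
    simp [pd, this]
  simp only [h2]
  rw [pd, h1, ContinuousLinearMap.comp_apply, fderiv_apply_eq_sum_pd]
  simp [mul_comm]

end PartialDerivatives

/-! ### Curvatures as smooth functions of jets of the metric -/

section Jets

variable {m : ℕ}

/-- Values of a 2-tensor at a point. -/
abbrev Jet0 (m : ℕ) : Type := Fin m → Fin m → ℝ

/-- First derivatives of a 2-tensor at a point; the first index is the direction. -/
abbrev Jet1 (m : ℕ) : Type := Fin m → Jet0 m

/-- Second derivatives of a 2-tensor at a point; the first two indices are the directions. -/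
abbrev Jet2 (m : ℕ) : Type := Fin m → Jet1 m

def jet0 (G : MetricField m) (x : Eu m) : Jet0 m := fun i j => G x i j

def jet1 (G : MetricField m) (x : Eu m) : Jet1 m := fun k i j => pd k (fun y => G y i j) x

def jet2 (G : MetricField m) (x : Eu m) : Jet2 m :=
  fun k l i j => pd k (pd l fun y => G y i j) x

/-- The Christoffel symbols as functions of the jet. -/
def jetChristoffel (k i j : Fin m) (p : Jet0 m × Jet1 m) : ℝ :=
  (1 / 2) * ∑ l, (Matrix.of p.1)⁻¹ k l * (p.2 i j l + p.2 j i l - p.2 l i j)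

/-- The scalar curvature as a function of the jet. -/
def jetScalar (q : (Jet0 m × Jet1 m) × Jet2 m) : ℝ :=
  ∑ i, ∑ j, (Matrix.of q.1.1)⁻¹ i j *
    ∑ k, (fderiv ℝ (jetChristoffel k i j) q.1 (q.1.2 k, q.2 k)
        - fderiv ℝ (jetChristoffel k i k) q.1 (q.1.2 j, q.2 j)
      + ∑ l, (jetChristoffel k k l q.1 * jetChristoffel l i j q.1
        - jetChristoffel k j l q.1 * jetChristoffel l i k q.1))

/-- The unit normal as a function of the metric and the point. -/
def jetNormal (i : Fin m) (p : Jet0 m × Eu m) : ℝ :=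
  (∑ j, (Matrix.of p.1)⁻¹ i j * p.2 j) / √(∑ k, ∑ l, (Matrix.of p.1)⁻¹ k l * p.2 k * p.2 l)

/-- The mean curvature of the coordinate sphere as a function of the jet and the point. -/
def jetMean (q : (Jet0 m × Jet1 m) × Eu m) : ℝ :=
  ∑ i, ∑ l, ((Matrix.of q.1.1)⁻¹ i l - jetNormal i (q.1.1, q.2) * jetNormal l (q.1.1, q.2)) *
    ∑ k, q.1.1 l k * (fderiv ℝ (jetNormal k) (q.1.1, q.2) (q.1.2 i, EuclideanSpace.single i 1)
      + ∑ j, jetChristoffel k i j q.1 * jetNormal j (q.1.1, q.2))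

theorem contDiff_det {E : Type*} [NormedAddCommGroup E] [NormedSpace ℝ E] {n : ℕ∞ω}
    {A : E → Matrix (Fin m) (Fin m) ℝ} (h : ∀ i j, ContDiff ℝ n fun e => A e i j) :
    ContDiff ℝ n fun e => (A e).det := by
  simp only [Matrix.det_apply]
  exact ContDiff.sum fun σ _ => (contDiff_prod fun i _ => h _ _).const_smul _

/-- Cramer's rule: the entries are cofactors, polynomial in the metric, divided by the determinant.
-/
theorem contDiffAt_inv_apply {n : ℕ∞ω} {P : Jet0 m} (hP : (Matrix.of P).det ≠ 0) (k l : Fin m) :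
    ContDiffAt ℝ n (fun P : Jet0 m => (Matrix.of P)⁻¹ k l) P := by
  have h0 : ∀ i j, ContDiff ℝ n fun P : Jet0 m => Matrix.of P i j := fun i j => by
    simp only [Matrix.of_apply]; fun_prop
  have h1 : ContDiff ℝ n fun P : Jet0 m => (Matrix.of P).adjugate k l := by
    simp only [Matrix.adjugate_apply]
    refine contDiff_det fun i j => ?_
    simp only [Matrix.updateRow_apply]
    split_ifs
    · exact contDiff_const
    · exact h0 i j
  simp only [Matrix.inv_def, Ring.inverse_eq_inv', Matrix.smul_apply, smul_eq_mul]
  exact ((contDiff_det h0).contDiffAt.inv hP).mul h1.contDiffAt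

theorem contDiffAt_jetChristoffel {n : ℕ∞ω} {p : Jet0 m × Jet1 m}
    (hp : (Matrix.of p.1).det ≠ 0) (k i j : Fin m) : ContDiffAt ℝ n (jetChristoffel k i j) p := by
  unfold jetChristoffel
  refine contDiffAt_const.mul (ContDiffAt.sum fun l _ => ContDiffAt.mul ?_ (by fun_prop))
  exact (contDiffAt_inv_apply hp k l).comp p contDiffAt_fst

/-- C¹ is exactly what is used later: it turns an error in the jet into an error of the same order
in the curvature. -/
theorem contDiffAt_jetScalar {q : (Jet0 m × Jet1 m) × Jet2 m}
    (hq : (Matrix.of q.1.1).det ≠ 0) : ContDiffAt ℝ 1 jetScalar q := by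
  have hC (k i j : Fin m) : ContDiffAt ℝ 1
      (fun q : (Jet0 m × Jet1 m) × Jet2 m => jetChristoffel k i j q.1) q :=
    (contDiffAt_jetChristoffel hq k i j).comp q contDiffAt_fst
  have hF (k i j l : Fin m) : ContDiffAt ℝ 1 (fun q : (Jet0 m × Jet1 m) × Jet2 m =>
      fderiv ℝ (jetChristoffel k i j) q.1 (q.1.2 l, q.2 l)) q := by
    refine ContDiffAt.clm_apply ?_ (by fun_prop)
    exact ((contDiffAt_jetChristoffel (n := 2) hq k i j).fderiv_right
      (m := 1) (by norm_num)).comp q contDiffAt_fst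
  unfold jetScalar
  refine ContDiffAt.sum fun i _ => ContDiffAt.sum fun j _ => ContDiffAt.mul ?_ ?_
  · exact (contDiffAt_inv_apply hq i j).comp q (contDiffAt_fst.comp q contDiffAt_fst)
  · exact ContDiffAt.sum fun k _ => ((hF _ _ _ _).sub (hF _ _ _ _)).add
      (ContDiffAt.sum fun l _ => ((hC _ _ _).mul (hC _ _ _)).sub ((hC _ _ _).mul (hC _ _ _)))

theorem contDiffAt_jetNormal {n : ℕ∞ω} {p : Jet0 m × Eu m} (hp : (Matrix.of p.1).det ≠ 0)
    (hp' : 0 < ∑ k, ∑ l, (Matrix.of p.1)⁻¹ k l * p.2 k * p.2 l) (i : Fin m) :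
    ContDiffAt ℝ n (jetNormal i) p := by
  have hI (k l : Fin m) : ContDiffAt ℝ n (fun p : Jet0 m × Eu m => (Matrix.of p.1)⁻¹ k l) p :=
    (contDiffAt_inv_apply hp k l).comp p contDiffAt_fst
  have hx (k : Fin m) : ContDiffAt ℝ n (fun p : Jet0 m × Eu m => p.2 k) p := by fun_prop
  unfold jetNormal
  refine ContDiffAt.div (ContDiffAt.sum fun j _ => (hI _ _).mul (hx _)) ?_
    (Real.sqrt_ne_zero'.2 hp')
  exact ContDiffAt.sqrt (ContDiffAt.sum fun k _ => ContDiffAt.sum fun l _ =>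
    ((hI _ _).mul (hx _)).mul (hx _)) hp'.ne'

theorem contDiffAt_jetMean {q : (Jet0 m × Jet1 m) × Eu m}
    (hq : (Matrix.of q.1.1).det ≠ 0)
    (hq' : 0 < ∑ k, ∑ l, (Matrix.of q.1.1)⁻¹ k l * q.2 k * q.2 l) : ContDiffAt ℝ 1 jetMean q := by
  have hπ : ContDiffAt ℝ 1 (fun q : (Jet0 m × Jet1 m) × Eu m => (q.1.1, q.2)) q := by fun_prop
  have hN (i : Fin m) : ContDiffAt ℝ 1
      (fun q : (Jet0 m × Jet1 m) × Eu m => jetNormal i (q.1.1, q.2)) q :=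
    (contDiffAt_jetNormal (p := (q.1.1, q.2)) hq hq' i).comp (g := jetNormal i)
      (f := fun q : (Jet0 m × Jet1 m) × Eu m => (q.1.1, q.2)) q hπ
  have hC (k i j : Fin m) : ContDiffAt ℝ 1
      (fun q : (Jet0 m × Jet1 m) × Eu m => jetChristoffel k i j q.1) q :=
    (contDiffAt_jetChristoffel hq k i j).comp q contDiffAt_fst
  have hI (k l : Fin m) : ContDiffAt ℝ 1
      (fun q : (Jet0 m × Jet1 m) × Eu m => (Matrix.of q.1.1)⁻¹ k l) q :=
    (contDiffAt_inv_apply hq k l).comp q (contDiffAt_fst.comp q contDiffAt_fst)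
  have hF (k i : Fin m) : ContDiffAt ℝ 1 (fun q : (Jet0 m × Jet1 m) × Eu m =>
      fderiv ℝ (jetNormal k) (q.1.1, q.2) (q.1.2 i, EuclideanSpace.single i 1)) q := by
    refine ContDiffAt.clm_apply ?_ (by fun_prop)
    exact ((contDiffAt_jetNormal (n := 2) (p := (q.1.1, q.2)) hq hq' k).fderiv_right
      (m := 1) (by norm_num)).comp q hπ
  unfold jetMean
  refine ContDiffAt.sum fun i _ => ContDiffAt.sum fun l _ => ContDiffAt.mul ?_ ?_
  · exact (hI _ _).sub ((hN _).mul (hN _))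
  · exact ContDiffAt.sum fun k _ => ContDiffAt.mul (by fun_prop) ((hF _ _).add
      (ContDiffAt.sum fun j _ => (hC _ _ _).mul (hN _)))

theorem hasFDerivAt_jet0 {G : MetricField m} {x : Eu m}
    (hG : ∀ i j, DifferentiableAt ℝ (fun y => G y i j) x) (k : Fin m) :
    DifferentiableAt ℝ (jet0 G) x ∧ fderiv ℝ (jet0 G) x (EuclideanSpace.single k 1) = jet1 G x k := by
  have h : DifferentiableAt ℝ (jet0 G) x :=
    differentiableAt_pi.2 fun i => differentiableAt_pi.2 fun j => hG i j
  refine ⟨h, ?_⟩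
  ext i j
  have h1 := ((ContinuousLinearMap.proj (R := ℝ) (φ := fun _ : Fin m => ℝ) j).hasFDerivAt.comp x
    ((ContinuousLinearMap.proj (R := ℝ) (φ := fun _ : Fin m => Fin m → ℝ) i).hasFDerivAt.comp x
      h.hasFDerivAt)).fderiv
  change fderiv ℝ (fun y => G y i j) x = _ at h1
  simp [jet1, pd, h1]

theorem hasFDerivAt_jet1 {G : MetricField m} {x : Eu m}
    (hG : ∀ i j, ContDiffAt ℝ 2 (fun y => G y i j) x) (k : Fin m) :
    DifferentiableAt ℝ (jet1 G) x ∧ fderiv ℝ (jet1 G) x (EuclideanSpace.single k 1) = jet2 G x k := by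
  have h (l : Fin m) := hasFDerivAt_jet0 (G := fun y => Matrix.of (jet1 G y l)) (x := x)
    (fun i j => (contDiffAt_pd (n' := 1) (hG i j) (by norm_num) l).differentiableAt (by norm_num)) k
  have h' : DifferentiableAt ℝ (jet1 G) x := differentiableAt_pi.2 fun l => (h l).1
  refine ⟨h', ?_⟩
  ext l i j
  have h1 := ((ContinuousLinearMap.proj (R := ℝ) (φ := fun _ : Fin m => Jet0 m) l).hasFDerivAt.comp
    x h'.hasFDerivAt).fderiv
  have h2 := congrFun (congrFun (h l).2 i) j
  change fderiv ℝ (fun y => jet1 G y l) x = _ at h1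
  change fderiv ℝ (fun y => jet1 G y l) x _ i j = _ at h2
  rw [h1] at h2
  exact h2

/-- Chain rule: the Christoffel symbols are `jetChristoffel` composed with x ↦ (g, ∂g), and the
derivative of this map in direction l is (∂ₗg, ∂ₗ∂g). -/
theorem scalarCurvature_eq_jetScalar {G : MetricField m} {x : Eu m}
    (hG : ∀ i j, ContDiffAt ℝ 2 (fun y => G y i j) x) (hx : (G x).det ≠ 0) :
    scalarCurvature G x = jetScalar ((jet0 G x, jet1 G x), jet2 G x) := by
  have h (k i j l : Fin m) : pd l (christoffel G k i j) x =
      fderiv ℝ (jetChristoffel k i j) (jet0 G x, jet1 G x) (jet1 G x l, jet2 G x l) := by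
    have h0 := hasFDerivAt_jet0 (x := x) (fun i j => (hG i j).differentiableAt (by norm_num)) l
    have h1 := hasFDerivAt_jet1 hG l
    have h2 : HasFDerivAt (jetChristoffel k i j) _ (jet0 G x, jet1 G x) :=
      ((contDiffAt_jetChristoffel (n := 1) (p := (jet0 G x, jet1 G x)) hx k i j).differentiableAt
      (by norm_num)).hasFDerivAt
    have h3 := (h2.comp x (h0.1.hasFDerivAt.prodMk h1.1.hasFDerivAt)).fderiv
    change fderiv ℝ (christoffel G k i j) x = _ at h3
    rw [pd, h3, ContinuousLinearMap.comp_apply, ContinuousLinearMap.prod_apply, h0.2, h1.2]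
  simp only [scalarCurvature, ricci, h]
  rfl

/-- Same chain rule for the normal. The position x is an independent argument here, and its
derivative in direction l is the basis vector eₗ. -/
theorem meanCurvature_eq_jetMean {G : MetricField m} {x : Eu m}
    (hG : ∀ i j, DifferentiableAt ℝ (fun y => G y i j) x) (hx : (G x).det ≠ 0)
    (hx' : 0 < ∑ k, ∑ l, (G x)⁻¹ k l * x k * x l) :
    meanCurvature G x = jetMean ((jet0 G x, jet1 G x), x) := by
  have h (k l : Fin m) : pd l (unitNormal G k) x =
      fderiv ℝ (jetNormal k) (jet0 G x, x) (jet1 G x l, EuclideanSpace.single l 1) := by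
    have h0 := hasFDerivAt_jet0 (x := x) hG l
    have h2 : HasFDerivAt (jetNormal k) _ (jet0 G x, x) :=
      ((contDiffAt_jetNormal (n := 1) (p := (jet0 G x, x)) hx hx' k).differentiableAt
      (by norm_num)).hasFDerivAt
    have h3 := (h2.comp (f := fun y => (jet0 G y, id y)) x
      (h0.1.hasFDerivAt.prodMk (hasFDerivAt_id x))).fderiv
    change fderiv ℝ (unitNormal G k) x = _ at h3
    rw [pd, h3, ContinuousLinearMap.comp_apply, ContinuousLinearMap.prod_apply, h0.2]
    simp
  simp only [meanCurvature, covDerivNormal, h]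
  rfl

end Jets

/-! ### Scaling and model metrics -/

section Models

variable {m : ℕ}

/-- Valid for singular A too, since both inverses are then 0 by convention. -/
theorem inv_smul_of_ne_zero {c : ℝ} (hc : c ≠ 0) (A : Matrix (Fin m) (Fin m) ℝ) :
    (c • A)⁻¹ = c⁻¹ • A⁻¹ := by
  by_cases hA : IsUnit A.det
  · have := invertibleOfNonzero hc
    rw [Matrix.inv_smul _ c hA, invOf_eq_inv]
  · have : ¬ IsUnit (c • A).det := by
      rw [isUnit_iff_ne_zero] at hA ⊢
      simpa [Matrix.det_smul, hc] using hA
    rw [Matrix.nonsing_inv_apply_not_isUnit _ hA, Matrix.nonsing_inv_apply_not_isUnit _ this,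
      smul_zero]

theorem christoffel_smul {c : ℝ} (hc : c ≠ 0) (G : MetricField m) (k i j : Fin m) :
    christoffel (fun y => c • G y) k i j = christoffel G k i j := by
  ext x
  simp only [christoffel, inv_smul_of_ne_zero hc, Matrix.smul_apply, smul_eq_mul, pd_const_mul]
  congr 1
  refine Finset.sum_congr rfl fun l _ => ?_
  field_simp

theorem scalarCurvature_smul {c : ℝ} (hc : c ≠ 0) (G : MetricField m) (x : Eu m) :
    scalarCurvature (fun y => c • G y) x = c⁻¹ * scalarCurvature G x := by
  simp only [scalarCurvature, ricci, christoffel_smul hc, inv_smul_of_ne_zero hc,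
    Matrix.smul_apply, smul_eq_mul, Finset.mul_sum, mul_assoc]

theorem unitNormal_comp_smul {r : ℝ} (hr : 0 < r) (G : MetricField m) (i : Fin m) :
    unitNormal (fun y => G (r • y)) i = fun y => unitNormal G i (r • y) := by
  ext y
  have h1 : ∑ j, (G (r • y))⁻¹ i j * (r • y) j = r * ∑ j, (G (r • y))⁻¹ i j * y j := by
    rw [Finset.mul_sum]
    exact Finset.sum_congr rfl fun j _ => by simp; ring
  have h2 : ∑ k, ∑ l, (G (r • y))⁻¹ k l * (r • y) k * (r • y) l =
      r ^ 2 * ∑ k, ∑ l, (G (r • y))⁻¹ k l * y k * y l := by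
    simp only [Finset.mul_sum]
    exact Finset.sum_congr rfl fun j _ => Finset.sum_congr rfl fun j _ => by simp; ring
  rw [unitNormal, unitNormal, h1, h2, Real.sqrt_mul (by positivity), Real.sqrt_sq hr.le,
    mul_div_mul_left _ _ hr.ne']

theorem christoffel_comp_smul (r : ℝ) (G : MetricField m) (k i j : Fin m) (x : Eu m) :
    christoffel (fun y => G (r • y)) k i j x = r * christoffel G k i j (r • x) := by
  have h (i j k : Fin m) := pd_comp_smul (k := k) r (fun y => G y i j) x
  simp only [christoffel, h, Finset.mul_sum]
  exact Finset.sum_congr rfl fun l _ => by ring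

/-- Moves the computation on S_r to the unit sphere, a fixed compact set. The components are only
precomposed with the dilation and not multiplied by r², so H scales by r. -/
theorem meanCurvature_comp_smul {r : ℝ} (hr : 0 < r) (G : MetricField m) (x : Eu m) :
    meanCurvature (fun y => G (r • y)) x = r * meanCurvature G (r • x) := by
  simp only [meanCurvature, covDerivNormal, unitNormal_comp_smul hr, christoffel_comp_smul,
    pd_comp_smul, Finset.mul_sum]
  refine Finset.sum_congr rfl fun i _ => Finset.sum_congr rfl fun l _ =>
    Finset.sum_congr rfl fun k _ => ?_
  rw [mul_left_comm r, mul_left_comm r, mul_add r, Finset.mul_sum]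
  simp only [mul_assoc]

theorem sum_sq_coord (x : Eu m) : ∑ i, x i * x i = ‖x‖ ^ 2 := by
  rw [EuclideanSpace.norm_sq_eq]; simp [sq]

theorem smul_one_inv {c : ℝ} (hc : c ≠ 0) :
    (c • (1 : Matrix (Fin m) (Fin m) ℝ))⁻¹ = c⁻¹ • 1 := by
  rw [inv_smul_of_ne_zero hc, inv_one]

/-- The mean curvature of coordinate spheres for a conformally flat metric whose factor has radial
gradient. -/
theorem meanCurvature_smul_one {u : Eu m → ℝ} {x : Eu m} (hx : x ≠ 0)
    (hu : DifferentiableAt ℝ u x) (hpos : 0 < u x) {b : ℝ} (hb : ∀ k, pd k u x = b * x k) :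
    meanCurvature (fun y => u y • (1 : Matrix (Fin m) (Fin m) ℝ)) x =
      (m - 1) * ((1 + b * ‖x‖ ^ 2 / (2 * u x)) / √(u x * ‖x‖ ^ 2)) := by
  have hρ : 0 < ‖x‖ ^ 2 := by positivity
  set q : Eu m → ℝ := fun y => u y * ‖y‖ ^ 2 with hq
  have hqx : 0 < q x := mul_pos hpos hρ
  have hn (i : Fin m) : unitNormal (fun y => u y • (1 : Matrix (Fin m) (Fin m) ℝ)) i
      =ᶠ[𝓝 x] fun y => y i * (√(q y))⁻¹ := by
    filter_upwards [hu.continuousAt.eventually (lt_mem_nhds hpos), eventually_ne_nhds hx] with y hy hy0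
    have : 0 < ‖y‖ := by positivity
    have h2 : ∑ k, ∑ l, (u y)⁻¹ * (1 : Matrix (Fin m) (Fin m) ℝ) k l * y k * y l
        = (u y)⁻¹ ^ 2 * q y := by
      simp only [Matrix.one_apply, mul_ite, mul_one, mul_zero, ite_mul, zero_mul,
        Finset.sum_ite_eq, Finset.mem_univ, if_true, mul_assoc, ← Finset.mul_sum, sum_sq_coord, hq]
      field_simp
    simp only [unitNormal, smul_one_inv hy.ne', Matrix.smul_apply, smul_eq_mul, h2]
    rw [Real.sqrt_mul (by positivity), Real.sqrt_sq (by positivity)]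
    simp [Matrix.one_apply]
    field_simp
  have hsq : DifferentiableAt ℝ (fun y : Eu m => ‖y‖ ^ 2) x := differentiableAt_id.norm_sq ℝ
  have hqd : DifferentiableAt ℝ q x := hu.mul hsq
  have hqp (i : Fin m) : pd i q x = (b * ‖x‖ ^ 2 + 2 * u x) * x i := by
    rw [hq, pd_mul hu hsq, pd_norm_sq, hb]; ring
  have hs : HasDerivAt (fun t : ℝ => (√t)⁻¹) (-(1 / (2 * √(q x))) / √(q x) ^ 2) (q x) :=
    (Real.hasDerivAt_sqrt hqx.ne').inv (by positivity)
  have hpn (i k : Fin m) : pd i (fun y => y k * (√(q y))⁻¹) x = (if k = i then 1 else 0) * (√(q x))⁻¹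
      - x k * ((1 / (2 * √(q x))) / q x * ((b * ‖x‖ ^ 2 + 2 * u x) * x i)) := by
    rw [pd_mul (f := fun y => y k) (g := fun y => (√(q y))⁻¹) (by fun_prop)
      (hs.differentiableAt.comp x hqd), pd_coord,
      pd_scomp hs.differentiableAt hqd, hs.deriv, hqp, Real.sq_sqrt hqx.le]
    ring
  have hC (k i j : Fin m) : christoffel (fun y => u y • (1 : Matrix (Fin m) (Fin m) ℝ)) k i j x =
      (1 / 2) * (u x)⁻¹ * b * (x i * (if j = k then 1 else 0) + x j * (if i = k then 1 else 0)
        - x k * (if i = j then 1 else 0)) := by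
    have (i j k : Fin m) : pd k (fun y => u y * (1 : Matrix (Fin m) (Fin m) ℝ) i j) x =
        b * x k * (if i = j then 1 else 0) := by
      simp_rw [mul_comm (u _)]
      rw [pd_const_mul, hb, Matrix.one_apply, mul_comm]
    simp only [christoffel, smul_one_inv hpos.ne', Matrix.smul_apply, smul_eq_mul, this]
    simp only [Matrix.one_apply, mul_ite, mul_one, mul_zero, ite_mul, zero_mul,
        Finset.sum_ite_eq, Finset.mem_univ, if_true]
    split_ifs <;> ring
  have hΓν (k i : Fin m) : ∑ j, christoffel (fun y => u y • (1 : Matrix (Fin m) (Fin m) ℝ)) k i j x *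
      (x j * (√(q x))⁻¹) =
      (1 / 2) * (u x)⁻¹ * b * (√(q x))⁻¹ * ‖x‖ ^ 2 * (if k = i then 1 else 0) := by
    simp only [hC, ← sum_sq_coord]
    have : ∀ j, (1 / 2) * (u x)⁻¹ * b * (x i * (if j = k then 1 else 0) +
        x j * (if i = k then 1 else 0) - x k * (if i = j then 1 else 0)) * (x j * (√(q x))⁻¹) =
        (1 / 2) * (u x)⁻¹ * b * (√(q x))⁻¹ * (x i * (if j = k then x j else 0) +
        (if i = k then 1 else 0) * (x j * x j) - x k * (if i = j then x j else 0)) := fun j => by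
      split_ifs <;> ring
    simp only [this, ← Finset.mul_sum, Finset.sum_sub_distrib, Finset.sum_add_distrib,
      Finset.sum_ite_eq', Finset.sum_ite_eq, Finset.mem_univ, if_true, eq_comm (a := k)]
    split_ifs <;> ring
  -- A is the common principal curvature of the tangential directions; B collects the purely radial
  -- part, which the trace will not see.
  set A : ℝ := (√(q x))⁻¹ * (1 + b * ‖x‖ ^ 2 / (2 * u x)) with hA
  set B : ℝ := (1 / (2 * √(q x))) / q x * (b * ‖x‖ ^ 2 + 2 * u x) with hB
  have hcov (i l : Fin m) : covDerivNormal (fun y => u y • (1 : Matrix (Fin m) (Fin m) ℝ)) i l x =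
      u x * ((if i = l then A else 0) - B * (x i * x l)) := by
    simp only [covDerivNormal, pd_congr (hn _), (hn _).eq_of_nhds, hpn, hΓν]
    simp only [Matrix.smul_apply, Matrix.one_apply, smul_eq_mul, mul_ite, mul_one, mul_zero,
      ite_mul, zero_mul, Finset.sum_ite_eq, Finset.mem_univ, if_true]
    simp only [eq_comm (a := l) (b := i)]
    split_ifs
    · rw [hA, hB]; field_simp; ring
    · rw [hB]; ring
  have hprod (i l : Fin m) : ((u x)⁻¹ * (if i = l then 1 else 0) -
      x i * (√(q x))⁻¹ * (x l * (√(q x))⁻¹)) * (u x * ((if i = l then A else 0) - B * (x i * x l)))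
      = (if i = l then A - B * (x i * x l) - (q x)⁻¹ * (x i * x l) * u x * A else 0) +
        (q x)⁻¹ * u x * B * ((x i * x i) * (x l * x l)) := by
    have h5 : x i * (√(q x))⁻¹ * (x l * (√(q x))⁻¹) = (q x)⁻¹ * (x i * x l) := by
      rw [mul_mul_mul_comm, ← mul_inv, Real.mul_self_sqrt hqx.le]; ring
    rw [h5]
    split_ifs <;> field_simp <;> ring
  simp only [meanCurvature, hcov, (hn _).eq_of_nhds, smul_one_inv hpos.ne', Matrix.smul_apply,
    Matrix.one_apply, smul_eq_mul, hprod, Finset.sum_add_distrib, Finset.sum_ite_eq,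
    Finset.mem_univ, if_true]
  simp only [← Finset.mul_sum, Finset.sum_sub_distrib, ← Finset.sum_mul, sum_sq_coord]
  simp only [Finset.sum_const, Finset.card_univ, Fintype.card_fin, nsmul_eq_mul]
  -- This is |ν|_g = 1. It makes the B terms cancel and removes one of the m copies of A.
  have : (q x)⁻¹ * ‖x‖ ^ 2 * u x = 1 := by simp only [hq]; field_simp
  have e : A = (1 + b * ‖x‖ ^ 2 / (2 * u x)) / √(u x * ‖x‖ ^ 2) := by rw [hA]; ring
  rw [← e]
  linear_combination (B * ‖x‖ ^ 2 - A) * this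

end Models

/-! ### Second partial derivatives and asymptotics of jets -/

section SecondDerivatives

variable {m d : ℕ} {f g : Eu m → ℝ} {x : Eu m}

theorem contDiffAt_eventually_differentiableAt (hf : ContDiffAt ℝ 2 f x) :
    ∀ᶠ y in 𝓝 x, DifferentiableAt ℝ f y :=
  (hf.eventually (by simp)).mono fun _ h => h.differentiableAt (by norm_num)

theorem differentiableAt_pd (hf : ContDiffAt ℝ 2 f x) (k : Fin m) :
    DifferentiableAt ℝ (pd k f) x :=
  (contDiffAt_pd (n' := 1) hf (by norm_num) k).differentiableAt (by norm_num)

theorem pd_pd_mul (hf : ContDiffAt ℝ 2 f x) (hg : ContDiffAt ℝ 2 g x) (k l : Fin m) :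
    pd k (pd l fun y => f y * g y) x = pd k (pd l f) x * g x + pd l f x * pd k g x +
      (pd k f x * pd l g x + f x * pd k (pd l g) x) := by
  have hf1 := hf.differentiableAt (by norm_num)
  have hg1 := hg.differentiableAt (by norm_num)
  have h : pd l (fun y => f y * g y) =ᶠ[𝓝 x] fun y => pd l f y * g y + f y * pd l g y := by
    filter_upwards [contDiffAt_eventually_differentiableAt hf,
      contDiffAt_eventually_differentiableAt hg] with y h1 h2 using pd_mul h1 h2
  rw [pd_congr h, pd_add ((differentiableAt_pd hf l).fun_mul hg1) (hf1.fun_mul (differentiableAt_pd hg l)),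
    pd_mul (differentiableAt_pd hf l) hg1, pd_mul hf1 (differentiableAt_pd hg l)]

theorem pd_pd_add (hf : ContDiffAt ℝ 2 f x) (hg : ContDiffAt ℝ 2 g x) (k l : Fin m) :
    pd k (pd l fun y => f y + g y) x = pd k (pd l f) x + pd k (pd l g) x := by
  have h : pd l (fun y => f y + g y) =ᶠ[𝓝 x] fun y => pd l f y + pd l g y := by
    filter_upwards [contDiffAt_eventually_differentiableAt hf,
      contDiffAt_eventually_differentiableAt hg] with y h1 h2 using pd_add h1 h2
  rw [pd_congr h, pd_add (differentiableAt_pd hf l) (differentiableAt_pd hg l)]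

theorem pd_pd_sub (hf : ContDiffAt ℝ 2 f x) (hg : ContDiffAt ℝ 2 g x) (k l : Fin m) :
    pd k (pd l fun y => f y - g y) x = pd k (pd l f) x - pd k (pd l g) x := by
  have h : pd l (fun y => f y - g y) =ᶠ[𝓝 x] fun y => pd l f y - pd l g y := by
    filter_upwards [contDiffAt_eventually_differentiableAt hf,
      contDiffAt_eventually_differentiableAt hg] with y h1 h2 using pd_sub h1 h2
  rw [pd_congr h, pd_sub (differentiableAt_pd hf l) (differentiableAt_pd hg l)]

theorem pd_pd_const_mul (c : ℝ) (f : Eu m → ℝ) (x : Eu m) (k l : Fin m) :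
    pd k (pd l fun y => c * f y) x = c * pd k (pd l f) x := by
  have h : pd l (fun y => c * f y) = fun y => c * pd l f y := funext fun y => pd_const_mul c f y
  rw [h, pd_const_mul]

theorem pd_pd_sum {ι : Type*} (s : Finset ι) {f : ι → Eu m → ℝ}
    (hf : ∀ i ∈ s, ContDiffAt ℝ 2 (f i) x) (k l : Fin m) :
    pd k (pd l fun y => ∑ i ∈ s, f i y) x = ∑ i ∈ s, pd k (pd l (f i)) x := by
  have h : pd l (fun y => ∑ i ∈ s, f i y) =ᶠ[𝓝 x] fun y => ∑ i ∈ s, pd l (f i) y := by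
    filter_upwards [(Filter.eventually_all_finset s).2 fun i hi =>
      contDiffAt_eventually_differentiableAt (hf i hi)] with y h1 using pd_sum s h1
  rw [pd_congr h, pd_sum s fun i hi => differentiableAt_pd (hf i hi) l]

theorem contDiffAt_coord {E : Type*} [NormedAddCommGroup E] [NormedSpace ℝ E] {n : ℕ∞ω}
    {ψ : E → Eu m} {y : E} (hψ : ContDiffAt ℝ n ψ y) (l : Fin m) :
    ContDiffAt ℝ n (fun z => ψ z l) y :=
  (EuclideanSpace.proj l : Eu m →L[ℝ] ℝ).contDiff.contDiffAt.comp y hψ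

theorem pd_pd_comp {ψ : Eu d → Eu m} {y : Eu d} (hf : ContDiffAt ℝ 2 f (ψ y))
    (hψ : ContDiffAt ℝ 2 ψ y) (a b : Fin d) :
    pd a (pd b fun z => f (ψ z)) y = ∑ l, ((∑ k, pd k (pd l f) (ψ y) * pd a (fun z => ψ z k) y) *
      pd b (fun z => ψ z l) y + pd l f (ψ y) * pd a (pd b fun z => ψ z l) y) := by
  have hψ1 := hψ.differentiableAt (by norm_num)
  have h : pd b (fun z => f (ψ z)) =ᶠ[𝓝 y]
      fun z => ∑ l, pd l f (ψ z) * pd b (fun z => ψ z l) z := by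
    filter_upwards [hψ.continuousAt.eventually (contDiffAt_eventually_differentiableAt hf),
      (hψ.eventually (by simp)).mono fun _ h => h.differentiableAt (by norm_num)]
      with z h1 h2 using pd_comp b h1 h2
  have hl (l : Fin m) : ContDiffAt ℝ 2 (fun z => ψ z l) y := contDiffAt_coord hψ l
  have hc (l : Fin m) : DifferentiableAt ℝ (fun z => pd l f (ψ z)) y :=
    (differentiableAt_pd hf l).comp y hψ1
  rw [pd_congr h, pd_sum _ fun l _ => (hc l).fun_mul (differentiableAt_pd (hl l) b)]
  refine Finset.sum_congr rfl fun l _ => ?_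
  rw [pd_mul (hc l) (differentiableAt_pd (hl l) b), pd_comp a (differentiableAt_pd hf l) hψ1]

end SecondDerivatives

/-! ### Families of functions with uniformly controlled 2-jets at the origin. -/

section JetO

open Asymptotics

variable {d m : ℕ} {α : Type*} {l : Filter α} {f g : α → Eu d → ℝ} {e e' : α → ℝ}

/-- The 2-jets at the origin of a family of functions are `O(e)`. -/
structure JetO (l : Filter α) (f : α → Eu d → ℝ) (e : α → ℝ) : Prop where
  smooth : ∀ᶠ a in l, ContDiffAt ℝ 2 (f a) 0
  val : (fun a => f a 0) =O[l] e
  d1 : ∀ i, (fun a => pd i (f a) 0) =O[l] e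
  d2 : ∀ i j, (fun a => pd i (pd j (f a)) 0) =O[l] e

theorem JetO.mul (hf : JetO l f e) (hg : JetO l g e') :
    JetO l (fun a y => f a y * g a y) (fun a => e a * e' a) where
  smooth := by filter_upwards [hf.smooth, hg.smooth] with a h1 h2 using h1.mul h2
  val := hf.val.mul hg.val
  d1 i := by
    refine (((hf.d1 i).mul hg.val).add (hf.val.mul (hg.d1 i))).congr' ?_ EventuallyEq.rfl
    filter_upwards [hf.smooth, hg.smooth] with a h1 h2
    rw [pd_mul (h1.differentiableAt (by norm_num)) (h2.differentiableAt (by norm_num))]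
  d2 i j := by
    refine ((((hf.d2 i j).mul hg.val).add ((hf.d1 j).mul (hg.d1 i))).add
      (((hf.d1 i).mul (hg.d1 j)).add (hf.val.mul (hg.d2 i j)))).congr' ?_ EventuallyEq.rfl
    filter_upwards [hf.smooth, hg.smooth] with a h1 h2
    rw [pd_pd_mul h1 h2]

theorem JetO.add (hf : JetO l f e) (hg : JetO l g e) : JetO l (fun a y => f a y + g a y) e where
  smooth := by filter_upwards [hf.smooth, hg.smooth] with a h1 h2 using h1.add h2
  val := hf.val.add hg.val
  d1 i := by
    refine ((hf.d1 i).add (hg.d1 i)).congr' ?_ EventuallyEq.rfl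
    filter_upwards [hf.smooth, hg.smooth] with a h1 h2
    rw [pd_add (h1.differentiableAt (by norm_num)) (h2.differentiableAt (by norm_num))]
  d2 i j := by
    refine ((hf.d2 i j).add (hg.d2 i j)).congr' ?_ EventuallyEq.rfl
    filter_upwards [hf.smooth, hg.smooth] with a h1 h2
    rw [pd_pd_add h1 h2]

theorem JetO.const_mul {c : α → ℝ} (hc : c =O[l] e') (hf : JetO l f e) :
    JetO l (fun a y => c a * f a y) (fun a => e' a * e a) where
  smooth := by filter_upwards [hf.smooth] with a h1 using contDiffAt_const.mul h1
  val := hc.mul hf.val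
  d1 i := by simpa only [pd_const_mul] using hc.mul (hf.d1 i)
  d2 i j := by simpa only [pd_pd_const_mul] using hc.mul (hf.d2 i j)

theorem JetO.sum {ι : Type*} {s : Finset ι} {f : ι → α → Eu d → ℝ} (hf : ∀ i ∈ s, JetO l (f i) e) :
    JetO l (fun a y => ∑ i ∈ s, f i a y) e where
  smooth := by
    filter_upwards [(Filter.eventually_all_finset s).2 fun i hi => (hf i hi).smooth] with a h
      using ContDiffAt.sum h
  val := IsBigO.fun_sum fun i hi => (hf i hi).val
  d1 k := by
    refine (IsBigO.fun_sum fun i hi => (hf i hi).d1 k).congr' ?_ EventuallyEq.rfl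
    filter_upwards [(Filter.eventually_all_finset s).2 fun i hi => (hf i hi).smooth] with a h
    rw [pd_sum s fun i hi => (h i hi).differentiableAt (by norm_num)]
  d2 k j := by
    refine (IsBigO.fun_sum fun i hi => (hf i hi).d2 k j).congr' ?_ EventuallyEq.rfl
    filter_upwards [(Filter.eventually_all_finset s).2 fun i hi => (hf i hi).smooth] with a h
    rw [pd_pd_sum s h]

theorem JetO.of_fixed {f : Eu d → ℝ} (hf : ContDiffAt ℝ 2 f 0) :
    JetO l (fun _ => f) (fun _ => 1) where
  smooth := .of_forall fun _ => hf
  val := isBigO_const_const _ one_ne_zero _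
  d1 _ := isBigO_const_const _ one_ne_zero _
  d2 _ _ := isBigO_const_const _ one_ne_zero _

theorem JetO.mono (hf : JetO l f e) (h : e =O[l] e') : JetO l f e' :=
  ⟨hf.smooth, hf.val.trans h, fun i => (hf.d1 i).trans h, fun i j => (hf.d2 i j).trans h⟩

theorem JetO.congr (hf : JetO l f e) (h : ∀ᶠ a in l, f a =ᶠ[𝓝 0] g a) : JetO l g e where
  smooth := by
    filter_upwards [hf.smooth, h] with a h1 h2 using h1.congr_of_eventuallyEq h2.symm
  val := hf.val.congr' (h.mono fun a h => h.eq_of_nhds) .rfl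
  d1 i := (hf.d1 i).congr' (h.mono fun a h => pd_congr h) .rfl
  d2 i j := (hf.d2 i j).congr' (h.mono fun a h => pd_congr (pd_congr_nhds h)) .rfl

/-- A weighted chain rule: all first and second derivatives of ψ have size ρ, so a k-th derivative
of F is multiplied by at most ρᵏ. In the application ρ = r, and each derivative of F decays one
power of r faster. -/
theorem JetO.comp {F : Eu m → ℝ} {ψ : α → Eu d → Eu m} {ρ : α → ℝ}
    (hF : ∀ᶠ a in l, ContDiffAt ℝ 2 F (ψ a 0)) (hψ : ∀ᶠ a in l, ContDiffAt ℝ 2 (ψ a) 0)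
    (h1 : ∀ i k, (fun a => pd i (fun y => ψ a y k) 0) =O[l] ρ)
    (h2 : ∀ i j k, (fun a => pd i (pd j fun y => ψ a y k) 0) =O[l] ρ)
    (f0 : (fun a => F (ψ a 0)) =O[l] e)
    (f1 : ∀ k, (fun a => pd k F (ψ a 0) * ρ a) =O[l] e)
    (f2 : ∀ k i, (fun a => pd k (pd i F) (ψ a 0) * ρ a * ρ a) =O[l] e) :
    JetO l (fun a y => F (ψ a y)) e where
  smooth := by filter_upwards [hF, hψ] with a h1 h2 using h1.comp 0 h2
  val := f0
  d1 i := by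
    have : (fun a => ∑ k, pd k F (ψ a 0) * pd i (fun y => ψ a y k) 0) =O[l] e :=
      IsBigO.fun_sum fun k _ => ((isBigO_refl _ _).mul (h1 i k)).trans (f1 k)
    refine this.congr' ?_ EventuallyEq.rfl
    filter_upwards [hF, hψ] with a h1 h2
    rw [pd_comp _ (h1.differentiableAt (by norm_num)) (h2.differentiableAt (by norm_num))]
  d2 i j := by
    have : (fun a => ∑ q, ((∑ k, pd k (pd q F) (ψ a 0) * pd i (fun y => ψ a y k) 0) *
      pd j (fun y => ψ a y q) 0 + pd q F (ψ a 0) * pd i (pd j fun y => ψ a y q) 0)) =O[l] e := by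
      refine IsBigO.fun_sum fun q _ => IsBigO.add ?_
        (((isBigO_refl _ _).mul (h2 i j q)).trans (f1 q))
      simp only [Finset.sum_mul]
      exact IsBigO.fun_sum fun k _ =>
        (((isBigO_refl _ _).mul (h1 i k)).mul (h1 j q)).trans (f2 k q)
    refine this.congr' ?_ EventuallyEq.rfl
    filter_upwards [hF, hψ] with a h1 h2
    rw [pd_pd_comp h1 h2]

end JetO

/-! ### The round jet and Lipschitz estimates for functions of jets. -/

section JetEstimates

open Asymptotics

variable {m d : ℕ} {α : Type*} {l : Filter α}

/-- The jet at the centre of the stereographic chart of the round metric of the unit sphere. -/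
def roundJet (d : ℕ) : (Jet0 d × Jet1 d) × Jet2 d :=
  ((fun i j => if i = j then 1 else 0, 0),
    fun k l i j => if k = l then (if i = j then -1 else 0) else 0)

theorem of_ite_eq_one :
    (Matrix.of fun i j : Fin m => if i = j then (1 : ℝ) else 0) = 1 := by
  ext i j; simp [Matrix.one_apply]

/-- The symbols are linear in the first derivatives of the metric, so where these vanish a variation
D of the metric itself does not contribute. -/
theorem fderiv_jetChristoffel_of_eq_zero {P : Jet0 m} (hP : (Matrix.of P).det ≠ 0)
    (k i j : Fin m) (D : Jet0 m) (E : Jet1 m) :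
    fderiv ℝ (jetChristoffel k i j) (P, 0) (D, E) = jetChristoffel k i j (P, E) := by
  have h := ((contDiffAt_jetChristoffel (n := 1) (p := (P, 0)) hP k i j).differentiableAt
    (by norm_num)).hasFDerivAt.hasLineDerivAt (D, E)
  -- By linearity in the second argument, the value at (P + tD, tE) is t times the value at (P + tD,
  -- E).
  have h1 : HasDerivAt (fun t : ℝ => t * jetChristoffel k i j (P + t • D, E))
      (jetChristoffel k i j (P, E)) 0 := by
    have h2 : DifferentiableAt ℝ (fun t : ℝ => jetChristoffel k i j (P + t • D, E)) 0 := by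
      refine ((contDiffAt_jetChristoffel (n := 1) (p := (P + (0 : ℝ) • D, E))
        (by simpa using hP) k i j).differentiableAt (by norm_num)).comp (0 : ℝ)
        (f := fun t : ℝ => (P + t • D, E)) ?_
      fun_prop
    have h3 := (hasDerivAt_id' (0 : ℝ)).fun_mul h2.hasDerivAt
    simpa using h3
  refine h.unique (h1.congr_of_eventuallyEq (.of_forall fun t => ?_))
  simp only [jetChristoffel, Prod.smul_mk, Prod.mk_add_mk, zero_add, Pi.smul_apply, smul_eq_mul]
  simp only [Finset.mul_sum]
  exact Finset.sum_congr rfl fun l _ => by ring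

theorem jetChristoffel_one (k i j : Fin m) (E : Jet1 m) :
    jetChristoffel k i j ((fun i j => if i = j then 1 else 0), E) =
      (1 / 2) * (E i j k + E j i k - E k i j) := by
  simp only [jetChristoffel, of_ite_eq_one, inv_one, Matrix.one_apply, ite_mul, one_mul, zero_mul,
    Finset.sum_ite_eq, Finset.mem_univ, if_true]

/-- The first derivatives vanish at the stereographic centre, so the quadratic terms in Γ drop out.
The second derivatives contribute 1 for each ordered pair i ≠ k and 0 for i = k. -/
theorem jetScalar_roundJet (d : ℕ) : jetScalar (roundJet d) = (d : ℝ) * (d - 1) := by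
  have hP : (Matrix.of fun i j : Fin d => if i = j then (1 : ℝ) else 0).det ≠ 0 := by
    simp [of_ite_eq_one]
  simp only [jetScalar, roundJet, fderiv_jetChristoffel_of_eq_zero hP, jetChristoffel_one,
    of_ite_eq_one, inv_one, Matrix.one_apply, ite_mul, one_mul, zero_mul,
    Finset.sum_ite_eq, Finset.mem_univ, if_true]
  have (i k : Fin d) : (1 / 2 : ℝ) * (((if k = i then if i = k then -1 else 0 else 0) +
      if k = i then if i = k then -1 else 0 else 0) - -1) -
      1 / 2 * ((-1 + if i = k then if i = k then -1 else 0 else 0) -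
        if i = k then if i = k then -1 else 0 else 0) = 1 - if i = k then 1 else 0 := by
    by_cases h : i = k
    · subst h; norm_num
    · simp only [h, Ne.symm h, if_false]; norm_num
  simp only [this, Pi.zero_apply]
  simp [Finset.sum_sub_distrib]
  ring

theorem isBigO_jetScalar_sub {q : α → (Jet0 d × Jet1 d) × Jet2 d} {e : α → ℝ}
    (h : (fun a => q a - roundJet d) =O[l] e) (he : Tendsto e l (𝓝 0)) :
    (fun a => jetScalar (q a) - (d : ℝ) * (d - 1)) =O[l] e := by
  have hP : (Matrix.of (roundJet d).1.1).det ≠ 0 := by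
    simp [roundJet, of_ite_eq_one]
  have h1 := ((contDiffAt_jetScalar hP).differentiableAt (by norm_num)).hasFDerivAt.isBigO_sub
  have h2 : Tendsto q l (𝓝 (roundJet d)) := by
    simpa using (h.trans_tendsto he).add_const (roundJet d)
  have h3 := h1.comp_tendsto h2
  rw [jetScalar_roundJet] at h3
  exact h3.trans h

/-- Each point (p₀, z) has a neighbourhood with a Lipschitz constant, and compactness of K makes it
uniform in z. Both p and p' move because the model metric also varies with r. -/
theorem isBigO_comp_sub_of_isCompact {E F : Type*} [NormedAddCommGroup E] [NormedSpace ℝ E]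
    [NormedAddCommGroup F] [NormedSpace ℝ F] {f : E × F → ℝ} {p₀ : E} {K : Set F}
    (hK : IsCompact K) (hf : ∀ z ∈ K, ContDiffAt ℝ 1 f (p₀, z)) {p p' : α → E} {z : α → F}
    (hp : Tendsto p l (𝓝 p₀)) (hp' : Tendsto p' l (𝓝 p₀)) (hz : ∀ a, z a ∈ K) :
    (fun a => f (p a, z a) - f (p' a, z a)) =O[l] fun a => p a - p' a := by
  have key : ∃ C : ℝ, ∀ᶠ q : E × E in 𝓝 (p₀, p₀), ∀ z ∈ K,
      ‖f (q.1, z) - f (q.2, z)‖ ≤ C * ‖q.1 - q.2‖ := by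
    -- Compact induction: the uniform bound passes to subsets and finite unions, so it is enough to
    -- have it near each z.
    refine hK.induction_on (p := fun s => ∃ C : ℝ, ∀ᶠ q : E × E in 𝓝 (p₀, p₀), ∀ z ∈ s,
      ‖f (q.1, z) - f (q.2, z)‖ ≤ C * ‖q.1 - q.2‖) ⟨0, by simp⟩ ?_ ?_ ?_
    · rintro s t hst ⟨C, hC⟩
      exact ⟨C, hC.mono fun q hq z hz => hq z (hst hz)⟩
    · rintro s t ⟨C, hC⟩ ⟨D, hD⟩
      refine ⟨max C D, ?_⟩
      filter_upwards [hC, hD] with q h1 h2 z hz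
      rcases hz with hz | hz
      · exact (h1 z hz).trans (by gcongr; exact le_max_left _ _)
      · exact (h2 z hz).trans (by gcongr; exact le_max_right _ _)
    · intro z hz
      obtain ⟨C, s, hs, hL⟩ := (hf z hz).exists_lipschitzOnWith
      rw [nhds_prod_eq, Filter.mem_prod_iff] at hs
      obtain ⟨u, hu, v, hv, huv⟩ := hs
      refine ⟨v, mem_nhdsWithin_of_mem_nhds hv, C, ?_⟩
      rw [nhds_prod_eq]
      filter_upwards [prod_mem_prod hu hu] with q hq z hz
      have := hL.norm_sub_le (huv (Set.mk_mem_prod hq.1 hz)) (huv (Set.mk_mem_prod hq.2 hz))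
      simpa [Prod.norm_def] using this
  obtain ⟨C, hC⟩ := key
  refine IsBigO.of_bound C ?_
  filter_upwards [(hp.prodMk_nhds hp').eventually hC] with a ha using ha _ (hz a)

end JetEstimates

/-! ### The stereographic parametrization of coordinate spheres -/

section SphereParam

open Asymptotics

variable {d : ℕ}

/-- The chart at θ projects from the antipode -θ, so curvature at r • θ is read off from jets at the
origin. -/
theorem chartAt_self_eq_zero (θ : USphere d) : chartAt (Eu d) θ θ = 0 := by
  have := Fact.mk (@finrank_euclideanSpace_fin ℝ _ (d + 1))
  change stereographic' d (-θ) θ = 0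
  simp only [stereographic', OpenPartialHomeomorph.coe_trans, Function.comp_apply,
    stereographic_neg_apply]
  exact map_zero (OrthonormalBasis.fromOrthogonalSpanSingleton (𝕜 := ℝ) d
    (ne_zero_of_mem_unit_sphere (-θ))).repr

/-- Inverse stereographic projection from -θ. The isometry ι identifies ℝᵈ with θ^⊥ through some
orthonormal basis; only isometry and orthogonality to θ are ever used, so its dependence on θ is
harmless. -/
theorem exists_sphereParam_eq (θ : USphere d) : ∃ ι : Eu d →ₗᵢ[ℝ] Eu (d + 1),
    (∀ v, inner ℝ (ι v) (θ : Eu (d + 1)) = 0) ∧ ∀ r y, sphereParam r θ y =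
      r • ((4 * (‖y‖ ^ 2 + 4)⁻¹) • ι y + (8 * (‖y‖ ^ 2 + 4)⁻¹ - 1) • (θ : Eu (d + 1))) := by
  have := Fact.mk (@finrank_euclideanSpace_fin ℝ _ (d + 1))
  let U := (OrthonormalBasis.fromOrthogonalSpanSingleton (𝕜 := ℝ) d
    (ne_zero_of_mem_unit_sphere (-θ))).repr
  refine ⟨(Submodule.subtypeₗᵢ _).comp U.symm.toLinearIsometry, fun v => ?_, fun r y => ?_⟩
  · have := (U.symm v).2
    rw [Submodule.mem_orthogonal_singleton_iff_inner_right] at this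
    rw [real_inner_comm]
    change inner ℝ (θ : Eu (d + 1)) (U.symm v : Eu (d + 1)) = 0
    simpa using this
  · have h := stereographic'_symm_apply (-θ) y
    have hn : ‖((U.symm y : _) : Eu (d + 1))‖ = ‖y‖ :=
      U.symm.norm_map y
    change r • (((stereographic' d (-θ)).symm y : USphere d) : Eu (d + 1)) = _
    rw [h]
    simp only [U] at hn
    simp only [hn]
    congr 1
    change _ = (4 * (‖y‖ ^ 2 + 4)⁻¹) • (U.symm y : Eu (d + 1)) + _
    have hq : (‖y‖ ^ 2 + 4) ≠ 0 := by positivity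
    have e : (8 * (‖y‖ ^ 2 + 4)⁻¹ - 1 : ℝ) = -((‖y‖ ^ 2 + 4)⁻¹ * (‖y‖ ^ 2 - 4)) := by
      field_simp; ring
    rw [e, smul_smul, smul_smul, mul_comm (4 : ℝ)]
    simp [U]

theorem norm_sphereParam {r : ℝ} (hr : 0 ≤ r) (θ : USphere d) (y : Eu d) :
    ‖sphereParam r θ y‖ = r := by
  simp [sphereParam, norm_smul, abs_of_nonneg hr]

theorem sphereParam_zero (r : ℝ) (θ : USphere d) :
    sphereParam r θ 0 = r • (θ : Eu (d + 1)) := by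
  obtain ⟨ι, -, h⟩ := exists_sphereParam_eq θ
  rw [h]; norm_num

theorem norm_sq_add_four_ne_zero (y : Eu d) : ‖y‖ ^ 2 + 4 ≠ 0 := by positivity

theorem contDiff_inv_norm_sq_add_four {n : ℕ∞ω} :
    ContDiff ℝ n fun y : Eu d => (‖y‖ ^ 2 + 4)⁻¹ :=
  ((contDiff_norm_sq ℝ).add contDiff_const).inv norm_sq_add_four_ne_zero

theorem pd_inv_norm_sq_add_four (a : Fin d) (y : Eu d) :
    pd a (fun y : Eu d => (‖y‖ ^ 2 + 4)⁻¹) y = -(2 * y a) * ((‖y‖ ^ 2 + 4)⁻¹) ^ 2 := by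
  have hd : DifferentiableAt ℝ (fun y : Eu d => ‖y‖ ^ 2) y := differentiableAt_id.norm_sq ℝ
  rw [pd_scomp (f := fun y : Eu d => ‖y‖ ^ 2 + 4) (h := fun t => t⁻¹)
    (differentiableAt_inv (norm_sq_add_four_ne_zero y)) (hd.add_const _),
    pd_add hd (differentiableAt_const _), pd_norm_sq, pd_const, deriv_inv]
  generalize ‖y‖ ^ 2 + 4 = q
  ring

variable {θ : USphere d} {ι : Eu d →ₗᵢ[ℝ] Eu (d + 1)}

theorem contDiff_of_sphereParam_eq {n : ℕ∞ω} {r : ℝ} (hι : ∀ y, sphereParam r θ y =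
      r • ((4 * (‖y‖ ^ 2 + 4)⁻¹) • ι y + (8 * (‖y‖ ^ 2 + 4)⁻¹ - 1) • (θ : Eu (d + 1)))) :
    ContDiff ℝ n (sphereParam r θ) := by
  rw [show sphereParam r θ = _ from funext hι]
  have hq := contDiff_inv_norm_sq_add_four (d := d) (n := n)
  have h1 : ContDiff ℝ n fun y : Eu d => 4 * (‖y‖ ^ 2 + 4)⁻¹ := contDiff_const.mul hq
  have h2 : ContDiff ℝ n fun y : Eu d => 8 * (‖y‖ ^ 2 + 4)⁻¹ - 1 :=
    (contDiff_const.mul hq).sub contDiff_const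
  exact ((h1.smul ι.contDiff).add (h2.smul contDiff_const)).const_smul r

theorem pd_sphereParam {r : ℝ} (hι : ∀ y, sphereParam r θ y =
      r • ((4 * (‖y‖ ^ 2 + 4)⁻¹) • ι y + (8 * (‖y‖ ^ 2 + 4)⁻¹ - 1) • (θ : Eu (d + 1))))
    (a : Fin d) (i : Fin (d + 1)) (y : Eu d) :
    pd a (fun z => sphereParam r θ z i) y =
      (r • ((4 * (‖y‖ ^ 2 + 4)⁻¹) • ι (EuclideanSpace.single a 1)
        - (8 * y a * ((‖y‖ ^ 2 + 4)⁻¹) ^ 2) • ι y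
        - (16 * y a * ((‖y‖ ^ 2 + 4)⁻¹) ^ 2) • (θ : Eu (d + 1)))) i := by
  have e : (fun z => sphereParam r θ z i) = fun z =>
      r * ((4 * (‖z‖ ^ 2 + 4)⁻¹) * (ι z) i + (8 * (‖z‖ ^ 2 + 4)⁻¹ + -1) * (θ : Eu (d + 1)) i) := by
    ext z; simp [hι, sub_eq_add_neg, mul_add]
  have hq : DifferentiableAt ℝ (fun y : Eu d => (‖y‖ ^ 2 + 4)⁻¹) y :=
    (contDiff_inv_norm_sq_add_four (n := 1)).differentiable (by norm_num) y
  have hl : HasFDerivAt (fun z => (ι z) i)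
      ((EuclideanSpace.proj i : Eu (d + 1) →L[ℝ] ℝ).comp ι.toContinuousLinearMap) y :=
    ((EuclideanSpace.proj i : Eu (d + 1) →L[ℝ] ℝ).comp ι.toContinuousLinearMap).hasFDerivAt
  have hl' : pd a (fun z => (ι z) i) y = (ι (EuclideanSpace.single a 1)) i := by
    rw [pd, hl.fderiv]; rfl
  have h4 : DifferentiableAt ℝ (fun y : Eu d => 4 * (‖y‖ ^ 2 + 4)⁻¹) y := hq.const_mul _
  have h8 : DifferentiableAt ℝ (fun y : Eu d => 8 * (‖y‖ ^ 2 + 4)⁻¹) y := hq.const_mul _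
  have h81 : DifferentiableAt ℝ (fun y : Eu d => 8 * (‖y‖ ^ 2 + 4)⁻¹ + -1) y := h8.add_const _
  rw [e, pd_const_mul, pd_add (h4.fun_mul hl.differentiableAt)
    (h81.fun_mul (differentiableAt_const _)),
    pd_mul h4 hl.differentiableAt, pd_mul h81 (differentiableAt_const _), pd_add h8
    (differentiableAt_const _), pd_const_mul, pd_const_mul, pd_inv_norm_sq_add_four, hl',
    pd_const, pd_const]
  simp only [PiLp.smul_apply, PiLp.sub_apply, smul_eq_mul]
  ring

/-- Stereographic projection is conformal: expanding the inner product, the y_a y_b terms must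
cancel. -/
theorem sum_pd_sphereParam_mul (hθ : ∀ v, inner ℝ (ι v) (θ : Eu (d + 1)) = 0) {r : ℝ}
    (hι : ∀ y, sphereParam r θ y =
      r • ((4 * (‖y‖ ^ 2 + 4)⁻¹) • ι y + (8 * (‖y‖ ^ 2 + 4)⁻¹ - 1) • (θ : Eu (d + 1))))
    (a b : Fin d) (y : Eu d) :
    ∑ i, pd a (fun z => sphereParam r θ z i) y * pd b (fun z => sphereParam r θ z i) y =
      r ^ 2 * (16 * ((‖y‖ ^ 2 + 4)⁻¹) ^ 2 * if a = b then 1 else 0) := by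
  have hin (v w : Eu (d + 1)) : ∑ i, v i * w i = inner ℝ w v := by
    simp [PiLp.inner_apply]
  have hθ' (v : Eu d) : inner ℝ (θ : Eu (d + 1)) (ι v) = 0 := by rw [real_inner_comm]; exact hθ v
  have hθθ : inner ℝ (θ : Eu (d + 1)) (θ : Eu (d + 1)) = 1 := by simp
  have hab : inner ℝ (EuclideanSpace.single b (1 : ℝ)) (EuclideanSpace.single a (1 : ℝ) : Eu d) =
      if a = b then 1 else 0 := by
    simp [EuclideanSpace.inner_single_left, eq_comm]
  have hay : inner ℝ y (EuclideanSpace.single a (1 : ℝ) : Eu d) = y a := by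
    simp [EuclideanSpace.inner_single_right]
  have hby : inner ℝ (EuclideanSpace.single b (1 : ℝ) : Eu d) y = y b := by
    simp [EuclideanSpace.inner_single_left]
  simp only [pd_sphereParam hι]
  rw [hin]
  simp only [inner_sub_left, inner_sub_right, inner_smul_left, inner_smul_right,
    LinearIsometry.inner_map_map, hθ, hθ', hθθ, hab, hay, hby, real_inner_self_eq_norm_sq,
    conj_trivial]
  have hq := norm_sq_add_four_ne_zero y
  have e : (‖y‖ ^ 2 + 4)⁻¹ * (‖y‖ ^ 2 + 4) = 1 := inv_mul_cancel₀ hq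
  generalize (‖y‖ ^ 2 + 4)⁻¹ = q at *
  generalize (if a = b then (1 : ℝ) else 0) = δ
  generalize ‖y‖ ^ 2 = n at *
  -- With q = (‖y‖² + 4)⁻¹, the y_a y_b terms are -64q³ from the mixed products and 64(‖y‖² + 4)q⁴
  -- from the squares.
  linear_combination (64 * r ^ 2 * y a * y b * q ^ 3) * e

end SphereParam

/-! ### Scalar curvature of large coordinate spheres -/

section SphereAsymptotics

open Asymptotics

variable {d : ℕ}

/-- The filter on pairs `(r, θ)` describing uniform statements on `S_r` as `r → ∞`. -/
abbrev largeSpheres (d : ℕ) : Filter (ℝ × USphere d) := atTop ×ˢ ⊤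

theorem tendsto_fst_largeSpheres : Tendsto Prod.fst (largeSpheres d) atTop := tendsto_fst

theorem tendsto_smul_largeSpheres :
    Tendsto (fun a : ℝ × USphere d => a.1 • (a.2 : Eu (d + 1))) (largeSpheres d)
      (Bornology.cobounded (Eu (d + 1))) := by
  rw [← tendsto_norm_atTop_iff_cobounded]
  have : (fun a : ℝ × USphere d => ‖a.1 • (a.2 : Eu (d + 1))‖) = fun a => |a.1| := by
    ext a; simp [norm_smul]
  rw [this]
  exact tendsto_abs_atTop_atTop.comp tendsto_fst_largeSpheres

theorem isBigO_largeSpheres {f : Eu (d + 1) → ℝ} {k : ℤ}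
    (h : f =O[Bornology.cobounded (Eu (d + 1))] fun x => ‖x‖ ^ k) :
    (fun a : ℝ × USphere d => f (a.1 • (a.2 : Eu (d + 1)))) =O[largeSpheres d]
      fun a => a.1 ^ k := by
  refine (h.comp_tendsto tendsto_smul_largeSpheres).trans (IsBigO.of_bound 1 (.of_forall ?_))
  intro a
  simp [norm_smul]

theorem isBigO_zpow_of_le {α : Type*} {l : Filter α} {f : α → ℝ} (hf : Tendsto f l atTop)
    {j k : ℤ} (h : j ≤ k) : (fun a => f a ^ j) =O[l] fun a => f a ^ k := by
  refine IsBigO.of_bound 1 ?_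
  filter_upwards [hf.eventually_ge_atTop 1] with a ha
  have : 0 < f a := by linarith
  rw [one_mul, Real.norm_of_nonneg (by positivity), Real.norm_of_nonneg (by positivity)]
  exact zpow_le_zpow_right₀ ha h

theorem tendsto_zpow_neg {α : Type*} {l : Filter α} {f : α → ℝ} (hf : Tendsto f l atTop)
    {k : ℤ} (h : k < 0) : Tendsto (fun a => f a ^ k) l (𝓝 0) :=
  (tendsto_zpow_atTop_zero h).comp hf

/-- The metric `G` is asymptotic to the conformally flat metric with factor `φ(|x|)`. -/
structure ConformalDecay (G : MetricField (d + 1)) (φ : ℝ → ℝ) : Prop where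
  tendsto : Tendsto φ atTop (𝓝 1)
  smooth_factor : ∀ᶠ r in atTop, ContDiffAt ℝ 2 φ r
  smooth : ∀ i j, ∀ᶠ x in Bornology.cobounded (Eu (d + 1)), ContDiffAt ℝ 2 (fun y => G y i j) x
  decay : ∀ i j, (fun x => G x i j - if i = j then φ ‖x‖ else 0)
    =O[Bornology.cobounded (Eu (d + 1))] fun x => ‖x‖ ^ (-(d : ℤ))
  decay_deriv : ∀ i j k, pd k (fun x => G x i j - if i = j then φ ‖x‖ else 0)
    =O[Bornology.cobounded (Eu (d + 1))] fun x => ‖x‖ ^ (-(d : ℤ) - 1)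
  decay_deriv₂ : ∀ i j k l, pd k (pd l fun x => G x i j - if i = j then φ ‖x‖ else 0)
    =O[Bornology.cobounded (Eu (d + 1))] fun x => ‖x‖ ^ (-(d : ℤ) - 2)

theorem eventually_cobounded_ne_zero {m : ℕ} : ∀ᶠ x in Bornology.cobounded (Eu m), x ≠ 0 := by
  filter_upwards [tendsto_norm_cobounded_atTop.eventually_gt_atTop 0] with x hx
  exact norm_pos_iff.1 hx

theorem ConformalDecay.contDiffAt_factor {G : MetricField (d + 1)} {φ : ℝ → ℝ}
    (hG : ConformalDecay G φ) : ∀ᶠ x in Bornology.cobounded (Eu (d + 1)),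
      ContDiffAt ℝ 2 (fun y => φ ‖y‖) x := by
  filter_upwards [tendsto_norm_cobounded_atTop.eventually hG.smooth_factor,
    eventually_cobounded_ne_zero] with x h1 h2
  exact h1.comp x (contDiffAt_norm ℝ h2)

theorem ConformalDecay.contDiffAt_sub {G : MetricField (d + 1)} {φ : ℝ → ℝ}
    (hG : ConformalDecay G φ) (i j : Fin (d + 1)) : ∀ᶠ x in Bornology.cobounded (Eu (d + 1)),
      ContDiffAt ℝ 2 (fun y => G y i j - if i = j then φ ‖y‖ else 0) x := by
  filter_upwards [hG.smooth i j, hG.contDiffAt_factor] with x h1 h2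
  refine h1.sub ?_
  split_ifs
  exacts [h2, contDiffAt_const]

theorem abs_coord_le {m : ℕ} (x : Eu m) (i : Fin m) : |x i| ≤ ‖x‖ := PiLp.norm_apply_le x i

/-- The derivative is a finite sum of fixed smooth functions of y with coefficients r·c(θ). Each
c(θ) is a coordinate of a unit vector, hence at most 1, which gives uniformity in θ. -/
theorem jetO_pd_sphereParam (b : Fin d) (i : Fin (d + 1)) :
    JetO (largeSpheres d) (fun a y => pd b (fun z => sphereParam a.1 a.2 z i) y)
      fun a => a.1 := by
  choose ι hθ hι using exists_sphereParam_eq (d := d)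
  have hq : ContDiff ℝ 2 fun y : Eu d => (‖y‖ ^ 2 + 4)⁻¹ := contDiff_inv_norm_sq_add_four
  have hb (b : Fin d) : ContDiff ℝ 2 fun y : Eu d => y b :=
    (EuclideanSpace.proj b : Eu d →L[ℝ] ℝ).contDiff
  have hO {c : USphere d → ℝ} (hc : ∀ θ, |c θ| ≤ 1) :
      (fun a : ℝ × USphere d => a.1 * c a.2) =O[largeSpheres d] fun a => a.1 := by
    refine IsBigO.of_bound 1 (.of_forall fun a => ?_)
    rw [norm_mul, one_mul]
    exact mul_le_of_le_one_right (norm_nonneg _) (hc _)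
  have hι1 (θ : USphere d) (c : Fin d) : |ι θ (EuclideanSpace.single c 1) i| ≤ 1 :=
    (abs_coord_le _ _).trans (by simp)
  have hθ1 (θ : USphere d) : |(θ : Eu (d + 1)) i| ≤ 1 := (abs_coord_le _ _).trans (by simp)
  have h1 := JetO.const_mul (hO fun θ => hι1 θ b) (JetO.of_fixed
    (contDiff_const (c := (4 : ℝ)) |>.mul hq).contDiffAt)
  have h2 := JetO.sum (s := Finset.univ) fun c _ => JetO.const_mul (hO fun θ => hι1 θ c)
    (JetO.of_fixed (((contDiff_const (c := (-8 : ℝ)) |>.mul (hb b)).mul (hb c)).mul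
      (hq.pow 2)).contDiffAt)
  have h3 := JetO.const_mul (hO hθ1) (JetO.of_fixed
    ((contDiff_const (c := (-16 : ℝ)) |>.mul (hb b)).mul (hq.pow 2)).contDiffAt)
  have h := (h1.add h2).add h3
  simp only [mul_one] at h
  refine h.congr (.of_forall fun a => .of_forall fun y => ?_)
  -- Linearity of ι separates the dependence on y from that on θ.
  have hy : ι a.2 y i = ∑ c, y c * ι a.2 (EuclideanSpace.single c 1) i := by
    conv_lhs => rw [← (EuclideanSpace.basisFun (Fin d) ℝ).sum_repr y]
    simp [map_sum]
  beta_reduce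
  rw [pd_sphereParam (hι a.2 a.1)]
  simp only [PiLp.smul_apply, PiLp.sub_apply, smul_eq_mul, hy]
  simp only [Finset.mul_sum, mul_sub]
  rw [sub_eq_add_neg, sub_eq_add_neg, ← Finset.sum_neg_distrib]
  congr 1
  · congr 1
    · ring
    · exact Finset.sum_congr rfl fun c _ => by ring
  · ring

/-- Each derivative in y costs a factor r and gains r⁻¹ from the decay in x, so value, first and
second derivatives all have the same order. -/
theorem ConformalDecay.jetO_sub {G : MetricField (d + 1)} {φ : ℝ → ℝ}
    (hG : ConformalDecay G φ) (i j : Fin (d + 1)) :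
    JetO (largeSpheres d) (fun a y => G (sphereParam a.1 a.2 y) i j -
      if i = j then φ ‖sphereParam a.1 a.2 y‖ else 0) fun a => a.1 ^ (-(d : ℤ)) := by
  have hr : ∀ᶠ a in largeSpheres d, a.1 ≠ 0 := tendsto_fst_largeSpheres.eventually_ne_atTop 0
  refine JetO.comp (F := fun x => G x i j - if i = j then φ ‖x‖ else 0)
    (ψ := fun a : ℝ × USphere d => sphereParam a.1 a.2) (ρ := fun a => a.1) ?_ ?_
    (fun b k => (jetO_pd_sphereParam b k).val) (fun b c k => (jetO_pd_sphereParam c k).d1 b)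
    ?_ (fun k => ?_) (fun k k' => ?_)
  · simp only [sphereParam_zero]
    exact tendsto_smul_largeSpheres.eventually (hG.contDiffAt_sub i j)
  · refine .of_forall fun a => ?_
    obtain ⟨ι, -, hι⟩ := exists_sphereParam_eq a.2
    exact (contDiff_of_sphereParam_eq (hι a.1)).contDiffAt
  · simp only [sphereParam_zero]
    exact isBigO_largeSpheres (hG.decay i j)
  · simp only [sphereParam_zero]
    refine ((isBigO_largeSpheres (hG.decay_deriv i j k)).mul (isBigO_refl _ _)).congr' .rfl ?_
    filter_upwards [hr] with a ha
    rw [zpow_sub_one₀ ha, inv_mul_cancel_right₀ ha]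
  · simp only [sphereParam_zero]
    refine (((isBigO_largeSpheres (hG.decay_deriv₂ i j k k')).mul (isBigO_refl _ _)).mul
      (isBigO_refl _ _)).congr' .rfl ?_
    filter_upwards [hr] with a ha
    rw [show (-(d : ℤ) - 2) = -d - 1 - 1 by ring, zpow_sub_one₀ ha, zpow_sub_one₀ ha,
      inv_mul_cancel_right₀ ha, inv_mul_cancel_right₀ ha]

theorem ConformalDecay.eventually_pos {G : MetricField (d + 1)} {φ : ℝ → ℝ}
    (hG : ConformalDecay G φ) : ∀ᶠ a in largeSpheres d, 0 < a.1 ∧ 0 < φ a.1 :=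
  (tendsto_fst_largeSpheres.eventually_gt_atTop 0).and
    ((hG.tendsto.comp tendsto_fst_largeSpheres).eventually (lt_mem_nhds zero_lt_one))

/-- The conformal factor of the unit sphere in stereographic coordinates. -/
def stereoFactor (d : ℕ) (y : Eu d) : ℝ := 16 * ((‖y‖ ^ 2 + 4)⁻¹) ^ 2

theorem contDiff_stereoFactor {n : ℕ∞ω} : ContDiff ℝ n (stereoFactor d) :=
  contDiff_const.mul (contDiff_inv_norm_sq_add_four.pow 2)

theorem pd_stereoFactor (k : Fin d) :
    pd k (stereoFactor d) = fun y => -64 * ((‖y‖ ^ 2 + 4)⁻¹ ^ 3 * y k) := by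
  ext y
  have hq : DifferentiableAt ℝ (fun y : Eu d => (‖y‖ ^ 2 + 4)⁻¹) y :=
    (contDiff_inv_norm_sq_add_four (n := 1)).differentiable (by norm_num) y
  have : stereoFactor d = fun y => 16 * ((‖y‖ ^ 2 + 4)⁻¹ * (‖y‖ ^ 2 + 4)⁻¹) := by
    ext y; simp only [stereoFactor]; ring
  rw [this, pd_const_mul, pd_mul hq hq, pd_inv_norm_sq_add_four]
  ring

theorem pd_pd_stereoFactor_zero (k l : Fin d) :
    pd k (pd l (stereoFactor d)) 0 = if k = l then -1 else 0 := by
  have hq : DifferentiableAt ℝ (fun y : Eu d => (‖y‖ ^ 2 + 4)⁻¹ ^ 3) 0 :=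
    ((contDiff_inv_norm_sq_add_four (n := 1)).pow 3).differentiable (by norm_num) 0
  rw [pd_stereoFactor, pd_const_mul, pd_mul (g := fun y => y l) hq (by fun_prop), pd_coord]
  by_cases h : k = l
  · simp [h]; norm_num
  · simp [h, Ne.symm h]

/-- Since |x| = r along the parametrization, φ(|x|) is constant there and the model part pulls back
exactly to φ(r)r² times the round metric. The rest is r^{-d}, times r² from the two tangent vectors,
divided by φ(r)r². -/
theorem ConformalDecay.jetO_pullback {G : MetricField (d + 1)} {φ : ℝ → ℝ}
    (hG : ConformalDecay G φ) (p q : Fin d) :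
    JetO (largeSpheres d) (fun a y =>
      ((φ a.1 * a.1 ^ 2)⁻¹ • pullback G (sphereParam a.1 a.2) y) p q -
        (if p = q then 1 else 0) * stereoFactor d y)
      fun a => a.1 ^ (-(d : ℤ)) := by
  have h1 := JetO.sum (s := Finset.univ) fun i _ => JetO.sum (s := Finset.univ) fun j _ =>
    ((hG.jetO_sub i j).mul (jetO_pd_sphereParam p i)).mul (jetO_pd_sphereParam q j)
  have hc : (fun a : ℝ × USphere d => (φ a.1 * a.1 ^ 2)⁻¹) =O[largeSpheres d]
      fun a => (a.1 ^ 2)⁻¹ := by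
    have : (fun a : ℝ × USphere d => (φ a.1)⁻¹) =O[largeSpheres d] fun _ => (1 : ℝ) :=
      ((hG.tendsto.inv₀ one_ne_zero).comp tendsto_fst_largeSpheres).isBigO_one ℝ
    simpa [mul_inv, mul_comm] using this.mul (isBigO_refl (fun a : ℝ × USphere d => (a.1 ^ 2)⁻¹) _)
  refine ((JetO.const_mul hc h1).congr ?_).mono (IsBigO.of_bound 1 ?_)
  · filter_upwards [hG.eventually_pos] with a ha
    refine .of_forall fun y => ?_
    obtain ⟨ι, hθ, hι⟩ := exists_sphereParam_eq a.2
    have hs := sum_pd_sphereParam_mul hθ (hι a.1) p q y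
    have hs' : ∑ i, ∑ j, (if i = j then φ a.1 else 0) *
        pd p (fun z => sphereParam a.1 a.2 z i) y * pd q (fun z => sphereParam a.1 a.2 z j) y =
        φ a.1 * (a.1 ^ 2 * (stereoFactor d y * if p = q then 1 else 0)) := by
      rw [stereoFactor, ← hs, Finset.mul_sum]
      refine Finset.sum_congr rfl fun i _ => ?_
      simp [mul_assoc]
    have e : (if p = q then 1 else 0) * stereoFactor d y = (φ a.1 * a.1 ^ 2)⁻¹ *
        (φ a.1 * (a.1 ^ 2 * (stereoFactor d y * if p = q then 1 else 0))) := by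
      have := ha.1.ne'
      have := ha.2.ne'
      field_simp
    beta_reduce
    rw [e, ← hs', Matrix.smul_apply, smul_eq_mul, ← mul_sub, pullback, Matrix.of_apply,
      ← Finset.sum_sub_distrib]
    congr 1
    refine Finset.sum_congr rfl fun i _ => ?_
    rw [← Finset.sum_sub_distrib]
    refine Finset.sum_congr rfl fun j _ => ?_
    rw [norm_sphereParam ha.1.le]
    ring
  · filter_upwards [hG.eventually_pos] with a ha
    have := ha.1.ne'
    apply le_of_eq
    rw [one_mul]
    congr 1
    field_simp

/-- After division by φr² the jets converge to one fixed jet, so differentiability of `jetScalar` at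
`roundJet` suffices. No derivative of φ enters. -/
theorem ConformalDecay.isBigO_sphereScalarCurvature {G : MetricField (d + 1)} {φ : ℝ → ℝ}
    (hG : ConformalDecay G φ) (hd : 0 < d) :
    (fun a => φ a.1 * a.1 ^ 2 * sphereScalarCurvature G a.1 a.2 - (d : ℝ) * (d - 1))
      =O[largeSpheres d] fun a => a.1 ^ (-(d : ℤ)) := by
  set γ : ℝ × USphere d → MetricField d := fun a y =>
    (φ a.1 * a.1 ^ 2)⁻¹ • pullback G (sphereParam a.1 a.2) y with hγ
  have hJ := hG.jetO_pullback
  have hs : ∀ᶠ a in largeSpheres d, ∀ p q, ContDiffAt ℝ 2 (fun y => γ a y p q -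
      (if p = q then 1 else 0) * stereoFactor d y) 0 :=
    eventually_all.2 fun p => eventually_all.2 fun q => (hJ p q).smooth
  have hδ (p q : Fin d) : ContDiffAt ℝ 2
      (fun y => (if p = q then 1 else 0) * stereoFactor d y) 0 :=
    contDiffAt_const.mul contDiff_stereoFactor.contDiffAt
  have hs' : ∀ᶠ a in largeSpheres d, ∀ p q, ContDiffAt ℝ 2 (fun y => γ a y p q) 0 := by
    filter_upwards [hs] with a ha p q
    simpa using (ha p q).add (hδ p q)
  have hO : (fun a => ((jet0 (γ a) 0, jet1 (γ a) 0), jet2 (γ a) 0) - roundJet d)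
      =O[largeSpheres d] fun a => a.1 ^ (-(d : ℤ)) := by
    refine IsBigO.prod_left (IsBigO.prod_left ?_ ?_) ?_
    · refine isBigO_pi.2 fun p => isBigO_pi.2 fun q => (hJ p q).val.congr_left fun a => ?_
      simp [jet0, roundJet, hγ, stereoFactor]
      norm_num
    · refine isBigO_pi.2 fun k => isBigO_pi.2 fun p => isBigO_pi.2 fun q =>
        ((hJ p q).d1 k).congr' ?_ .rfl
      filter_upwards [hs'] with a ha
      rw [pd_sub ((ha p q).differentiableAt (by norm_num))
        ((hδ p q).differentiableAt (by norm_num)), pd_const_mul, pd_stereoFactor]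
      simp [jet1, roundJet, hγ]
    · refine isBigO_pi.2 fun k => isBigO_pi.2 fun l => isBigO_pi.2 fun p => isBigO_pi.2 fun q =>
        ((hJ p q).d2 k l).congr' ?_ .rfl
      filter_upwards [hs'] with a ha
      rw [pd_pd_sub (ha p q) (hδ p q), pd_pd_const_mul, pd_pd_stereoFactor_zero]
      simp [jet2, roundJet, hγ]
      split_ifs <;> simp
  have h0 := tendsto_zpow_neg (k := -(d : ℤ)) (tendsto_fst_largeSpheres (d := d)) (by simpa)
  have hdet : ∀ᶠ a in largeSpheres d, (γ a 0).det ≠ 0 := by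
    have h1 : Tendsto (fun a => jet0 (γ a) 0) (largeSpheres d) (𝓝 (roundJet d).1.1) := by
      have := (hO.trans_tendsto h0).add_const (roundJet d)
      simp only [sub_add_cancel, zero_add] at this
      exact ((continuous_fst.comp continuous_fst).tendsto _).comp this
    have h2 : Continuous fun P : Jet0 d => (Matrix.of P).det :=
      (contDiff_det (n := 0) (A := fun P : Jet0 d => Matrix.of P) fun i j => by
        simp only [Matrix.of_apply]; fun_prop).continuous
    have h3 := (h2.tendsto _).comp h1
    have h4 : (Matrix.of (roundJet d).1.1).det ≠ 0 := by simp [roundJet, of_ite_eq_one]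
    exact h3.eventually_ne h4
  refine (isBigO_jetScalar_sub hO h0).congr' ?_ .rfl
  filter_upwards [hs', hdet, hG.eventually_pos] with a h1 h2 h3
  have hne : φ a.1 * a.1 ^ 2 ≠ 0 := (mul_pos h3.2 (pow_pos h3.1 2)).ne'
  rw [← scalarCurvature_eq_jetScalar h1 h2, hγ, scalarCurvature_smul (inv_ne_zero hne), inv_inv,
    sphereScalarCurvature, chartAt_self_eq_zero]

end SphereAsymptotics

/-! ### Mean curvature of large coordinate spheres -/

section MeanCurvatureAsymptotics

open Asymptotics

variable {d : ℕ} {G : MetricField (d + 1)} {φ : ℝ → ℝ}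

theorem pd_norm {m : ℕ} {x : Eu m} (hx : x ≠ 0) (k : Fin m) :
    pd k (fun y : Eu m => ‖y‖) x = x k / ‖x‖ := by
  have h : (fun y : Eu m => ‖y‖) = fun y => √(‖y‖ ^ 2) := by
    ext y; rw [Real.sqrt_sq (norm_nonneg _)]
  have h0 : ‖x‖ ^ 2 ≠ 0 := by positivity
  rw [h, pd_scomp (f := fun y : Eu m => ‖y‖ ^ 2) (Real.hasDerivAt_sqrt h0).differentiableAt (differentiableAt_id.norm_sq ℝ),
    (Real.hasDerivAt_sqrt h0).deriv, pd_norm_sq, Real.sqrt_sq (norm_nonneg _)]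
  have : ‖x‖ ≠ 0 := by positivity
  field_simp

theorem pd_comp_norm {m : ℕ} {x : Eu m} (hx : x ≠ 0) (hφ : DifferentiableAt ℝ φ ‖x‖) (k : Fin m) :
    pd k (fun y : Eu m => φ ‖y‖) x = deriv φ ‖x‖ * (x k / ‖x‖) := by
  rw [pd_scomp hφ ((contDiffAt_norm ℝ hx (n := 1)).differentiableAt (by norm_num)), pd_norm hx]

theorem norm_smul_sphere {r : ℝ} (hr : 0 < r) (θ : USphere d) :
    ‖r • (θ : Eu (d + 1))‖ = r := by
  simp [norm_smul, abs_of_pos hr]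

theorem smul_sphere_ne_zero {r : ℝ} (hr : 0 < r) (θ : USphere d) :
    r • (θ : Eu (d + 1)) ≠ 0 := by
  rw [← norm_pos_iff, norm_smul_sphere hr]; exact hr

/-- The point θ may vary with the index; boundedness of its coordinates replaces convergence. -/
theorem tendsto_sum_inv_mul_sphere {α : Type*} {l : Filter α} {P : α → Jet0 (d + 1)}
    {θ : α → USphere d} (hP : Tendsto P l (𝓝 fun i j => if i = j then 1 else 0)) :
    Tendsto (fun a => ∑ k, ∑ j, (Matrix.of (P a))⁻¹ k j * (θ a : Eu (d + 1)) k *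
      (θ a : Eu (d + 1)) j) l (𝓝 1) := by
  have h1 (a : α) : ∑ k, ∑ j, (if k = j then (1 : ℝ) else 0) * (θ a : Eu (d + 1)) k *
      (θ a : Eu (d + 1)) j = 1 := by
    simp [sum_sq_coord]
  have hdet : (Matrix.of fun i j : Fin (d + 1) => if i = j then (1 : ℝ) else 0).det ≠ 0 := by
    simp [of_ite_eq_one]
  have h2 (k j : Fin (d + 1)) : Tendsto (fun a => (Matrix.of (P a))⁻¹ k j -
      if k = j then (1 : ℝ) else 0) l (𝓝 0) := by
    have := ((contDiffAt_inv_apply (n := 0) hdet k j).continuousAt.tendsto.comp hP).sub_const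
      (if k = j then (1 : ℝ) else 0)
    simpa [of_ite_eq_one, Matrix.one_apply] using this
  have h3 : Tendsto (fun a => ∑ k, ∑ j, ((Matrix.of (P a))⁻¹ k j - if k = j then (1 : ℝ) else 0) *
      (θ a : Eu (d + 1)) k * (θ a : Eu (d + 1)) j) l (𝓝 0) := by
    have e : ∑ k : Fin (d + 1), ∑ j : Fin (d + 1), (0 : ℝ) = 0 := by simp
    refine Tendsto.mono_right ?_ (le_of_eq (congrArg 𝓝 e))
    refine tendsto_finsetSum _ fun k _ => tendsto_finsetSum _ fun j _ => ?_
    refine IsBigO.trans_tendsto (IsBigO.of_bound 1 (.of_forall fun a => ?_)) (h2 k j)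
    have hθ (i : Fin (d + 1)) : ‖(θ a : Eu (d + 1)) i‖ ≤ 1 := (abs_coord_le _ _).trans (by simp)
    simp only [Real.norm_eq_abs, mul_assoc, abs_mul, one_mul] at hθ ⊢
    exact mul_le_of_le_one_right (abs_nonneg _) (mul_le_one₀ (hθ k) (abs_nonneg _) (hθ j))
  have h4 := h3.add_const 1
  rw [zero_add] at h4
  refine h4.congr fun a => ?_
  conv_lhs => rhs; rw [← h1 a]
  rw [← Finset.sum_add_distrib]
  refine Finset.sum_congr rfl fun k _ => ?_
  rw [← Finset.sum_add_distrib]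
  exact Finset.sum_congr rfl fun j _ => by ring

theorem eventually_det_ne_zero {m : ℕ} {α : Type*} {l : Filter α} {P : α → Jet0 m}
    (hP : Tendsto P l (𝓝 fun i j => if i = j then 1 else 0)) :
    ∀ᶠ a in l, (Matrix.of (P a)).det ≠ 0 := by
  have hdet : (Matrix.of fun i j : Fin m => if i = j then (1 : ℝ) else 0).det ≠ 0 := by
    simp [of_ite_eq_one]
  have hcont : Continuous fun P : Jet0 m => (Matrix.of P).det :=
    (contDiff_det (n := 0) (A := fun P : Jet0 m => Matrix.of P) fun i j => by
      simp only [Matrix.of_apply]; fun_prop).continuous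
  exact ((hcont.tendsto _).comp hP).eventually_ne hdet

/-- The metric y ↦ G(ry) has 1-jet (g, r∂g) at θ; the base point now ranges over the unit sphere, as
the compactness argument requires. -/
theorem eventually_mul_meanCurvature_eq
    (h0 : Tendsto (fun a : ℝ × USphere d => jet0 G (a.1 • (a.2 : Eu (d + 1))))
      (largeSpheres d) (𝓝 fun i j => if i = j then 1 else 0))
    (hd : ∀ᶠ a : ℝ × USphere d in largeSpheres d, ∀ i j,
      DifferentiableAt ℝ (fun y => G y i j) (a.1 • (a.2 : Eu (d + 1)))) :
    ∀ᶠ a : ℝ × USphere d in largeSpheres d, a.1 * meanCurvature G (a.1 • (a.2 : Eu (d + 1))) =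
      jetMean ((jet0 G (a.1 • (a.2 : Eu (d + 1))), a.1 • jet1 G (a.1 • (a.2 : Eu (d + 1)))),
        (a.2 : Eu (d + 1))) := by
  filter_upwards [eventually_det_ne_zero h0, (tendsto_sum_inv_mul_sphere h0
    (θ := fun a => a.2)).eventually (lt_mem_nhds zero_lt_one), hd,
    tendsto_fst_largeSpheres.eventually_gt_atTop 0] with a h1 h2 h3 h4
  have hsm : DifferentiableAt ℝ (fun z : Eu (d + 1) => a.1 • z) (a.2 : Eu (d + 1)) := by fun_prop
  rw [← meanCurvature_comp_smul h4, meanCurvature_eq_jetMean (G := fun z => G (a.1 • z))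
    (fun i j => (h3 i j).comp (a.2 : Eu (d + 1)) hsm) h1 h2]
  congr 3
  ext k i j
  exact pd_comp_smul a.1 (fun y => G y i j) _

theorem ConformalDecay.isBigO_jet0 (hG : ConformalDecay G φ) :
    (fun a : ℝ × USphere d => jet0 G (a.1 • (a.2 : Eu (d + 1))) -
      fun i j => if i = j then φ a.1 else 0) =O[largeSpheres d] fun a => a.1 ^ (-(d : ℤ)) := by
  refine isBigO_pi.2 fun i => isBigO_pi.2 fun j =>
    (isBigO_largeSpheres (hG.decay i j)).congr' ?_ .rfl
  filter_upwards [hG.eventually_pos] with a ha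
  simp only [norm_smul_sphere ha.1]
  rfl

theorem ConformalDecay.tendsto_factor (hG : ConformalDecay G φ) :
    Tendsto (fun a : ℝ × USphere d => fun i j : Fin (d + 1) => if i = j then φ a.1 else 0)
      (largeSpheres d) (𝓝 fun i j => if i = j then 1 else 0) := by
  refine tendsto_pi_nhds.2 fun i => tendsto_pi_nhds.2 fun j => ?_
  split_ifs
  · exact hG.tendsto.comp tendsto_fst_largeSpheres
  · exact tendsto_const_nhds

theorem ConformalDecay.tendsto_jet0 (hG : ConformalDecay G φ) (hd : 0 < d) :
    Tendsto (fun a : ℝ × USphere d => jet0 G (a.1 • (a.2 : Eu (d + 1))))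
      (largeSpheres d) (𝓝 fun i j => if i = j then 1 else 0) := by
  have h0 := tendsto_zpow_neg (k := -(d : ℤ)) (tendsto_fst_largeSpheres (d := d)) (by simpa)
  simpa using (hG.isBigO_jet0.trans_tendsto h0).add hG.tendsto_factor

theorem smul_one_apply (x : Eu (d + 1)) (i j : Fin (d + 1)) :
    (φ ‖x‖ • (1 : Matrix (Fin (d + 1)) (Fin (d + 1)) ℝ)) i j = if i = j then φ ‖x‖ else 0 := by
  simp [Matrix.one_apply]

theorem ConformalDecay.eventually_differentiableAt (hG : ConformalDecay G φ) :
    ∀ᶠ a : ℝ × USphere d in largeSpheres d, ∀ i j,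
      DifferentiableAt ℝ (fun y => G y i j) (a.1 • (a.2 : Eu (d + 1))) :=
  eventually_all.2 fun i => eventually_all.2 fun j =>
    (tendsto_smul_largeSpheres.eventually (hG.smooth i j)).mono fun a h =>
      h.differentiableAt (by norm_num)

theorem ConformalDecay.eventually_differentiableAt_factor (hG : ConformalDecay G φ) :
    ∀ᶠ a : ℝ × USphere d in largeSpheres d, DifferentiableAt ℝ φ a.1 ∧ ∀ i j : Fin (d + 1),
      DifferentiableAt ℝ (fun y : Eu (d + 1) => if i = j then φ ‖y‖ else 0)
        (a.1 • (a.2 : Eu (d + 1))) := by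
  filter_upwards [tendsto_smul_largeSpheres.eventually hG.contDiffAt_factor,
    tendsto_fst_largeSpheres.eventually hG.smooth_factor] with a h h'
  refine ⟨h'.differentiableAt (by norm_num), fun i j => ?_⟩
  split_ifs
  exacts [h.differentiableAt (by norm_num), differentiableAt_const _]

theorem ConformalDecay.isBigO_jet1 (hG : ConformalDecay G φ) :
    (fun a : ℝ × USphere d => a.1 • jet1 G (a.1 • (a.2 : Eu (d + 1))) -
      a.1 • jet1 (fun x => φ ‖x‖ • (1 : Matrix (Fin (d + 1)) (Fin (d + 1)) ℝ))
        (a.1 • (a.2 : Eu (d + 1)))) =O[largeSpheres d] fun a => a.1 ^ (-(d : ℤ)) := by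
  refine isBigO_pi.2 fun k => isBigO_pi.2 fun i => isBigO_pi.2 fun j => ?_
  refine ((isBigO_refl (fun a : ℝ × USphere d => a.1) _).mul
    (isBigO_largeSpheres (hG.decay_deriv i j k))).congr' ?_ ?_
  · filter_upwards [hG.eventually_differentiableAt, hG.eventually_differentiableAt_factor]
      with a h1 h2
    rw [pd_sub (h1 i j) (h2.2 i j), mul_sub]
    simp only [jet1, Pi.sub_apply, Pi.smul_apply, smul_eq_mul, smul_one_apply]
  · filter_upwards [hG.eventually_pos] with a ha
    rw [zpow_sub_one₀ ha.1.ne', mul_comm, inv_mul_cancel_right₀ ha.1.ne']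

theorem ConformalDecay.tendsto_jet1_factor (hG : ConformalDecay G φ)
    (hφ' : Tendsto (fun r => r * deriv φ r) atTop (𝓝 0)) :
    Tendsto (fun a : ℝ × USphere d =>
      a.1 • jet1 (fun x => φ ‖x‖ • (1 : Matrix (Fin (d + 1)) (Fin (d + 1)) ℝ))
        (a.1 • (a.2 : Eu (d + 1)))) (largeSpheres d) (𝓝 0) := by
  refine tendsto_pi_nhds.2 fun k => tendsto_pi_nhds.2 fun i => tendsto_pi_nhds.2 fun j => ?_
  have h1 : Tendsto (fun a : ℝ × USphere d => a.1 * deriv φ a.1) (largeSpheres d) (𝓝 0) :=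
    hφ'.comp tendsto_fst_largeSpheres
  refine IsBigO.trans_tendsto (IsBigO.of_bound 1 ?_) h1
  filter_upwards [hG.eventually_pos, hG.eventually_differentiableAt_factor] with a ha hφa
  have hne := smul_sphere_ne_zero ha.1 a.2
  have hn := norm_smul_sphere ha.1 a.2
  simp only [jet1, Pi.smul_apply, smul_eq_mul, smul_one_apply]
  by_cases hij : i = j
  · simp only [hij, if_true]
    rw [pd_comp_norm hne (by rw [hn]; exact hφa.1), hn, ← mul_assoc, norm_mul, one_mul]
    refine mul_le_of_le_one_right (norm_nonneg _) ?_
    have := abs_coord_le (a.1 • (a.2 : Eu (d + 1))) k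
    rw [hn] at this
    rw [Real.norm_eq_abs, abs_div, abs_of_pos ha.1]
    exact div_le_one_of_le₀ this ha.1.le
  · simp only [hij, if_false, pd_const, mul_zero, norm_zero]
    positivity

theorem ConformalDecay.mul_meanCurvature_factor (hG : ConformalDecay G φ) :
    ∀ᶠ a : ℝ × USphere d in largeSpheres d,
      a.1 * meanCurvature (fun x => φ ‖x‖ • (1 : Matrix (Fin (d + 1)) (Fin (d + 1)) ℝ))
        (a.1 • (a.2 : Eu (d + 1))) =
      d * ((1 + a.1 * deriv φ a.1 / (2 * φ a.1)) / √(φ a.1)) := by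
  filter_upwards [hG.eventually_pos, hG.eventually_differentiableAt_factor] with a h8 h7
  have hn := norm_smul_sphere h8.1 a.2
  have hne := smul_sphere_ne_zero h8.1 a.2
  have h6 := h7.2 0 0
  simp only [if_true] at h6
  rw [meanCurvature_smul_one hne h6 (by rw [hn]; exact h8.2) (b := deriv φ a.1 / a.1)
      (fun k => by rw [pd_comp_norm hne (by rw [hn]; exact h7.1), hn]; ring), hn,
    Real.sqrt_mul h8.2.le, Real.sqrt_sq h8.1.le]
  have := h8.1.ne'
  have := h8.2.ne'
  have : √(φ a.1) ≠ 0 := (Real.sqrt_pos.2 h8.2).ne'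
  push_cast
  field_simp
  ring

/-- Compares `jetMean` at the rescaled jets of G and of the conformal model, both of which tend to
the flat jet; for the model's first derivatives this is `hφ'`. The model value is then explicit. -/
theorem ConformalDecay.isBigO_meanCurvature_sub (hG : ConformalDecay G φ) (hd : 0 < d)
    (hφ' : Tendsto (fun r => r * deriv φ r) atTop (𝓝 0)) :
    (fun a : ℝ × USphere d => a.1 * meanCurvature G (a.1 • (a.2 : Eu (d + 1))) -
      d * ((1 + a.1 * deriv φ a.1 / (2 * φ a.1)) / √(φ a.1)))
      =O[largeSpheres d] fun a => a.1 ^ (-(d : ℤ)) := by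
  have h0 := tendsto_zpow_neg (k := -(d : ℤ)) (tendsto_fst_largeSpheres (d := d)) (by simpa)
  have hT1 := hG.tendsto_jet1_factor hφ'
  have hS0 : ∀ᶠ a : ℝ × USphere d in largeSpheres d,
      jet0 (fun x => φ ‖x‖ • (1 : Matrix (Fin (d + 1)) (Fin (d + 1)) ℝ))
        (a.1 • (a.2 : Eu (d + 1))) = fun i j => if i = j then φ a.1 else 0 := by
    filter_upwards [hG.eventually_pos] with a ha
    ext i j
    simp only [jet0]
    rw [smul_one_apply, norm_smul_sphere ha.1]
  have hS0' := hS0.mono fun a h => h.symm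
  have hT0 := hG.tendsto_factor.congr' hS0'
  have hO0 : (fun a : ℝ × USphere d => jet0 G (a.1 • (a.2 : Eu (d + 1))) -
      jet0 (fun x => φ ‖x‖ • (1 : Matrix (Fin (d + 1)) (Fin (d + 1)) ℝ))
        (a.1 • (a.2 : Eu (d + 1)))) =O[largeSpheres d] fun a => a.1 ^ (-(d : ℤ)) := by
    refine hG.isBigO_jet0.congr' ?_ .rfl
    filter_upwards [hS0] with a h
    rw [h]
  have hO := IsBigO.prod_left hO0 hG.isBigO_jet1
  have key := isBigO_comp_sub_of_isCompact (f := jetMean) (isCompact_sphere (0 : Eu (d + 1)) 1)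
    (p₀ := (fun i j => if i = j then 1 else 0, 0))
    (fun z hz => contDiffAt_jetMean (by simp [of_ite_eq_one]) (by
      have hz1 : ‖z‖ = 1 := by simpa using hz
      simp [of_ite_eq_one, Matrix.one_apply, sum_sq_coord, hz1]))
    ((hG.tendsto_jet0 hd).prodMk_nhds
      (by simpa using (hG.isBigO_jet1.trans_tendsto h0).add hT1))
    (hT0.prodMk_nhds hT1)
    (z := fun a : ℝ × USphere d => (a.2 : Eu (d + 1))) (fun a => a.2.2)
  refine (key.trans hO).congr' ?_ .rfl
  filter_upwards [eventually_mul_meanCurvature_eq (hG.tendsto_jet0 hd)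
      hG.eventually_differentiableAt, eventually_mul_meanCurvature_eq hT0
      (hG.eventually_differentiableAt_factor.mono fun a h i j => by
        simp only [smul_one_apply]; exact h.2 i j),
    hG.mul_meanCurvature_factor] with a h1 h2 h3
  rw [h1, ← h3, h2]

end MeanCurvatureAsymptotics

/-! ### Expansions of curvature for asymptotically Schwarzschild metrics -/

section Expansions

open Asymptotics

/-- Mean value inequality for t ↦ f t - f' t on |t| ≤ |s|: its derivative there is at most C|s|
because the derivative of f is differentiable at 0. -/
theorem isBigO_taylor_two {f : ℝ → ℝ} {f' : ℝ} (hf : ContDiffAt ℝ 2 f 0) (h : HasDerivAt f f' 0) :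
    (fun s => f s - f 0 - f' * s) =O[𝓝 0] fun s => s ^ 2 := by
  have hd : DifferentiableAt ℝ (deriv f) 0 := by
    have : ContDiffAt ℝ 1 (fun x => fderiv ℝ f x 1) 0 :=
      (hf.fderiv_right (m := 1) (by norm_num)).clm_apply contDiffAt_const
    exact this.differentiableAt (by norm_num)
  obtain ⟨C, hC⟩ := hd.hasDerivAt.isBigO_sub.bound
  have hev : ∀ᶠ s in 𝓝 (0 : ℝ), DifferentiableAt ℝ f s :=
    (hf.eventually (by simp)).mono fun _ h => h.differentiableAt (by norm_num)
  obtain ⟨δ, hδ, hb⟩ := Metric.eventually_nhds_iff_ball.1 (hC.and hev)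
  refine IsBigO.of_bound C ?_
  filter_upwards [Metric.ball_mem_nhds 0 hδ] with s hs
  have hs' : |s| < δ := by simpa using hs
  have hsub : ∀ t ∈ Metric.closedBall (0 : ℝ) |s|, t ∈ Metric.ball (0 : ℝ) δ := fun t ht => by
    simp only [Metric.mem_closedBall, dist_zero_right, Metric.mem_ball] at ht ⊢
    exact ht.trans_lt hs'
  have hC0 : 0 ≤ C * |s| := by
    have := (hb s hs).1
    simp only [sub_zero] at this
    exact (norm_nonneg _).trans this
  have key := (convex_closedBall (0 : ℝ) |s|).norm_image_sub_le_of_norm_hasDerivWithin_le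
    (f := fun t => f t - f' * t) (f' := fun t => deriv f t - f') (C := C * |s|)
    (fun t ht => (((hb t (hsub t ht)).2.hasDerivAt.sub
      ((hasDerivAt_id t).const_mul f')).congr_deriv (by simp)).hasDerivWithinAt)
    (fun t ht => by
      have h1 := (hb t (hsub t ht)).1
      rw [h.deriv, sub_zero] at h1
      refine h1.trans ?_
      have ht' : |t| ≤ |s| := by simpa using ht
      by_cases hs0 : s = 0
      · have : t = 0 := by simpa [hs0] using ht'
        simp [this, hs0]
      · have : 0 ≤ C := nonneg_of_mul_nonneg_left hC0 (abs_pos.2 hs0)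
        exact mul_le_mul_of_nonneg_left ht' this)
    (x := 0) (y := s) (by simp) (by simp)
  simp only [sub_zero, mul_zero] at key
  refine le_trans (le_of_eq ?_) (key.trans (le_of_eq ?_))
  · congr 1; ring
  · rw [Real.norm_eq_abs, Real.norm_eq_abs, abs_sq, mul_assoc, abs_mul_abs_self, sq]

variable {d : ℕ}

/-- The conformal factor of the Schwarzschild metric as a function of the radius. -/
def schwarzschildFactor (d : ℕ) (m r : ℝ) : ℝ :=
  (1 + m / (2 * r ^ (d - 1))) ^ (4 / ((d : ℝ) - 1))

theorem schwarzschildFactor_eq (m r : ℝ) :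
    schwarzschildFactor d m r = (1 + m * (r ^ (d - 1))⁻¹ / 2) ^ (4 / ((d : ℝ) - 1)) := by
  rw [schwarzschildFactor]; congr 2; field_simp

theorem tendsto_inv_pow_atTop (hd : 2 ≤ d) :
    Tendsto (fun r : ℝ => (r ^ (d - 1))⁻¹) atTop (𝓝 0) :=
  (tendsto_pow_atTop (by omega)).inv_tendsto_atTop

theorem eventually_base_pos (hd : 2 ≤ d) (m : ℝ) :
    ∀ᶠ r : ℝ in atTop, 0 < r ∧ 0 < 1 + m * (r ^ (d - 1))⁻¹ / 2 := by
  have h : Tendsto (fun r : ℝ => 1 + m * (r ^ (d - 1))⁻¹ / 2) atTop (𝓝 1) := by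
    simpa using (((tendsto_inv_pow_atTop hd).const_mul m).div_const 2).const_add 1
  exact (eventually_gt_atTop 0).and (h.eventually (lt_mem_nhds zero_lt_one))

theorem contDiffAt_one_add_rpow {m q s : ℝ} {n : ℕ∞ω} (hs : 0 < 1 + m * s / 2) :
    ContDiffAt ℝ n (fun s : ℝ => (1 + m * s / 2) ^ q) s := by
  refine ContDiffAt.rpow_const_of_ne ?_ hs.ne'
  fun_prop

theorem hasDerivAt_one_add_rpow {m q s : ℝ} (hs : 0 < 1 + m * s / 2) :
    HasDerivAt (fun s : ℝ => (1 + m * s / 2) ^ q) (m / 2 * q * (1 + m * s / 2) ^ (q - 1)) s := by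
  have h : HasDerivAt (fun s : ℝ => 1 + m * s / 2) (m / 2) s := by
    simpa using (((hasDerivAt_id s).const_mul m).div_const 2).const_add 1
  exact h.rpow_const (Or.inl hs.ne')

theorem hasDerivAt_inv_pow {r : ℝ} (hr : 0 < r) (k : ℕ) :
    HasDerivAt (fun r : ℝ => (r ^ k)⁻¹) (-(k * (r ^ k)⁻¹ / r)) r := by
  have h := (hasDerivAt_pow k r).inv (pow_pos hr k).ne'
  refine h.congr_deriv ?_
  rcases k with _ | k
  · simp
  · have := hr.ne'
    simp only [Nat.add_sub_cancel]
    field_simp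
    ring

theorem contDiffAt_schwarzschildFactor {m r : ℝ} (hr : 0 < r)
    (h : 0 < 1 + m * (r ^ (d - 1))⁻¹ / 2) {n : ℕ∞ω} :
    ContDiffAt ℝ n (schwarzschildFactor d m) r := by
  rw [show schwarzschildFactor d m = _ from funext (schwarzschildFactor_eq m)]
  exact (contDiffAt_one_add_rpow h).comp (g := fun s : ℝ => (1 + m * s / 2) ^ (4 / ((d : ℝ) - 1)))
    (f := fun r : ℝ => (r ^ (d - 1))⁻¹) r ((contDiffAt_id.pow _).inv (pow_pos hr _).ne')

/-- The factor d - 1 from differentiating r^{-(d-1)} cancels the denominator of the exponent: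
(m/2)·(4/(d-1))·(d-1) = 2m. -/
theorem mul_deriv_schwarzschildFactor (hd : 2 ≤ d) {m r : ℝ} (hr : 0 < r)
    (h : 0 < 1 + m * (r ^ (d - 1))⁻¹ / 2) :
    r * deriv (schwarzschildFactor d m) r = -2 * m * (r ^ (d - 1))⁻¹ *
      (1 + m * (r ^ (d - 1))⁻¹ / 2) ^ (4 / ((d : ℝ) - 1) - 1) := by
  have h1 := (hasDerivAt_one_add_rpow (q := 4 / ((d : ℝ) - 1)) h).comp r
    (hasDerivAt_inv_pow hr (d - 1))
  have e : schwarzschildFactor d m = (fun s : ℝ => (1 + m * s / 2) ^ (4 / ((d : ℝ) - 1))) ∘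
      fun r : ℝ => (r ^ (d - 1))⁻¹ := funext (schwarzschildFactor_eq m)
  rw [e, h1.deriv]
  have hd' : ((d - 1 : ℕ) : ℝ) = d - 1 := by rw [Nat.cast_sub (by omega)]; simp
  have hc : (d : ℝ) - 1 ≠ 0 := by
    have : (2 : ℝ) ≤ d := by exact_mod_cast hd
    intro h; linarith
  rw [hd']
  field_simp
  ring

theorem tendsto_schwarzschildFactor (hd : 2 ≤ d) (m : ℝ) :
    Tendsto (schwarzschildFactor d m) atTop (𝓝 1) := by
  have h1 := (hasDerivAt_one_add_rpow (m := m) (q := 4 / ((d : ℝ) - 1)) (s := 0)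
    (by norm_num)).continuousAt.tendsto.comp (tendsto_inv_pow_atTop hd)
  rw [show schwarzschildFactor d m = _ from funext (schwarzschildFactor_eq m)]
  simpa [Function.comp_def] using h1

/-- The leading behaviour of the derivative of the Schwarzschild factor. -/
theorem tendsto_deriv_schwarzschildFactor (hd : 2 ≤ d) (m : ℝ) :
    Tendsto (fun r => r ^ (d - 1) * (r * deriv (schwarzschildFactor d m) r)) atTop
      (𝓝 (-2 * m)) := by
  have h1 := ((hasDerivAt_one_add_rpow (m := m) (q := 4 / ((d : ℝ) - 1) - 1) (s := 0)
    (by norm_num)).continuousAt.tendsto.comp (tendsto_inv_pow_atTop hd)).const_mul (-2 * m)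
  simp only [mul_zero, zero_div, add_zero, Real.one_rpow, mul_one] at h1
  refine h1.congr' ?_
  filter_upwards [eventually_base_pos hd m] with r hr
  have := (pow_pos hr.1 (d - 1)).ne'
  rw [mul_deriv_schwarzschildFactor hd hr.1 hr.2]
  simp only [Function.comp_apply]
  field_simp

theorem tendsto_mul_deriv_schwarzschildFactor (hd : 2 ≤ d) (m : ℝ) :
    Tendsto (fun r => r * deriv (schwarzschildFactor d m) r) atTop (𝓝 0) := by
  have h := (tendsto_inv_pow_atTop hd).mul (tendsto_deriv_schwarzschildFactor hd m)
  rw [zero_mul] at h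
  refine h.congr' ?_
  filter_upwards [eventually_gt_atTop 0] with r hr
  have := (pow_pos hr (d - 1)).ne'
  field_simp

/-- Here d ≥ 2 enters: 2(d-1) ≥ d, so terms quadratic in s = r^{-(d-1)} are absorbed by the error.
-/
theorem isBigO_inv_pow_sq (hd : 2 ≤ d) :
    (fun r : ℝ => ((r ^ (d - 1))⁻¹) ^ 2) =O[atTop] fun r => r ^ (-(d : ℤ)) := by
  refine (isBigO_zpow_of_le (j := -(2 * ((d : ℤ) - 1))) tendsto_id (by omega)).congr_left fun r => ?_
  rw [id, zpow_neg, inv_pow, ← pow_mul, ← zpow_natCast]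
  congr 2
  push_cast [Nat.cast_sub (show 1 ≤ d by omega)]
  ring

/-- First order expansion of a smooth function of `r^{-(d-1)}`. -/
theorem isBigO_expand (hd : 2 ≤ d) {f : ℝ → ℝ} {f' : ℝ} (hf : ContDiffAt ℝ 2 f 0)
    (h : HasDerivAt f f' 0) :
    (fun r : ℝ => f ((r ^ (d - 1))⁻¹) - (f 0 + f' * (r ^ (d - 1))⁻¹)) =O[atTop]
      fun r => r ^ (-(d : ℤ)) := by
  refine (((isBigO_taylor_two hf h).comp_tendsto (tendsto_inv_pow_atTop hd)).trans
    (isBigO_inv_pow_sq hd)).congr_left fun r => ?_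
  simp only [Function.comp_apply]; ring

theorem isBigO_inv_schwarzschildFactor (hd : 2 ≤ d) (m : ℝ) :
    (fun r : ℝ => (schwarzschildFactor d m r)⁻¹ - (1 - 2 * m / ((d : ℝ) - 1) * (r ^ (d - 1))⁻¹))
      =O[atTop] fun r => r ^ (-(d : ℤ)) := by
  have h0 : 0 < 1 + m * 0 / 2 := by norm_num
  refine (isBigO_expand hd (contDiffAt_one_add_rpow (q := -(4 / ((d : ℝ) - 1))) h0)
    (hasDerivAt_one_add_rpow h0)).congr' ?_ .rfl
  filter_upwards [eventually_base_pos hd m] with r hr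
  rw [schwarzschildFactor_eq, ← Real.rpow_neg hr.2.le]
  simp only [mul_zero, zero_div, add_zero, Real.one_rpow]
  ring

theorem isBigO_mean_schwarzschildFactor (hd : 2 ≤ d) (m : ℝ) :
    (fun r : ℝ => (1 + r * deriv (schwarzschildFactor d m) r / (2 * schwarzschildFactor d m r)) /
      √(schwarzschildFactor d m r) - (1 - d * m / ((d : ℝ) - 1) * (r ^ (d - 1))⁻¹))
      =O[atTop] fun r => r ^ (-(d : ℤ)) := by
  have hc : (d : ℝ) - 1 ≠ 0 := by
    have : (2 : ℝ) ≤ d := by exact_mod_cast hd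
    intro h; linarith
  have h0 : 0 < 1 + m * 0 / 2 := by norm_num
  have h1 := hasDerivAt_one_add_rpow (q := -(2 / ((d : ℝ) - 1))) h0
  have h2 := (hasDerivAt_one_add_rpow (q := -(2 / ((d : ℝ) - 1)) - 1) h0).fun_mul
    (hasDerivAt_id' (0 : ℝ))
  have h3 := h1.fun_sub (h2.const_mul m)
  -- With u = 1 + ms/2 one has rφ'/(2φ) = -ms/u and √φ = u^{2/(d-1)}, so the quantity is this
  -- function of s. Its slope at 0 is -m/(d-1) - m = -dm/(d-1).
  have h4 : ContDiffAt ℝ 2 (fun s : ℝ => (1 + m * s / 2) ^ (-(2 / ((d : ℝ) - 1))) -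
      m * ((1 + m * s / 2) ^ (-(2 / ((d : ℝ) - 1)) - 1) * s)) 0 :=
    (contDiffAt_one_add_rpow h0).sub
      (contDiffAt_const.mul ((contDiffAt_one_add_rpow h0).mul contDiffAt_id))
  refine (isBigO_expand hd h4 h3).congr' ?_ .rfl
  filter_upwards [eventually_base_pos hd m] with r hr
  rw [mul_deriv_schwarzschildFactor hd hr.1 hr.2, schwarzschildFactor_eq, Real.sqrt_eq_rpow,
    ← Real.rpow_mul hr.2.le, Real.rpow_sub_one hr.2.ne', Real.rpow_sub_one hr.2.ne',
    Real.rpow_neg hr.2.le,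
    show (4 / ((d : ℝ) - 1) * (1 / 2)) = 2 / ((d : ℝ) - 1) by ring]
  have hu := hr.2.ne'
  set u := 1 + m * (r ^ (d - 1))⁻¹ / 2
  have hu2 := (Real.rpow_pos_of_pos hr.2 (2 / ((d : ℝ) - 1))).ne'
  have hu4 := (Real.rpow_pos_of_pos hr.2 (4 / ((d : ℝ) - 1))).ne'
  simp only [mul_zero, zero_div, add_zero, Real.one_rpow]
  generalize u ^ (2 / ((d : ℝ) - 1)) = A at *
  generalize u ^ (4 / ((d : ℝ) - 1)) = B at *
  generalize (r ^ (d - 1))⁻¹ = s at *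
  field_simp
  ring

end Expansions

/-! ### Expansions of ρ and H, and the limit of the bracket in F. -/

section Main

open Asymptotics

variable {d : ℕ} {G : MetricField (d + 1)} {m : ℝ}

theorem two_le_cast (hd : 2 ≤ d) : (0 : ℝ) < (d : ℝ) - 1 ∧ (0 : ℝ) < d := by
  have : (2 : ℝ) ≤ d := by exact_mod_cast hd
  constructor <;> linarith

/-- Dividing φr²ρ = d(d-1) + O(r^{-d}) by φ, whose inverse is 1 - 2ms/(d-1) + O(r^{-d}). -/
theorem ConformalDecay.isBigO_scalar (hG : ConformalDecay G (schwarzschildFactor d m))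
    (hd : 2 ≤ d) : (fun a : ℝ × USphere d => a.1 ^ 2 * sphereScalarCurvature G a.1 a.2 -
      ((d : ℝ) * (d - 1) - 2 * d * m * (a.1 ^ (d - 1))⁻¹)) =O[largeSpheres d]
      fun a => a.1 ^ (-(d : ℤ)) := by
  have h1 : (fun a : ℝ × USphere d => (schwarzschildFactor d m a.1)⁻¹) =O[largeSpheres d]
      fun _ => (1 : ℝ) :=
    ((hG.tendsto.inv₀ one_ne_zero).comp tendsto_fst_largeSpheres).isBigO_one ℝ
  have h2 := (h1.mul (hG.isBigO_sphereScalarCurvature (by omega))).add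
    (((isBigO_inv_schwarzschildFactor hd m).comp_tendsto
      (tendsto_fst_largeSpheres (d := d))).const_mul_left ((d : ℝ) * (d - 1)) |>.trans
        (isBigO_refl _ _ |>.congr_right fun a => (one_mul _).symm))
  refine (h2.congr' ?_ (.of_forall fun a => one_mul _))
  filter_upwards [hG.eventually_pos] with a ha
  have := ha.2.ne'
  have := (two_le_cast hd).1.ne'
  simp only [Function.comp_apply]
  field_simp
  ring

theorem ConformalDecay.isBigO_mean (hG : ConformalDecay G (schwarzschildFactor d m))
    (hd : 2 ≤ d) : (fun a : ℝ × USphere d => a.1 * meanCurvature G (a.1 • (a.2 : Eu (d + 1))) -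
      (d - (d : ℝ) ^ 2 * m / (d - 1) * (a.1 ^ (d - 1))⁻¹)) =O[largeSpheres d]
      fun a => a.1 ^ (-(d : ℤ)) := by
  have h2 := (hG.isBigO_meanCurvature_sub (by omega)
    (tendsto_mul_deriv_schwarzschildFactor hd m)).add
    (((isBigO_mean_schwarzschildFactor hd m).comp_tendsto
      (tendsto_fst_largeSpheres (d := d))).const_mul_left (d : ℝ))
  refine h2.congr_left fun a => ?_
  simp only [Function.comp_apply]
  ring

theorem tendsto_inv_pow_largeSpheres (hd : 2 ≤ d) :
    Tendsto (fun a : ℝ × USphere d => (a.1 ^ (d - 1))⁻¹) (largeSpheres d) (𝓝 0) :=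
  (tendsto_inv_pow_atTop hd).comp tendsto_fst_largeSpheres

/-- Uses a² - b² = (a - b)(a + b) with a + b bounded, then drops the s² term of b². -/
theorem ConformalDecay.isBigO_mean_sq (hG : ConformalDecay G (schwarzschildFactor d m))
    (hd : 2 ≤ d) : (fun a : ℝ × USphere d =>
      (a.1 * meanCurvature G (a.1 • (a.2 : Eu (d + 1)))) ^ 2 -
      ((d : ℝ) ^ 2 - 2 * (d : ℝ) ^ 3 * m / (d - 1) * (a.1 ^ (d - 1))⁻¹)) =O[largeSpheres d]
      fun a => a.1 ^ (-(d : ℤ)) := by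
  have h0 := tendsto_zpow_neg (k := -(d : ℤ)) (tendsto_fst_largeSpheres (d := d))
    (by have : 0 < d := by omega
        simpa)
  have h1 := hG.isBigO_mean hd
  have hs := (tendsto_inv_pow_largeSpheres hd).const_mul ((d : ℝ) ^ 2 * m / (d - 1))
  have hB : Tendsto (fun a : ℝ × USphere d => a.1 * meanCurvature G (a.1 • (a.2 : Eu (d + 1))) +
      (d - (d : ℝ) ^ 2 * m / (d - 1) * (a.1 ^ (d - 1))⁻¹)) (largeSpheres d)
      (𝓝 (0 + (2 * (d - (d : ℝ) ^ 2 * m / (d - 1) * 0)))) := by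
    rw [mul_zero] at hs ⊢
    refine ((h1.trans_tendsto h0).add ((hs.const_sub (d : ℝ)).const_mul 2)).congr fun a => ?_
    ring
  have h2 := h1.mul (hB.isBigO_one ℝ)
  have h3 := ((isBigO_inv_pow_sq hd).comp_tendsto
    (tendsto_fst_largeSpheres (d := d))).const_mul_left (((d : ℝ) ^ 2 * m / (d - 1)) ^ 2)
  refine ((h2.congr_right fun a => mul_one _).add h3).congr_left fun a => ?_
  simp only [Function.comp_apply]
  ring

theorem exists_forall_largeSpheres {p : ℝ × USphere d → Prop} (h : ∀ᶠ a in largeSpheres d, p a) :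
    ∃ r₀ : ℝ, 0 < r₀ ∧ ∀ r, r₀ ≤ r → ∀ θ, p (r, θ) := by
  rw [Filter.eventually_prod_iff] at h
  obtain ⟨pa, ha, pb, hb, hab⟩ := h
  obtain ⟨R, hR⟩ := Filter.eventually_atTop.1 ha
  rw [Filter.eventually_top] at hb
  exact ⟨max R 1, by positivity, fun r hr θ => hab (hR r ((le_max_left _ _).trans hr)) (hb θ)⟩

theorem exists_bound_of_isBigO {f : ℝ × USphere d → ℝ} {k : ℕ}
    (h : f =O[largeSpheres d] fun a => a.1 ^ (-(k : ℤ))) :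
    ∃ C r₀ : ℝ, 0 < r₀ ∧ ∀ r : ℝ, r₀ ≤ r → ∀ θ : USphere d, |f (r, θ)| ≤ C / r ^ k := by
  obtain ⟨C, hC⟩ := h.bound
  obtain ⟨r₀, hr₀, h⟩ := exists_forall_largeSpheres hC
  refine ⟨C, r₀, hr₀, fun r hr θ => (h r hr θ).trans_eq ?_⟩
  have : 0 < r := hr₀.trans_le hr
  simp only
  rw [Real.norm_of_nonneg (by positivity), zpow_neg, zpow_natCast, div_eq_mul_inv]

theorem ConformalDecay.exists_bound_scalar (hG : ConformalDecay G (schwarzschildFactor d m))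
    (hd : 2 ≤ d) : ∃ C r₀ : ℝ, 0 < r₀ ∧ ∀ r : ℝ, r₀ ≤ r → ∀ θ : USphere d,
      |sphereScalarCurvature G r θ - ((d : ℝ) * (d - 1) / r ^ 2 - 2 * d * m / r ^ (d + 1))|
        ≤ C / r ^ (d + 2) := by
  obtain ⟨C, r₀, hr₀, h⟩ := exists_bound_of_isBigO (hG.isBigO_scalar hd)
  refine ⟨C, r₀, hr₀, fun r hr θ => ?_⟩
  have hr' : 0 < r := hr₀.trans_le hr
  have h1 := h r hr θ
  have h2 : sphereScalarCurvature G r θ - ((d : ℝ) * (d - 1) / r ^ 2 - 2 * d * m / r ^ (d + 1)) =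
      (r ^ 2 * sphereScalarCurvature G r θ - ((d : ℝ) * (d - 1) - 2 * d * m * (r ^ (d - 1))⁻¹))
        / r ^ 2 := by
    have e : r ^ (d + 1) = r ^ (d - 1) * r ^ 2 := by rw [← pow_add]; congr 1; omega
    rw [e]
    field_simp
  rw [h2, abs_div, abs_of_pos (pow_pos hr' 2), div_le_iff₀ (pow_pos hr' 2)]
  refine h1.trans_eq ?_
  rw [pow_add]
  field_simp

theorem ConformalDecay.exists_bound_mean (hG : ConformalDecay G (schwarzschildFactor d m))
    (hd : 2 ≤ d) : ∃ C r₀ : ℝ, 0 < r₀ ∧ ∀ r : ℝ, r₀ ≤ r → ∀ θ : USphere d,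
      |meanCurvature G (r • (θ : Eu (d + 1))) - ((d : ℝ) / r - (d : ℝ) ^ 2 * m / ((d - 1) * r ^ d))|
        ≤ C / r ^ (d + 1) := by
  obtain ⟨C, r₀, hr₀, h⟩ := exists_bound_of_isBigO (hG.isBigO_mean hd)
  refine ⟨C, r₀, hr₀, fun r hr θ => ?_⟩
  have hr' : 0 < r := hr₀.trans_le hr
  have h1 := h r hr θ
  have h2 : meanCurvature G (r • (θ : Eu (d + 1))) -
      ((d : ℝ) / r - (d : ℝ) ^ 2 * m / ((d - 1) * r ^ d)) =
      (r * meanCurvature G (r • (θ : Eu (d + 1))) -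
        (d - (d : ℝ) ^ 2 * m / (d - 1) * (r ^ (d - 1))⁻¹)) / r := by
    have e : r ^ d = r ^ (d - 1) * r := by rw [← pow_succ]; congr 1; omega
    rw [e]
    have := (two_le_cast hd).1.ne'
    field_simp
  rw [h2, abs_div, abs_of_pos hr', div_le_iff₀ hr']
  refine h1.trans_eq ?_
  rw [pow_succ]
  field_simp

instance : Nonempty (USphere d) := ⟨⟨EuclideanSpace.single 0 1, by simp⟩⟩

/-- Two-sided bounds uniform in θ pass to supremum and infimum, so neither attainment nor continuity
is needed. -/
theorem isBigO_iSup_sub {f : ℝ × USphere d → ℝ} {g e : ℝ → ℝ}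
    (h : (fun a => f a - g a.1) =O[largeSpheres d] fun a => e a.1) :
    (fun r => (⨆ θ, f (r, θ)) - g r) =O[atTop] e ∧
      (fun r => (⨅ θ, f (r, θ)) - g r) =O[atTop] e := by
  obtain ⟨C, hC⟩ := h.bound
  obtain ⟨r₀, hr₀, h⟩ := exists_forall_largeSpheres hC
  have hb (r : ℝ) (hr : r₀ ≤ r) (θ : USphere d) : f (r, θ) ≤ g r + C * ‖e r‖ ∧
      g r - C * ‖e r‖ ≤ f (r, θ) := by
    have := abs_le.1 (h r hr θ)
    simp only at this
    constructor <;> linarith [this.1, this.2]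
  constructor
  · refine IsBigO.of_bound C ?_
    filter_upwards [eventually_ge_atTop r₀] with r hr
    rw [Real.norm_eq_abs, abs_le]
    have h1 : (⨆ θ, f (r, θ)) ≤ g r + C * ‖e r‖ := ciSup_le fun θ => (hb r hr θ).1
    have h2 : f (r, Classical.arbitrary _) ≤ ⨆ θ, f (r, θ) :=
      le_ciSup ⟨g r + C * ‖e r‖, by rintro _ ⟨θ, rfl⟩; exact (hb r hr θ).1⟩ _
    constructor <;> linarith [(hb r hr (Classical.arbitrary _)).2]
  · refine IsBigO.of_bound C ?_
    filter_upwards [eventually_ge_atTop r₀] with r hr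
    rw [Real.norm_eq_abs, abs_le]
    have h1 : g r - C * ‖e r‖ ≤ ⨅ θ, f (r, θ) := le_ciInf fun θ => (hb r hr θ).2
    have h2 : ⨅ θ, f (r, θ) ≤ f (r, Classical.arbitrary _) :=
      ciInf_le ⟨g r - C * ‖e r‖, by rintro _ ⟨θ, rfl⟩; exact (hb r hr θ).2⟩ _
    constructor <;> linarith [(hb r hr (Classical.arbitrary _)).1]

theorem isBigO_zpow_mul_sq {f g : ℝ × USphere d → ℝ} {k : ℤ}
    (h : (fun a => a.1 ^ 2 * f a - g a) =O[largeSpheres d] fun a => a.1 ^ k) :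
    (fun a => f a - g a / a.1 ^ 2) =O[largeSpheres d] fun a => a.1 ^ (k - 2) := by
  have h1 := h.mul (isBigO_refl (fun a : ℝ × USphere d => (a.1 ^ 2)⁻¹) (largeSpheres d))
  refine h1.congr' ?_ ?_ <;>
  · filter_upwards [tendsto_fst_largeSpheres.eventually_gt_atTop 0] with a ha
    first
    | (field_simp; done)
    | (rw [zpow_sub₀ ha.ne', div_eq_mul_inv]; norm_cast)

/-- The bracket in the definition of `F`. -/
theorem ConformalDecay.tendsto_bracket (hG : ConformalDecay G (schwarzschildFactor d m))
    (hd : 2 ≤ d) : Tendsto (fun r : ℝ => r ^ (d - 1) * (1 - ((d : ℝ) - 1) / d *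
      ((⨆ θ : USphere d, meanCurvature G (r • (θ : Eu (d + 1))) ^ 2) /
        (⨅ θ : USphere d, sphereScalarCurvature G r θ)))) atTop (𝓝 (2 * m)) := by
  obtain ⟨hc, hd0⟩ := two_le_cast hd
  set X : ℝ → ℝ := fun r => ⨆ θ : USphere d, meanCurvature G (r • (θ : Eu (d + 1))) ^ 2
  set Y : ℝ → ℝ := fun r => ⨅ θ : USphere d, sphereScalarCurvature G r θ
  have hX := (isBigO_iSup_sub (f := fun a => meanCurvature G (a.1 • (a.2 : Eu (d + 1))) ^ 2)
    (g := fun r => ((d : ℝ) ^ 2 - 2 * (d : ℝ) ^ 3 * m / (d - 1) * (r ^ (d - 1))⁻¹) / r ^ 2)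
    (e := fun r => r ^ (-(d : ℤ) - 2))
    (isBigO_zpow_mul_sq ((hG.isBigO_mean_sq hd).congr_left fun a => by ring))).1
  have hY := (isBigO_iSup_sub (f := fun a => sphereScalarCurvature G a.1 a.2)
    (g := fun r => ((d : ℝ) * (d - 1) - 2 * d * m * (r ^ (d - 1))⁻¹) / r ^ 2)
    (e := fun r => r ^ (-(d : ℤ) - 2))
    (isBigO_zpow_mul_sq (hG.isBigO_scalar hd))).2
  change (fun r => X r - _) =O[atTop] _ at hX
  change (fun r => Y r - _) =O[atTop] _ at hY
  have hs : Tendsto (fun r : ℝ => r⁻¹) atTop (𝓝 0) := tendsto_inv_atTop_zero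
  have hpos : ∀ᶠ r : ℝ in atTop, 0 < r := eventually_gt_atTop 0
  have hpow (r : ℝ) : r ^ (d + 1) = r ^ (d - 1) * r ^ 2 := by
    rw [← pow_add]; congr 1; omega
  have hO : (fun r : ℝ => r ^ (d + 1) * r ^ (-(d : ℤ) - 2)) =ᶠ[atTop] fun r => r⁻¹ := by
    filter_upwards [hpos] with r hr
    rw [← zpow_natCast, ← zpow_add₀ hr.ne', ← zpow_neg_one]
    congr 1; push_cast; ring
  have hYt : Tendsto (fun r => r ^ 2 * Y r) atTop (𝓝 ((d : ℝ) * (d - 1))) := by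
    have h0 : Tendsto (fun r : ℝ => r ^ 2 * r ^ (-(d : ℤ) - 2)) atTop (𝓝 0) := by
      refine (tendsto_zpow_neg (k := -(d : ℤ)) tendsto_id (by omega)).congr' ?_
      filter_upwards [hpos] with r hr
      rw [← zpow_natCast, ← zpow_add₀ hr.ne']
      congr 1; push_cast; ring
    have h1 := ((isBigO_refl (fun r : ℝ => r ^ 2) atTop).mul hY).trans_tendsto h0
    have h2 := h1.add (((tendsto_inv_pow_atTop hd).const_mul (2 * d * m)).const_sub
      ((d : ℝ) * (d - 1)))
    simp only [mul_zero, sub_zero, zero_add] at h2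
    refine h2.congr' ?_
    filter_upwards [hpos] with r hr
    field_simp
    ring
  -- The leading parts d·d(d-1) and (d-1)·d² cancel. The s terms leave -2d²m + 2d³m = 2d²(d-1)m, and
  -- the error O(r^{-d-2}) is only r⁻¹ after multiplication by r^{d+1}.
  have hnum : Tendsto (fun r => r ^ (d + 1) * (d * Y r - (d - 1) * X r)) atTop
      (𝓝 (2 * (d : ℝ) ^ 2 * (d - 1) * m)) := by
    have h1 := ((isBigO_refl (fun r : ℝ => r ^ (d + 1)) atTop).mul
      ((hY.const_mul_left (d : ℝ)).sub (hX.const_mul_left ((d : ℝ) - 1)))).trans_tendsto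
      (hs.congr' hO.symm)
    have h2 := h1.add_const (2 * (d : ℝ) ^ 2 * (d - 1) * m)
    rw [zero_add] at h2
    refine h2.congr' ?_
    filter_upwards [hpos] with r hr
    rw [hpow]
    have := hc.ne'
    field_simp
    ring
  have hfin := hnum.div (hYt.const_mul (d : ℝ)) (by positivity)
  have e : 2 * (d : ℝ) ^ 2 * (d - 1) * m / (d * (d * (d - 1))) = 2 * m := by
    field_simp
  rw [e] at hfin
  -- The bracket equals (dY - (d-1)X)/(dY).
  refine hfin.congr' ?_
  filter_upwards [hpos, hYt.eventually_ne (mul_pos hd0 hc).ne'] with r hr hY0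
  have : Y r ≠ 0 := right_ne_zero_of_mul hY0
  change _ = r ^ (d - 1) * (1 - (d - 1) / d * (X r / Y r))
  simp only [Pi.div_apply]
  rw [hpow]
  field_simp

end Main

/-! ### Area, Hawking-type functional and ADM mass -/

section Mass

open Asymptotics

variable {d : ℕ} {G : MetricField (d + 1)} {m : ℝ}

instance : IsFiniteMeasure (sphereMeasure d) := by
  unfold sphereMeasure; infer_instance

theorem unitSphereArea_pos : 0 < unitSphereArea d := by
  unfold unitSphereArea
  rw [measureReal_def, ENNReal.toReal_pos_iff]
  refine ⟨?_, measure_lt_top _ _⟩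
  rw [pos_iff_ne_zero, Ne, Measure.measure_univ_eq_zero]
  exact Measure.toSphere_ne_zero _

theorem eventually_forall_of_largeSpheres {p : ℝ × USphere d → Prop}
    (h : ∀ᶠ a in largeSpheres d, p a) : ∀ᶠ r in atTop, ∀ θ, p (r, θ) := by
  obtain ⟨r₀, -, hr⟩ := exists_forall_largeSpheres h
  filter_upwards [eventually_ge_atTop r₀] with r h θ using hr r h θ

/-- Dominated convergence with the constant |c| + 1; continuity serves only for measurability. -/
theorem tendsto_integral_sphere {f : ℝ → USphere d → ℝ} {c : ℝ}
    (hf : Tendsto (fun a : ℝ × USphere d => f a.1 a.2) (largeSpheres d) (𝓝 c))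
    (hc : ∀ᶠ r in atTop, Continuous (f r)) :
    Tendsto (fun r => ∫ θ, f r θ ∂sphereMeasure d) atTop (𝓝 (c * unitSphereArea d)) := by
  have e : c * unitSphereArea d = ∫ _θ, c ∂sphereMeasure d := by
    simp [unitSphereArea, mul_comm]
  rw [e]
  have hb : ∀ᶠ a in largeSpheres d, ‖f a.1 a.2‖ ≤ |c| + 1 := by
    have h1 : Tendsto (fun a : ℝ × USphere d => ‖f a.1 a.2‖) (largeSpheres d) (𝓝 |c|) := hf.norm
    exact h1.eventually_le_const (lt_add_one _)
  refine tendsto_integral_filter_of_dominated_convergence (fun _ => |c| + 1) ?_ ?_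
    (integrable_const _) (.of_forall fun θ => ?_)
  · exact hc.mono fun r h => h.aestronglyMeasurable
  · exact (eventually_forall_of_largeSpheres hb).mono fun r h => .of_forall h
  · exact hf.comp (tendsto_id.prodMk tendsto_top)

theorem continuous_comp_sphere {f : Eu (d + 1) → ℝ} {r : ℝ}
    (h : ∀ θ : USphere d, ContinuousAt f (r • (θ : Eu (d + 1)))) :
    Continuous fun θ : USphere d => f (r • (θ : Eu (d + 1))) :=
  continuous_iff_continuousAt.2 fun θ => (h θ).comp
    (f := fun θ : USphere d => r • (θ : Eu (d + 1))) (by fun_prop)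

theorem ConformalDecay.tendsto_det {φ : ℝ → ℝ} (hG : ConformalDecay G φ) (hd : 0 < d) :
    Tendsto (fun a : ℝ × USphere d => (G (a.1 • (a.2 : Eu (d + 1)))).det)
      (largeSpheres d) (𝓝 1) := by
  have hcont : Continuous fun P : Jet0 (d + 1) => (Matrix.of P).det :=
    (contDiff_det (n := 0) (A := fun P : Jet0 (d + 1) => Matrix.of P) fun i j => by
      simp only [Matrix.of_apply]; fun_prop).continuous
  have h := (hcont.tendsto _).comp (hG.tendsto_jet0 hd)
  rw [of_ite_eq_one, Matrix.det_one] at h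
  exact h

theorem ConformalDecay.tendsto_areaDensity {φ : ℝ → ℝ} (hG : ConformalDecay G φ) (hd : 0 < d) :
    Tendsto (fun a : ℝ × USphere d => areaDensity G (a.1 • (a.2 : Eu (d + 1))))
      (largeSpheres d) (𝓝 1) := by
  have h := ((hG.tendsto_det hd).mul (tendsto_sum_inv_mul_sphere (θ := Prod.snd)
    (hG.tendsto_jet0 hd))).sqrt
  rw [mul_one, Real.sqrt_one] at h
  refine h.congr' ?_
  filter_upwards [tendsto_fst_largeSpheres.eventually_gt_atTop 0] with a ha
  have hx (i : Fin (d + 1)) : (a.1 • (a.2 : Eu (d + 1))) i / ‖a.1 • (a.2 : Eu (d + 1))‖ =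
      (a.2 : Eu (d + 1)) i := by
    rw [norm_smul_sphere ha, PiLp.smul_apply, smul_eq_mul, mul_div_cancel_left₀ _ ha.ne']
  simp only [areaDensity, hx]
  rfl

theorem continuousAt_areaDensity {x : Eu (d + 1)} (hx : x ≠ 0)
    (hG : ∀ i j, ContinuousAt (fun y => G y i j) x) (hdet : (G x).det ≠ 0) :
    ContinuousAt (areaDensity G) x := by
  have hG' (i j) : ContDiffAt ℝ 0 (fun P : Jet0 (d + 1) => (Matrix.of P)⁻¹ i j) (jet0 G x) :=
    contDiffAt_inv_apply hdet i j
  have hJ : ContinuousAt (jet0 G) x := continuousAt_pi.2 fun i => continuousAt_pi.2 fun j => hG i j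
  have hinv (i j) : ContinuousAt (fun y => (G y)⁻¹ i j) x :=
    ((hG' i j).continuousAt).comp hJ
  have hcont : Continuous fun P : Jet0 (d + 1) => (Matrix.of P).det :=
    (contDiff_det (n := 0) (A := fun P : Jet0 (d + 1) => Matrix.of P) fun i j => by
      simp only [Matrix.of_apply]; fun_prop).continuous
  have hd : ContinuousAt (fun y => (G y).det) x := hcont.continuousAt.comp hJ
  have hn (i : Fin (d + 1)) : ContinuousAt (fun y : Eu (d + 1) => y i / ‖y‖) x :=
    (by fun_prop : ContinuousAt (fun y : Eu (d + 1) => y i) x).div (by fun_prop) (norm_ne_zero_iff.2 hx)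
  refine ContinuousAt.sqrt (hd.mul ?_)
  exact tendsto_finsetSum _ fun i _ => tendsto_finsetSum _ fun j _ =>
    ((hinv i j).mul (hn i)).mul (hn j)

/-- Leading order is enough, because the bracket multiplying the area power is already
O(r^{-(d-1)}). -/
theorem ConformalDecay.tendsto_sphereArea {φ : ℝ → ℝ} (hG : ConformalDecay G φ) (hd : 0 < d) :
    Tendsto (fun r => sphereArea G r / unitSphereArea d / r ^ d) atTop (𝓝 1) := by
  have hc : ∀ᶠ r : ℝ in atTop, Continuous fun θ : USphere d =>
      areaDensity G (r • (θ : Eu (d + 1))) := by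
    filter_upwards [eventually_forall_of_largeSpheres hG.eventually_differentiableAt,
      eventually_forall_of_largeSpheres (eventually_det_ne_zero (hG.tendsto_jet0 hd)),
      eventually_gt_atTop 0] with r h1 h2 h3
    exact continuous_comp_sphere fun θ => continuousAt_areaDensity (smul_sphere_ne_zero h3 θ)
      (fun i j => (h1 θ i j).continuousAt) (h2 θ)
  have h := (tendsto_integral_sphere (hG.tendsto_areaDensity hd) hc).div_const (unitSphereArea d)
  rw [one_mul, div_self unitSphereArea_pos.ne'] at h
  refine h.congr' ?_
  filter_upwards [eventually_gt_atTop 0] with r hr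
  have := (pow_pos hr d).ne'
  rw [sphereArea, sphereIntegral]
  field_simp

/-- The area power is asymptotic to r^{d-1}, which exactly compensates the bracket 2m r^{-(d-1)};
the factor ½ leaves m. -/
theorem ConformalDecay.tendsto_F (hG : ConformalDecay G (schwarzschildFactor d m)) (hd : 2 ≤ d) :
    Tendsto (fun r => F G r) atTop (𝓝 m) := by
  have hd0 := (two_le_cast hd).2
  have h1 := (hG.tendsto_sphereArea (by omega)).rpow_const (p := ((d : ℝ) - 1) / d)
    (Or.inl one_ne_zero)
  have h2 := (h1.const_mul (1 / 2)).mul (hG.tendsto_bracket hd)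
  rw [Real.one_rpow, show (1 / 2 : ℝ) * 1 * (2 * m) = m by ring] at h2
  refine h2.congr' ?_
  filter_upwards [eventually_gt_atTop 0, (hG.tendsto_sphereArea (by omega)).eventually
    (lt_mem_nhds zero_lt_one)] with r hr hA
  have hp : (r ^ d) ^ (((d : ℝ) - 1) / d) = r ^ (d - 1) := by
    rw [← Real.rpow_natCast, ← Real.rpow_mul hr.le, ← Real.rpow_natCast]
    congr 1
    push_cast [Nat.cast_sub (show 1 ≤ d by omega)]
    field_simp
  have hA' : (sphereArea G r / unitSphereArea d) ^ (((d : ℝ) - 1) / d) =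
      (sphereArea G r / unitSphereArea d / r ^ d) ^ (((d : ℝ) - 1) / d) * r ^ (d - 1) := by
    rw [← hp, ← Real.mul_rpow hA.le (by positivity), div_mul_cancel₀ _ (pow_pos hr d).ne']
  rw [F, hA']
  ring

/-- The integrand of the ADM mass. -/
theorem ConformalDecay.tendsto_massDensity (hG : ConformalDecay G (schwarzschildFactor d m))
    (hd : 2 ≤ d) :
    Tendsto (fun a : ℝ × USphere d => a.1 ^ d * ∑ i, ∑ j,
      (pd i (fun y => G y i j) (a.1 • (a.2 : Eu (d + 1))) -
        pd j (fun y => G y i i) (a.1 • (a.2 : Eu (d + 1)))) * (a.2 : Eu (d + 1)) j)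
      (largeSpheres d) (𝓝 (2 * d * m)) := by
  set φ := schwarzschildFactor d m
  set h : Fin (d + 1) → Fin (d + 1) → Eu (d + 1) → ℝ :=
    fun i j x => G x i j - if i = j then φ ‖x‖ else 0
  have hh (i j k) : Tendsto (fun a : ℝ × USphere d =>
      a.1 ^ d * pd k (h i j) (a.1 • (a.2 : Eu (d + 1)))) (largeSpheres d) (𝓝 0) := by
    have h1 := (isBigO_refl (fun a : ℝ × USphere d => a.1 ^ d) (largeSpheres d)).mul
      (isBigO_largeSpheres (hG.decay_deriv i j k))
    refine h1.trans_tendsto ((tendsto_zpow_neg (k := -1) tendsto_fst_largeSpheres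
      (by norm_num)).congr' ?_)
    filter_upwards [tendsto_fst_largeSpheres.eventually_gt_atTop 0] with a ha
    rw [← zpow_natCast, ← zpow_add₀ ha.ne']
    congr 1; ring
  have hz (i j : Fin (d + 1)) : Tendsto (fun a : ℝ × USphere d =>
      (a.1 ^ d * pd i (h i j) (a.1 • (a.2 : Eu (d + 1))) -
        a.1 ^ d * pd j (h i i) (a.1 • (a.2 : Eu (d + 1)))) * (a.2 : Eu (d + 1)) j)
      (largeSpheres d) (𝓝 0) := by
    have h1 := (hh i j i).sub (hh i i j)
    rw [sub_zero] at h1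
    refine IsBigO.trans_tendsto (IsBigO.of_bound 1 (.of_forall fun a => ?_)) h1
    rw [norm_mul, one_mul]
    exact mul_le_of_le_one_right (norm_nonneg _) ((abs_coord_le _ _).trans (by simp))
  have hz' := tendsto_finsetSum Finset.univ fun i _ => tendsto_finsetSum Finset.univ
    fun j _ => hz i j
  -- For the model, the sum over i, j of (δᵢⱼ - 1)θⱼ² is 1 - (d+1) = -d, multiplied by φ'.
  have hm : Tendsto (fun a : ℝ × USphere d => -(d : ℝ) * (a.1 ^ (d - 1) * (a.1 * deriv φ a.1)))
      (largeSpheres d) (𝓝 (-(d : ℝ) * (-2 * m))) :=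
    ((tendsto_deriv_schwarzschildFactor hd m).comp tendsto_fst_largeSpheres).const_mul _
  have hs := hz'.add hm
  simp only [Finset.sum_const_zero, zero_add] at hs
  rw [show -(d : ℝ) * (-2 * m) = 2 * d * m by ring] at hs
  refine hs.congr' ?_
  filter_upwards [hG.eventually_differentiableAt, hG.eventually_differentiableAt_factor,
    tendsto_fst_largeSpheres.eventually_gt_atTop 0] with a h1 h2 h3
  set x := a.1 • (a.2 : Eu (d + 1)) with hx
  have hn := norm_smul_sphere h3 a.2
  have hp (i j k) : pd k (fun y => G y i j) x = pd k (h i j) x +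
      if i = j then deriv φ a.1 * (a.2 : Eu (d + 1)) k else 0 := by
    rw [pd_sub (h1 i j) (h2.2 i j)]
    split_ifs with hij
    · rw [pd_comp_norm (smul_sphere_ne_zero h3 a.2) (by rw [hn]; exact h2.1), hn, hx,
        PiLp.smul_apply, smul_eq_mul, mul_div_cancel_left₀ _ h3.ne']
      ring
    · rw [pd_const]; ring
  have e (i j : Fin (d + 1)) : (pd i (fun y => G y i j) x - pd j (fun y => G y i i) x) *
      (a.2 : Eu (d + 1)) j = (pd i (h i j) x - pd j (h i i) x) * (a.2 : Eu (d + 1)) j +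
      deriv φ a.1 * ((if i = j then (a.2 : Eu (d + 1)) j * (a.2 : Eu (d + 1)) j else 0) -
        (a.2 : Eu (d + 1)) j * (a.2 : Eu (d + 1)) j) := by
    rw [hp, hp, if_pos rfl]
    split_ifs with hij
    · subst hij; ring
    · ring
  have hsq : ∑ j, (a.2 : Eu (d + 1)) j * (a.2 : Eu (d + 1)) j = 1 := by
    rw [sum_sq_coord]; simp
  have hpow : a.1 ^ d = a.1 ^ (d - 1) * a.1 := by rw [← pow_succ]; congr 1; omega
  simp only [e, Finset.sum_add_distrib, ← Finset.mul_sum, Finset.sum_sub_distrib,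
    Finset.sum_ite_eq, Finset.mem_univ, if_true, hsq, Finset.sum_const, Finset.card_univ,
    Fintype.card_fin, nsmul_eq_mul, mul_one, mul_add, ← mul_sub, mul_assoc]
  congr 1
  rw [hpow]; push_cast; ring

theorem ConformalDecay.eventually_continuous_massDensity {φ : ℝ → ℝ} (hG : ConformalDecay G φ) :
    ∀ᶠ r : ℝ in atTop, Continuous fun θ : USphere d => r ^ d * ∑ i, ∑ j,
      (pd i (fun y => G y i j) (r • (θ : Eu (d + 1))) -
        pd j (fun y => G y i i) (r • (θ : Eu (d + 1)))) * (θ : Eu (d + 1)) j := by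
  have hs : ∀ᶠ a : ℝ × USphere d in largeSpheres d, ∀ i j,
      ContDiffAt ℝ 2 (fun y => G y i j) (a.1 • (a.2 : Eu (d + 1))) :=
    eventually_all.2 fun i => eventually_all.2 fun j =>
      tendsto_smul_largeSpheres.eventually (hG.smooth i j)
  filter_upwards [eventually_forall_of_largeSpheres hs] with r h1
  have h2 (i j k) : Continuous fun θ : USphere d =>
      pd k (fun y => G y i j) (r • (θ : Eu (d + 1))) :=
    continuous_comp_sphere fun θ =>
      (contDiffAt_pd (n' := 1) (h1 θ i j) (by norm_num) k).continuousAt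
  have h3 (j : Fin (d + 1)) : Continuous fun θ : USphere d => (θ : Eu (d + 1)) j := by fun_prop
  exact continuous_const.mul (continuous_finsetSum _ fun i _ => continuous_finsetSum _
    fun j _ => ((h2 i j i).sub (h2 i i j)).mul (h3 j))

theorem ConformalDecay.hasADMMass (hG : ConformalDecay G (schwarzschildFactor d m))
    (hd : 2 ≤ d) : HasADMMass G m := by
  have hd0 := (two_le_cast hd).2
  have hω := (unitSphereArea_pos (d := d)).ne'
  have h := (tendsto_integral_sphere (hG.tendsto_massDensity hd)
    hG.eventually_continuous_massDensity).const_mul (1 / (2 * (d : ℝ) * unitSphereArea d))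
  have e : 1 / (2 * (d : ℝ) * unitSphereArea d) * (2 * d * m * unitSphereArea d) = m := by
    field_simp
  rw [e] at h
  refine h.congr' ?_
  filter_upwards [eventually_gt_atTop 0] with r hr
  rw [integral_const_mul, sphereIntegral]
  simp only [PiLp.smul_apply, smul_eq_mul, mul_div_cancel_left₀ _ hr.ne']

end Mass

/-! ### Coordinate systems at infinity -/

section Charts

open Asymptotics

variable {d : ℕ} {H : Type*} [TopologicalSpace H] {I : ModelWithCorners ℝ (Eu (d + 1)) H}
  {M : Type*} [TopologicalSpace M] [ChartedSpace H M]
  {Φ : OpenPartialHomeomorph M (Eu (d + 1))}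

theorem IsEndChart.eventually_mem_target (h : IsEndChart I Φ) :
    ∀ᶠ x in Bornology.cobounded (Eu (d + 1)), x ∈ Φ.target := by
  obtain ⟨c, R, -, hR⟩ := h.target_eq
  rw [hR]
  exact Bornology.isBounded_def.1 Metric.isBounded_closedBall

variable [IsManifold I ∞ M]
  {g : Bundle.ContMDiffRiemannianMetric I ∞ (Eu (d + 1)) (fun p : M => TangentSpace I p)}
  {m : ℝ}

theorem IsEndChart.eventually_contDiffAt (h : IsEndChart I Φ) (i j : Fin (d + 1)) :
    ∀ᶠ x in Bornology.cobounded (Eu (d + 1)),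
      ContDiffAt ℝ ∞ (fun y => metricInChart g Φ y i j) x := by
  filter_upwards [h.eventually_mem_target] with x hx
  exact (h.contDiffOn_metricInChart g i j).contDiffAt (Φ.open_target.mem_nhds hx)

theorem IsAsymptoticallySchwarzschildChart.conformalDecay
    (h : IsAsymptoticallySchwarzschildChart g Φ m) (hd : 2 ≤ d) :
    ConformalDecay (metricInChart g Φ) (schwarzschildFactor d m) where
  tendsto := tendsto_schwarzschildFactor hd m
  smooth_factor := (eventually_base_pos hd m).mono fun _ hr =>
    contDiffAt_schwarzschildFactor hr.1 hr.2
  smooth i j := (h.isEndChart.eventually_contDiffAt i j).mono fun _ hx =>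
    contDiffAt_infty.1 hx 2
  decay := h.decay
  decay_deriv := h.decay_deriv
  decay_deriv₂ := h.decay_deriv₂

end Charts

/-! ### The Euclidean Laplacian and Green's identity -/

section Laplacian

variable {m : ℕ} {f g : Eu m → ℝ} {x : Eu m}

/-- The Euclidean Laplacian as the sum of the pure second partial derivatives. -/
def lap (f : Eu m → ℝ) (x : Eu m) : ℝ := ∑ k, pd k (pd k f) x

theorem laplacian_eq_lap (hf : ContDiffAt ℝ 2 f x) : Laplacian.laplacian f x = lap f x := by
  have h := InnerProductSpace.laplacian_eq_iteratedFDeriv_orthonormalBasis f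
    (EuclideanSpace.basisFun (Fin m) ℝ)
  rw [h, lap]
  refine Finset.sum_congr rfl fun k _ => ?_
  have hd : DifferentiableAt ℝ (fderiv ℝ f) x :=
    (hf.fderiv_right (m := 1) (by norm_num)).differentiableAt (by norm_num)
  rw [iteratedFDeriv_two_apply]
  have e : pd k f = fun y => fderiv ℝ f y (EuclideanSpace.single k 1) := rfl
  rw [e, pd, fderiv_clm_apply hd (by fun_prop)]
  simp

theorem lap_congr (h : f =ᶠ[𝓝 x] g) : lap f x = lap g x :=
  Finset.sum_congr rfl fun _ _ => pd_congr (pd_congr_nhds h)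

theorem lap_mul (hf : ContDiffAt ℝ 2 f x) (hg : ContDiffAt ℝ 2 g x) :
    lap (fun y => f y * g y) x =
      lap f x * g x + 2 * ∑ k, pd k f x * pd k g x + f x * lap g x := by
  simp only [lap, pd_pd_mul hf hg, Finset.sum_mul, Finset.mul_sum, ← Finset.sum_add_distrib]
  exact Finset.sum_congr rfl fun k _ => by ring

theorem pd_comp_sub (k : Fin m) (f : Eu m → ℝ) (a x : Eu m) :
    pd k (fun y => f (y - a)) x = pd k f (x - a) := by
  simp [pd, fderiv_comp_sub]

theorem lap_comp_sub (f : Eu m → ℝ) (a x : Eu m) :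
    lap (fun y => f (y - a)) x = lap f (x - a) := by
  refine Finset.sum_congr rfl fun k _ => ?_
  rw [show pd k (fun y => f (y - a)) = fun y => pd k f (y - a) from
    funext fun y => pd_comp_sub k f a y, pd_comp_sub]

theorem lap_comp_smul (r : ℝ) (f : Eu m → ℝ) (x : Eu m) :
    lap (fun y => f (r • y)) x = r ^ 2 * lap f (r • x) := by
  rw [lap, lap, Finset.mul_sum]
  refine Finset.sum_congr rfl fun k _ => ?_
  rw [show pd k (fun y => f (r • y)) = fun y => r * pd k f (r • y) from
    funext fun y => pd_comp_smul r f y, pd_const_mul, pd_comp_smul]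
  ring

theorem _root_.ContDiff.pd {n n' : ℕ∞ω} (hf : ContDiff ℝ n f) (h : n' + 1 ≤ n) (k : Fin m) :
    ContDiff ℝ n' (pd k f) :=
  contDiff_iff_contDiffAt.2 fun _ => contDiffAt_pd hf.contDiffAt h k

theorem _root_.ContDiff.continuous_lap (hf : ContDiff ℝ 2 f) : Continuous (lap f) :=
  continuous_finsetSum _ fun k _ =>
    ((hf.pd (n' := 1) (by norm_num) k).pd (n' := 0) (by norm_num) k).continuous

theorem _root_.HasCompactSupport.pd (hf : HasCompactSupport f) (k : Fin m) :
    HasCompactSupport (pd k f) :=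
  hf.fderiv_apply (𝕜 := ℝ) _

theorem integral_mul_pd (hf : ContDiff ℝ 1 f) (hg : ContDiff ℝ 1 g) (hc : HasCompactSupport g)
    (k : Fin m) : ∫ y, f y * pd k g y = -∫ y, pd k f y * g y :=
  integral_mul_fderiv_eq_neg_fderiv_mul_of_integrable
    (((hf.pd (n' := 0) (by norm_num) k).continuous.mul hg.continuous).integrable_of_hasCompactSupport
      hc.mul_left)
    ((hf.continuous.mul (hg.pd (n' := 0) (by norm_num) k).continuous).integrable_of_hasCompactSupport
      (hc.pd k).mul_left)
    ((hf.continuous.mul hg.continuous).integrable_of_hasCompactSupport hc.mul_left)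
    (fun x _ => hf.differentiable (by norm_num) x) fun x _ => hg.differentiable (by norm_num) x

/-- Green's identity. -/
theorem integral_mul_lap (hf : ContDiff ℝ 2 f) (hg : ContDiff ℝ 2 g) (hc : HasCompactSupport g) :
    ∫ y, f y * lap g y = ∫ y, lap f y * g y := by
  have h1 (k : Fin m) := hf.pd (n' := 1) (by norm_num) k
  have h2 (k : Fin m) := hg.pd (n' := 1) (by norm_num) k
  have h (k : Fin m) : ∫ y, f y * pd k (pd k g) y = ∫ y, pd k (pd k f) y * g y := by
    rw [integral_mul_pd (hf.of_le (by norm_num)) (h2 k) (hc.pd k),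
      integral_mul_pd (h1 k) (hg.of_le (by norm_num)) hc, neg_neg]
  simp only [lap, Finset.mul_sum, Finset.sum_mul]
  rw [integral_finsetSum, integral_finsetSum]
  · exact Finset.sum_congr rfl fun k _ => h k
  · exact fun k _ => (((h1 k).pd (n' := 0) (by norm_num) k).continuous.mul
      hg.continuous).integrable_of_hasCompactSupport hc.mul_left
  · exact fun k _ => (hf.continuous.mul ((h2 k).pd (n' := 0) (by norm_num)
      k).continuous).integrable_of_hasCompactSupport ((hc.pd k).pd k).mul_left

/-- The regularized power `(|z|² + e)^{-p}`. -/
def softKernel (p e : ℝ) (z : Eu m) : ℝ := (‖z‖ ^ 2 + e) ^ (-p)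

variable {p e : ℝ} {z : Eu m}

theorem softKernel_nonneg (he : 0 ≤ e) : 0 ≤ softKernel p e z := by
  unfold softKernel; positivity

theorem softKernel_neg : softKernel p e (-z) = softKernel p e z := by simp [softKernel]

theorem softKernel_le (hp : 0 ≤ p) (he : 0 ≤ e) (hz : z ≠ 0) :
    softKernel p e z ≤ softKernel p 0 z := by
  have : 0 < ‖z‖ ^ 2 := by positivity
  unfold softKernel
  exact Real.rpow_le_rpow_of_nonpos (by linarith) (by linarith) (by linarith)

theorem softKernel_zero_eq {j : ℕ} (hp : 2 * p = j) : softKernel p 0 z = (‖z‖ ^ j)⁻¹ := by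
  rw [softKernel, add_zero, Real.rpow_neg (by positivity), ← Real.rpow_natCast, ← Real.rpow_natCast,
    ← Real.rpow_mul (norm_nonneg _), ← hp]
  norm_num

theorem contDiffAt_softKernel {n : ℕ∞ω} (hz : 0 < ‖z‖ ^ 2 + e) :
    ContDiffAt ℝ n (softKernel p e : Eu m → ℝ) z :=
  ((contDiff_norm_sq ℝ).contDiffAt.add contDiffAt_const).rpow_const_of_ne hz.ne'

theorem contDiff_softKernel {n : ℕ∞ω} (he : 0 < e) : ContDiff ℝ n (softKernel p e : Eu m → ℝ) :=
  contDiff_iff_contDiffAt.2 fun z => contDiffAt_softKernel (by positivity)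

theorem pd_softKernel (hz : 0 < ‖z‖ ^ 2 + e) (k : Fin m) :
    pd k (softKernel p e) z = -2 * p * (z k * softKernel (p + 1) e z) := by
  have h : HasDerivAt (fun t : ℝ => (t + e) ^ (-p)) (1 * (-p) * (‖z‖ ^ 2 + e) ^ (-p - 1)) (‖z‖ ^ 2) :=
    ((hasDerivAt_id _).add_const e).rpow_const (Or.inl hz.ne')
  have h2 := pd_scomp (k := k) (f := fun y : Eu m => ‖y‖ ^ 2) h.differentiableAt
    (differentiableAt_id.norm_sq ℝ)
  rw [h.deriv, pd_norm_sq] at h2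
  change pd k (fun y : Eu m => (‖y‖ ^ 2 + e) ^ (-p)) z = _
  rw [h2, softKernel, show -(p + 1) = -p - 1 by ring]
  ring

theorem softKernel_succ (hz : 0 < ‖z‖ ^ 2 + e) :
    softKernel p e z = (‖z‖ ^ 2 + e) * softKernel (p + 1) e z := by
  rw [softKernel, softKernel, show -p = 1 + -(p + 1) by ring, Real.rpow_add hz, Real.rpow_one]

/-- For 2p + 2 = m the unregularized power is harmonic, so only a term proportional to e survives: a
bump that concentrates at 0 as e → 0. -/
theorem lap_softKernel (hp : 2 * p + 2 = m) (hz : 0 < ‖z‖ ^ 2 + e) :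
    lap (softKernel p e) z = -(2 * p * m * e) * softKernel (p + 2) e z := by
  have hev : ∀ᶠ y in 𝓝 z, 0 < ‖y‖ ^ 2 + e :=
    (by fun_prop : ContinuousAt (fun y : Eu m => ‖y‖ ^ 2 + e) z).eventually (lt_mem_nhds hz)
  have h (k : Fin m) : pd k (pd k (softKernel p e)) z =
      -2 * p * (softKernel (p + 1) e z + z k * (-2 * (p + 1) * (z k * softKernel (p + 2) e z))) := by
    rw [pd_congr (hev.mono fun y hy => pd_softKernel hy k), pd_const_mul,
      pd_mul (f := fun y : Eu m => y k) (by fun_prop)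
        ((contDiffAt_softKernel (n := 1) hz).differentiableAt (by norm_num)), pd_coord,
      pd_softKernel hz]
    simp [show p + 1 + 1 = p + 2 by ring]
  have hs : ∑ k, z k * z k = ‖z‖ ^ 2 := sum_sq_coord z
  simp only [lap, h, ← Finset.mul_sum, Finset.sum_add_distrib, Finset.sum_const, Finset.card_univ,
    Fintype.card_fin, nsmul_eq_mul]
  have h3 : ∑ k, z k * (-2 * (p + 1) * (z k * softKernel (p + 2) e z)) =
      -m * ‖z‖ ^ 2 * softKernel (p + 2) e z := by
    rw [← hs, ← hp, Finset.mul_sum, Finset.sum_mul]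
    exact Finset.sum_congr rfl fun k _ => by ring
  rw [h3, softKernel_succ (p := p + 1) hz, show p + 1 + 1 = p + 2 by ring]
  ring

/-- With regularization R⁻² the kernel is a rescaling of one fixed profile. -/
theorem softKernel_smul {R : ℝ} (hR : 0 < R) {j : ℕ} (hp : 2 * p = j) (z : Eu m) :
    softKernel p (R⁻¹ ^ 2) (R⁻¹ • z) = R ^ j * softKernel p 1 z := by
  have h : ‖R⁻¹ • z‖ ^ 2 + R⁻¹ ^ 2 = (R ^ 2)⁻¹ * (‖z‖ ^ 2 + 1) := by
    rw [norm_smul, Real.norm_of_nonneg (by positivity)]; field_simp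
  rw [softKernel, h, Real.mul_rpow (by positivity) (by positivity), softKernel]
  congr 1
  rw [Real.inv_rpow (by positivity), Real.rpow_neg (by positivity), inv_inv, ← Real.rpow_natCast,
    ← Real.rpow_natCast, ← Real.rpow_mul hR.le, ← hp]
  norm_num

end Laplacian

/-! ### Newtonian potentials -/

section Newton

open Asymptotics

variable {m j : ℕ} {p : ℝ}

theorem softKernel_le_inv_pow {e s : ℝ} (he : 0 ≤ e) (hs : 0 < s) (hp : 2 * p = j) {z : Eu m}
    (hz : s ≤ ‖z‖) : softKernel p e z ≤ (s ^ j)⁻¹ := by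
  have h0 : z ≠ 0 := norm_pos_iff.1 (hs.trans_le hz)
  have hp0 : 0 ≤ p := by linarith [(Nat.cast_nonneg j : (0 : ℝ) ≤ j)]
  refine (softKernel_le hp0 he h0).trans ?_
  rw [softKernel_zero_eq hp]
  gcongr

theorem abs_pd_softKernel_le {e s : ℝ} (he : 0 ≤ e) (hs : 0 < s) (hp : 2 * p = j) {z : Eu m}
    (hz : s ≤ ‖z‖) (k : Fin m) : |pd k (softKernel p e) z| ≤ j * (s ^ (j + 1))⁻¹ := by
  have hz0 : 0 < ‖z‖ := hs.trans_le hz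
  have h1 : softKernel (p + 1) e z ≤ (‖z‖ ^ (j + 2))⁻¹ :=
    softKernel_le_inv_pow he hz0 (by push_cast; linarith) le_rfl
  rw [pd_softKernel (by positivity), abs_mul, show |-2 * p| = j by rw [neg_mul, abs_neg, hp,
    Nat.abs_cast], abs_mul, abs_of_nonneg (softKernel_nonneg he)]
  gcongr
  calc |z k| * softKernel (p + 1) e z ≤ ‖z‖ * (‖z‖ ^ (j + 2))⁻¹ := by
        gcongr
        exacts [softKernel_nonneg he, abs_coord_le z k]
    _ = (‖z‖ ^ (j + 1))⁻¹ := by field_simp; ring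
    _ ≤ (s ^ (j + 1))⁻¹ := by gcongr

theorem exists_abs_le_of_tendsto_cobounded {W : Eu m → ℝ} (hW : Continuous W)
    (h0 : Tendsto W (Bornology.cobounded (Eu m)) (𝓝 0)) : ∃ M, ∀ x, |W x| ≤ M := by
  have h1 : ∀ᶠ x in Bornology.cobounded (Eu m), ‖W x‖ ≤ 1 := by
    have := h0.norm
    rw [norm_zero] at this
    exact this.eventually_le_const zero_lt_one
  rw [Metric.cobounded_eq_cocompact, Filter.eventually_iff, Filter.mem_cocompact] at h1
  obtain ⟨t, ht, h⟩ := h1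
  obtain ⟨C, hC⟩ := ht.exists_bound_of_continuousOn hW.continuousOn
  refine ⟨max C 1, fun x => ?_⟩
  by_cases hx : x ∈ t
  · exact (hC x hx).trans (le_max_left _ _)
  · exact (h hx : ‖W x‖ ≤ 1).trans (le_max_right _ _)

/-- A smooth cutoff function, equal to one on the unit ball and supported in the ball of
radius two. -/
def cutoff (m : ℕ) : ContDiffBump (0 : Eu m) := ⟨1, 2, one_pos, one_lt_two⟩

theorem cutoff_one {z : Eu m} (hz : ‖z‖ ≤ 1) : cutoff m z = 1 :=
  (cutoff m).one_of_mem_closedBall (by simpa [cutoff] using hz)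

theorem cutoff_zero {z : Eu m} (hz : 2 ≤ ‖z‖) : cutoff m z = 0 :=
  (cutoff m).zero_of_le_dist (by simpa [cutoff] using hz)

theorem abs_cutoff_le (z : Eu m) : |cutoff m z| ≤ 1 := by
  rw [abs_of_nonneg (cutoff m).nonneg]; exact (cutoff m).le_one

theorem cutoff_eventuallyEq_const {z : Eu m} (hz : ‖z‖ < 1 ∨ 2 < ‖z‖) :
    ∃ c : ℝ, (cutoff m : Eu m → ℝ) =ᶠ[𝓝 z] fun _ => c := by
  rcases hz with hz | hz
  · refine ⟨1, ?_⟩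
    filter_upwards [continuous_norm.continuousAt.eventually (gt_mem_nhds hz)] with y hy
    exact cutoff_one hy.le
  · refine ⟨0, ?_⟩
    filter_upwards [continuous_norm.continuousAt.eventually (lt_mem_nhds hz)] with y hy
    exact cutoff_zero hy.le

theorem pd_cutoff_eq_zero {z : Eu m} (hz : ‖z‖ < 1 ∨ 2 < ‖z‖) (k : Fin m) :
    pd k (cutoff m) z = 0 := by
  obtain ⟨c, hc⟩ := cutoff_eventuallyEq_const hz
  rw [pd_congr hc, pd_const]

theorem lap_cutoff_eq_zero {z : Eu m} (hz : ‖z‖ < 1 ∨ 2 < ‖z‖) : lap (cutoff m) z = 0 := by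
  obtain ⟨c, hc⟩ := cutoff_eventuallyEq_const hz
  rw [lap_congr hc, lap]
  refine Finset.sum_eq_zero fun k _ => ?_
  rw [show pd k (fun _ : Eu m => c) = fun _ => 0 from funext fun y => pd_const c, pd_const]

/-- The commutator of the Laplacian with a cutoff function at distance `R`, applied to a regularized
power centered at `x`. -/
def cutoffError (p R : ℝ) (x y : Eu m) : ℝ :=
  lap (fun y => cutoff m (R⁻¹ • y)) y * softKernel p (R⁻¹ ^ 2) (y - x) +
    2 * ∑ k, pd k (fun y => cutoff m (R⁻¹ • y)) y * pd k (softKernel p (R⁻¹ ^ 2)) (y - x)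

theorem cutoffError_eq_zero {R : ℝ} (hR : 0 < R) {x y : Eu m} (hy : ‖y‖ < R ∨ 2 * R < ‖y‖) :
    cutoffError p R x y = 0 := by
  have h : ‖R⁻¹ • y‖ < 1 ∨ 2 < ‖R⁻¹ • y‖ := by
    rw [norm_smul, Real.norm_of_nonneg (by positivity), inv_mul_eq_div, div_lt_one hR,
      lt_div_iff₀ hR]
    exact hy
  rw [cutoffError, lap_comp_smul, lap_cutoff_eq_zero h]
  simp [pd_comp_smul, pd_cutoff_eq_zero h]

/-- The error lives on R ≤ |y| ≤ 2R, where |y - x| ≥ R/2. Two derivatives on the cutoff give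
R⁻²·R^{-j}, one on each factor gives R⁻¹·R^{-j-1}; both are R^{-m}. -/
theorem exists_cutoffError_le (hp : 2 * p = j) (hm : m = j + 2) :
    ∃ C, 0 ≤ C ∧ ∀ (x y : Eu m) (R : ℝ), 1 ≤ R → 2 * ‖x‖ ≤ R →
      |cutoffError p R x y| ≤ C * (R ^ m)⁻¹ := by
  have hη : ContDiff ℝ 2 (cutoff m) := (cutoff m).contDiff
  have h1 (k : Fin m) : ∃ C, ∀ z, ‖pd k (cutoff m) z‖ ≤ C :=
    (hη.pd (n' := 0) (by norm_num) k).continuous.bounded_above_of_compact_support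
      ((cutoff m).hasCompactSupport.pd k)
  choose C₁ hC₁ using h1
  obtain ⟨C₂, hC₂⟩ := hη.continuous_lap.bounded_above_of_compact_support
    (HasCompactSupport.intro (isCompact_closedBall (0 : Eu m) 2) fun z hz =>
      lap_cutoff_eq_zero (Or.inr (by simpa using hz)))
  have hC₁0 (k) : 0 ≤ C₁ k := (norm_nonneg _).trans (hC₁ k 0)
  have hC₂0 : 0 ≤ C₂ := (norm_nonneg _).trans (hC₂ 0)
  have hS : 0 ≤ ∑ k, C₁ k * (j * 2 ^ (j + 1)) :=
    Finset.sum_nonneg fun k _ => mul_nonneg (hC₁0 k) (by positivity)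
  refine ⟨C₂ * 2 ^ j + 2 * ∑ k, C₁ k * (j * 2 ^ (j + 1)), by positivity, fun x y R hR hx => ?_⟩
  have hR0 : 0 < R := by linarith
  by_cases hy : ‖y‖ < R
  · rw [cutoffError_eq_zero hR0 (Or.inl hy), abs_zero]; positivity
  push Not at hy
  have hz : R / 2 ≤ ‖y - x‖ := by linarith [norm_sub_norm_le y x]
  have he : (0 : ℝ) ≤ R⁻¹ ^ 2 := by positivity
  have hK := softKernel_le_inv_pow he (by positivity) hp hz
  rw [cutoffError, lap_comp_smul]
  simp only [pd_comp_smul]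
  refine (abs_add_le _ _).trans ?_
  rw [add_mul]
  refine add_le_add ?_ ?_
  · rw [abs_mul, abs_mul, abs_of_nonneg he, abs_of_nonneg (softKernel_nonneg he)]
    calc R⁻¹ ^ 2 * |lap (cutoff m) (R⁻¹ • y)| * softKernel p (R⁻¹ ^ 2) (y - x)
        ≤ R⁻¹ ^ 2 * C₂ * ((R / 2) ^ j)⁻¹ := by
          gcongr
          exacts [softKernel_nonneg he, hC₂ _]
      _ = C₂ * 2 ^ j * (R ^ m)⁻¹ := by
          rw [hm, div_pow, pow_add]; field_simp
  · rw [abs_mul, abs_two, mul_assoc, Finset.sum_mul]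
    gcongr
    refine (Finset.abs_sum_le_sum_abs _ _).trans (Finset.sum_le_sum fun k _ => ?_)
    rw [abs_mul, abs_mul, abs_of_nonneg (inv_nonneg.2 hR0.le)]
    calc R⁻¹ * |pd k (cutoff m) (R⁻¹ • y)| * |pd k (softKernel p (R⁻¹ ^ 2)) (y - x)|
        ≤ R⁻¹ * C₁ k * (j * ((R / 2) ^ (j + 1))⁻¹) := by
          gcongr
          · have := hC₁0 k
            positivity
          · exact hC₁ k _
          · exact abs_pd_softKernel_le he (by positivity) hp hz k
      _ = C₁ k * (j * 2 ^ (j + 1)) * (R ^ m)⁻¹ := by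
          rw [hm, div_pow, show j + 2 = (j + 1) + 1 from rfl, pow_succ R (j + 1)]; field_simp

/-- The R^{-m} bound is balanced by the volume, of order R^m, so W → 0 without any rate is enough.
-/
theorem tendsto_integral_mul_cutoffError (hp : 2 * p = j) (hm : m = j + 2) {W : Eu m → ℝ}
    (h0 : Tendsto W (Bornology.cobounded (Eu m)) (𝓝 0)) (x : Eu m) :
    Tendsto (fun R : ℝ => ∫ y, W y * cutoffError p R x y) atTop (𝓝 0) := by
  obtain ⟨C, hC0, hC⟩ := exists_cutoffError_le (p := p) hp hm
  set v : ℝ := (volume : Measure (Eu m)).real (Metric.ball 0 1)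
  have hv : 0 ≤ v := measureReal_nonneg
  rw [Metric.tendsto_nhds]
  intro ε hε
  -- Here C·2^m·v·R^{-m} times R^m bounds the total error weight; the + 1 avoids a zero denominator
  -- and makes the final inequality strict.
  have hδ : 0 < ε / (C * 2 ^ m * v + 1) := by positivity
  set δ := ε / (C * 2 ^ m * v + 1)
  have hW : ∀ᶠ y in Bornology.cobounded (Eu m), |W y| < δ := by
    simpa using Metric.tendsto_nhds.1 h0 δ hδ
  obtain ⟨r, -, hr⟩ := (hasBasis_cobounded_norm.eventually_iff).1 hW
  filter_upwards [eventually_ge_atTop 1, eventually_ge_atTop (2 * ‖x‖), eventually_ge_atTop r]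
    with R h1 h2 h3
  have hR : 0 < R := by linarith
  have hb (y : Eu m) : ‖W y * cutoffError p R x y‖ ≤ δ * (C * (R ^ m)⁻¹) := by
    by_cases hy : ‖y‖ < R
    · rw [cutoffError_eq_zero hR (Or.inl hy), mul_zero, norm_zero]; positivity
    · rw [norm_mul]
      exact mul_le_mul (hr (h3.trans (not_lt.1 hy))).le (hC x y R h1 h2) (norm_nonneg _) hδ.le
  have hs : ∫ y, W y * cutoffError p R x y =
      ∫ y in Metric.closedBall 0 (2 * R), W y * cutoffError p R x y := by
    refine (setIntegral_eq_integral_of_forall_compl_eq_zero fun y hy => ?_).symm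
    rw [cutoffError_eq_zero hR (Or.inr (by simpa using hy)), mul_zero]
  rw [dist_zero_right, hs]
  refine (norm_setIntegral_le_of_norm_le_const measure_closedBall_lt_top fun y _ => hb y).trans_lt ?_
  rw [Measure.real, Measure.addHaar_closedBall _ _ (by positivity), ENNReal.toReal_mul,
    ENNReal.toReal_ofReal (by positivity)]
  change δ * (C * (R ^ m)⁻¹) * ((2 * R) ^ Module.finrank ℝ (Eu m) * v) < ε
  rw [finrank_euclideanSpace_fin]
  have : δ * (C * (R ^ m)⁻¹) * ((2 * R) ^ m * v) = ε * ((C * 2 ^ m * v) / (C * 2 ^ m * v + 1)) := by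
    rw [mul_pow]; simp only [δ]; field_simp
  rw [this]
  refine mul_lt_of_lt_one_right hε ?_
  rw [div_lt_one (by positivity)]
  linarith

end Newton

/-! ### Representing functions harmonic near infinity by Newtonian potentials. -/

section NewtonRepresentation

variable {m j : ℕ} {p : ℝ}

theorem _root_.HasCompactSupport.lap {f : Eu m → ℝ} (hf : HasCompactSupport f) :
    HasCompactSupport (lap f) := by
  refine HasCompactSupport.intro hf fun x hx => ?_
  rw [lap_congr (notMem_tsupport_iff_eventuallyEq.1 hx)]
  refine Finset.sum_eq_zero fun k _ => ?_
  rw [show ADM.pd k (0 : Eu m → ℝ) = fun _ => 0 from funext fun y => pd_const 0, pd_const]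

/-- The total mass of the Laplacian of the regularized Newtonian kernel. -/
def newtonConst (m : ℕ) (p : ℝ) : ℝ := -(2 * p * m) * ∫ z : Eu m, softKernel (p + 2) 1 z

theorem integrable_softKernel (hp : 2 * p + 2 = m) :
    Integrable fun z : Eu m => softKernel (p + 2) 1 z := by
  have h : (Module.finrank ℝ (Eu m) : ℝ) < m + 2 := by simp
  refine (integrable_rpow_neg_one_add_norm_sq h (μ := volume)).congr (.of_forall fun z => ?_)
  simp only [softKernel]
  rw [add_comm, ← hp]
  congr 1
  ring

/-- Only nonvanishing matters, since the coefficient a need not be computed; positivity of the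
profile suffices. -/
theorem newtonConst_ne_zero (hp : 2 * p + 2 = m) (hp0 : 0 < p) : newtonConst m p ≠ 0 := by
  have hm : (m : ℝ) ≠ 0 := by rw [← hp]; positivity
  have h : 0 < ∫ z : Eu m, softKernel (p + 2) 1 z := by
    rw [integral_pos_iff_support_of_nonneg (fun z => softKernel_nonneg zero_le_one)
      (integrable_softKernel hp)]
    have : Function.support (fun z : Eu m => softKernel (p + 2) 1 z) = Set.univ := by
      ext z
      have : 0 < softKernel (p + 2) 1 z := by unfold softKernel; positivity
      simp [this.ne']
    rw [this]
    exact Measure.measure_univ_pos.2 (NeZero.ne _)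
  unfold newtonConst
  exact mul_ne_zero (neg_ne_zero.2 (mul_ne_zero (mul_ne_zero two_ne_zero hp0.ne') hm)) h.ne'

theorem tendsto_inv_smul_add {x z : Eu m} :
    Tendsto (fun R : ℝ => R⁻¹ • z + x) atTop (𝓝 x) := by
  simpa using ((tendsto_inv_atTop_zero (𝕜 := ℝ)).smul_const z).add_const x

theorem eventually_cutoff_eq_one {l : Filter ℝ} (hl : l ≤ atTop) {y : ℝ → Eu m} {a : Eu m}
    (hy : Tendsto y l (𝓝 a)) : ∀ᶠ R in l, cutoff m (R⁻¹ • y R) = 1 := by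
  have h : Tendsto (fun R : ℝ => R⁻¹ • y R) l (𝓝 ((0 : ℝ) • a)) :=
    (tendsto_inv_atTop_zero.mono_left hl).smul hy
  rw [zero_smul] at h
  filter_upwards [h.norm.eventually (gt_mem_nhds (by simp : ‖(0 : Eu m)‖ < 1))] with R hR
  exact cutoff_one hR.le

/-- An approximate identity: the substitution y = x + z/R turns the bump into a fixed integrable
profile, and W is bounded and continuous. -/
theorem tendsto_integral_mul_lap_softKernel (hp : 2 * p + 2 = m) (hp0 : 0 < p) {W : Eu m → ℝ}
    (hW : Continuous W) (h0 : Tendsto W (Bornology.cobounded (Eu m)) (𝓝 0)) (x : Eu m) :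
    Tendsto (fun R : ℝ => ∫ y, W y * (cutoff m (R⁻¹ • y) *
      lap (softKernel p (R⁻¹ ^ 2)) (y - x))) atTop (𝓝 (newtonConst m p * W x)) := by
  obtain ⟨M, hM⟩ := exists_abs_le_of_tendsto_cobounded hW h0
  have hlim : Tendsto (fun R : ℝ => ∫ z, W (R⁻¹ • z + x) * cutoff m (R⁻¹ • (R⁻¹ • z + x)) *
      (-(2 * p * m) * softKernel (p + 2) 1 z)) atTop
      (𝓝 (∫ z : Eu m, W x * 1 * (-(2 * p * m) * softKernel (p + 2) 1 z))) := by
    refine tendsto_integral_filter_of_dominated_convergence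
      (fun z => M * 1 * |-(2 * p * m) * softKernel (p + 2) 1 z|) ?_ ?_
      (((integrable_softKernel hp).const_mul _).abs.const_mul _) (.of_forall fun z => ?_)
    · refine .of_forall fun R => Continuous.aestronglyMeasurable ?_
      have h1 := (cutoff m).continuous
      have h2 : Continuous (softKernel (p + 2) 1 : Eu m → ℝ) :=
        (contDiff_softKernel (n := 0) one_pos).continuous
      fun_prop
    · refine .of_forall fun R => .of_forall fun z => ?_
      rw [norm_mul, norm_mul]
      exact mul_le_mul_of_nonneg_right (mul_le_mul (hM _) (abs_cutoff_le _) (norm_nonneg _)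
        ((abs_nonneg _).trans (hM 0))) (abs_nonneg _)
    · refine ((hW.tendsto x).comp tendsto_inv_smul_add |>.mul
        (tendsto_const_nhds.congr' ?_)).mul_const _
      filter_upwards [eventually_cutoff_eq_one le_rfl (tendsto_inv_smul_add (x := x) (z := z))]
        with R hR using hR.symm
  have e : ∫ z : Eu m, W x * 1 * (-(2 * p * m) * softKernel (p + 2) 1 z) =
      newtonConst m p * W x := by
    rw [integral_const_mul, integral_const_mul, newtonConst]; ring
  rw [e] at hlim
  refine hlim.congr' ?_
  filter_upwards [eventually_gt_atTop 0] with R hR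
  have hl (z : Eu m) := lap_softKernel (z := z) (e := R⁻¹ ^ 2) hp (by positivity)
  rw [← integral_add_right_eq_self (fun y => W y * (cutoff m (R⁻¹ • y) * _)) x]
  have hs := Measure.integral_comp_smul (volume : Measure (Eu m)) (fun y => W (y + x) *
    (cutoff m (R⁻¹ • (y + x)) * lap (softKernel p (R⁻¹ ^ 2)) (y + x - x))) R⁻¹
  have hr : (R ^ m)⁻¹ * |(R⁻¹ ^ Module.finrank ℝ (Eu m))⁻¹| = 1 := by
    rw [finrank_euclideanSpace_fin, abs_of_pos (by positivity), inv_pow, inv_inv,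
      inv_mul_cancel₀ (by positivity)]
  have hs' := congrArg (fun t => (R ^ m)⁻¹ * t) hs
  simp only [smul_eq_mul, ← mul_assoc, hr, one_mul] at hs'
  simp only [mul_assoc] at hs'
  rw [← hs', ← integral_const_mul]
  refine integral_congr_ae (.of_forall fun z => ?_)
  -- The scaling yields R^{m+2}; the factor e = R⁻² and the Jacobian R^{-m} cancel it.
  have h3 := softKernel_smul (p := p + 2) hR (j := m + 2) (by push_cast; linarith) z
  simp only [add_sub_cancel_right, hl, h3]
  field_simp
  ring

/-- The point x is at distance at least s = ‖x‖ - ρ from the support of f, so the kernels are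
bounded by s^{-2p} there and the singularity never matters. -/
theorem tendsto_integral_mul_softKernel (hp0 : 0 < p) {f : Eu m → ℝ}
    (hf : Continuous f) {ρ : ℝ} (hρ : ∀ y, ρ < ‖y‖ → f y = 0) {x : Eu m} (hx : ρ < ‖x‖) :
    Tendsto (fun R : ℝ => ∫ y, f y * (cutoff m (R⁻¹ • y) * softKernel p (R⁻¹ ^ 2) (y - x)))
      atTop (𝓝 (∫ y, f y * softKernel p 0 (y - x))) := by
  have hc : HasCompactSupport f := HasCompactSupport.intro (isCompact_closedBall (0 : Eu m) ρ)
    fun y hy => hρ y (by simpa using hy)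
  set s := ‖x‖ - ρ
  have hs : 0 < s := sub_pos.2 hx
  have hsy {y : Eu m} (hy : f y ≠ 0) : s ≤ ‖y - x‖ := by
    have h1 : ‖y‖ ≤ ρ := not_lt.1 fun h => hy (hρ y h)
    have h2 := norm_sub_norm_le x y
    rw [norm_sub_rev] at h2
    simp only [s]; linarith
  refine tendsto_integral_filter_of_dominated_convergence
    (fun y => |f y| * (s ^ 2) ^ (-p)) ?_ ?_
    ((hf.integrable_of_hasCompactSupport hc).abs.mul_const _) (.of_forall fun y => ?_)
  · filter_upwards [eventually_gt_atTop 0] with R hR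
    refine Continuous.aestronglyMeasurable ?_
    have h1 := (cutoff m).continuous
    have h2 : Continuous (softKernel p (R⁻¹ ^ 2) : Eu m → ℝ) :=
      (contDiff_softKernel (n := 0) (by positivity)).continuous
    fun_prop
  · refine .of_forall fun R => .of_forall fun y => ?_
    by_cases hy : f y = 0
    · simp [hy]
    rw [norm_mul, Real.norm_eq_abs]
    gcongr
    rw [norm_mul, ← one_mul ((s ^ 2) ^ (-p))]
    refine mul_le_mul (abs_cutoff_le _) ?_ (norm_nonneg _) zero_le_one
    rw [Real.norm_of_nonneg (softKernel_nonneg (by positivity))]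
    refine Real.rpow_le_rpow_of_nonpos (by positivity) ?_ (by linarith)
    have := hsy hy
    have : s ^ 2 ≤ ‖y - x‖ ^ 2 := by gcongr
    nlinarith [sq_nonneg R⁻¹]
  · by_cases hy : f y = 0
    · simp [hy]
    refine Tendsto.const_mul _ ?_
    have hz : 0 < ‖y - x‖ := hs.trans_le (hsy hy)
    have h1 : Tendsto (fun R : ℝ => ‖y - x‖ ^ 2 + R⁻¹ ^ 2) atTop (𝓝 (‖y - x‖ ^ 2 + 0)) := by
      simpa using (tendsto_inv_atTop_zero.pow 2).const_add (‖y - x‖ ^ 2)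
    have h2 := h1.rpow_const (p := -p) (Or.inl (by positivity))
    rw [← one_mul (softKernel _ _ _)]
    refine Tendsto.mul (tendsto_const_nhds.congr' ?_) h2
    filter_upwards [eventually_cutoff_eq_one le_rfl (tendsto_const_nhds (x := y))] with R hR
      using hR.symm

/-- A function which is harmonic near infinity and tends to zero there is a Newtonian potential. -/
theorem newtonConst_mul_eq_integral (hp : 2 * p = j) (hm : m = j + 2) (hp0 : 0 < p) {W : Eu m → ℝ}
    (hW : ContDiff ℝ 2 W) (h0 : Tendsto W (Bornology.cobounded (Eu m)) (𝓝 0)) {ρ : ℝ}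
    (hρ : ∀ y, ρ < ‖y‖ → lap W y = 0) {x : Eu m} (hx : ρ < ‖x‖) :
    newtonConst m p * W x = ∫ y, lap W y * softKernel p 0 (y - x) := by
  have hpm : 2 * p + 2 = m := by rw [hp, hm]; push_cast; ring
  have h1 := tendsto_integral_mul_softKernel hp0 hW.continuous_lap hρ hx
  -- One parameter R drives both limits: the regularization R⁻² vanishes while the cutoff radius R
  -- grows.
  have h2 := (tendsto_integral_mul_lap_softKernel hpm hp0 hW.continuous h0 x).add
    (tendsto_integral_mul_cutoffError hp hm h0 x)
  rw [add_zero] at h2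
  refine tendsto_nhds_unique h2 (h1.congr' ?_)
  filter_upwards [eventually_gt_atTop 0] with R hR
  have hη : ContDiff ℝ 2 fun y : Eu m => cutoff m (R⁻¹ • y) :=
    (cutoff m).contDiff.comp (contDiff_const_smul _)
  have hK : ContDiff ℝ 2 (softKernel p (R⁻¹ ^ 2) : Eu m → ℝ) := contDiff_softKernel (by positivity)
  have hKx : ContDiff ℝ 2 fun y : Eu m => softKernel p (R⁻¹ ^ 2) (y - x) :=
    hK.comp (contDiff_id.sub contDiff_const)
  have hηc : HasCompactSupport fun y : Eu m => cutoff m (R⁻¹ • y) :=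
    (cutoff m).hasCompactSupport.comp_smul (inv_ne_zero hR.ne')
  -- The Laplacian of the test function splits into the approximate identity and the cutoff
  -- commutator.
  have hl (y : Eu m) : lap (fun y => cutoff m (R⁻¹ • y) * softKernel p (R⁻¹ ^ 2) (y - x)) y =
      cutoff m (R⁻¹ • y) * lap (softKernel p (R⁻¹ ^ 2)) (y - x) + cutoffError p R x y := by
    rw [lap_mul hη.contDiffAt hKx.contDiffAt, lap_comp_sub, cutoffError]
    simp only [pd_comp_sub]
    ring
  have hg := integral_mul_lap hW (hη.mul hKx) hηc.mul_right
  have hA : Continuous fun y => W y * (cutoff m (R⁻¹ • y) *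
      lap (softKernel p (R⁻¹ ^ 2)) (y - x)) :=
    hW.continuous.mul (hη.continuous.mul (hK.continuous_lap.comp (continuous_id.sub continuous_const)))
  have hAi : Integrable fun y => W y * (cutoff m (R⁻¹ • y) *
      lap (softKernel p (R⁻¹ ^ 2)) (y - x)) := hA.integrable_of_hasCompactSupport hηc.mul_right.mul_left
  have hTi : Integrable fun y => W y *
      lap (fun y => cutoff m (R⁻¹ • y) * softKernel p (R⁻¹ ^ 2) (y - x)) y :=
    (hW.continuous.mul (hη.mul hKx).continuous_lap).integrable_of_hasCompactSupport
      hηc.mul_right.lap.mul_left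
  have hBi : Integrable fun y => W y * cutoffError p R x y := by
    refine (hTi.sub hAi).congr (.of_forall fun y => ?_)
    change W y * lap (fun y => cutoff m (R⁻¹ • y) * softKernel p (R⁻¹ ^ 2) (y - x)) y - _ = _
    rw [hl]; ring
  rw [← integral_add hAi hBi]
  refine hg.symm.trans (integral_congr_ae (.of_forall fun y => ?_))
  change W y * lap (fun y => cutoff m (R⁻¹ • y) * softKernel p (R⁻¹ ^ 2) (y - x)) y = _
  rw [hl]; ring

end NewtonRepresentation

/-! ### Homogeneous kernels and the expansion of potentials at infinity -/

section Homogeneous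

open Asymptotics

variable {m q : ℕ} {K : Eu m → ℝ}

/-- `K` is smooth away from the origin and positively homogeneous of degree `-q`. -/
structure IsHomogeneousKernel (q : ℕ) (K : Eu m → ℝ) : Prop where
  smooth : ∀ z, z ≠ 0 → ContDiffAt ℝ ∞ K z
  homogeneous : ∀ t : ℝ, 0 < t → ∀ z, z ≠ 0 → K (t • z) = (t ^ q)⁻¹ * K z

theorem IsHomogeneousKernel.pd (hK : IsHomogeneousKernel q K) (k : Fin m) :
    IsHomogeneousKernel (q + 1) (pd k K) where
  smooth z hz := contDiffAt_pd (hK.smooth z hz) (by simp) k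
  homogeneous t ht z hz := by
    have h : (fun y => K (t • y)) =ᶠ[𝓝 z] fun y => (t ^ q)⁻¹ * K y := by
      filter_upwards [isOpen_ne.mem_nhds hz] with y hy using hK.homogeneous t ht y hy
    have h1 := pd_congr (k := k) h
    rw [pd_comp_smul, pd_const_mul] at h1
    rw [pow_succ', mul_inv, mul_assoc, ← h1, inv_mul_cancel_left₀ ht.ne']

/-- Homogeneity reduces the bound to the maximum over the compact unit sphere. -/
theorem IsHomogeneousKernel.exists_abs_le (hK : IsHomogeneousKernel q K) :
    ∃ C, 0 ≤ C ∧ ∀ z, z ≠ 0 → |K z| ≤ C * (‖z‖ ^ q)⁻¹ := by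
  obtain ⟨C, hC⟩ := (isCompact_sphere (0 : Eu m) 1).exists_bound_of_continuousOn (f := K)
    fun z hz => (hK.smooth z (by rintro rfl; simp at hz)).continuousAt.continuousWithinAt
  refine ⟨max C 0, le_max_right _ _, fun z hz => ?_⟩
  have hn : 0 < ‖z‖ := norm_pos_iff.2 hz
  have hu : ‖z‖⁻¹ • z ∈ Metric.sphere (0 : Eu m) 1 := by
    simp [norm_smul, hn.ne']
  have hu0 : ‖z‖⁻¹ • z ≠ 0 := smul_ne_zero (inv_ne_zero hn.ne') hz
  have h := hK.homogeneous ‖z‖ hn _ hu0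
  rw [smul_inv_smul₀ hn.ne'] at h
  rw [h, abs_mul, abs_of_pos (by positivity), mul_comm]
  gcongr
  exact (hC _ hu).trans (le_max_left _ _)

theorem norm_fderiv_le_sum_pd (f : Eu m → ℝ) (x : Eu m) : ‖fderiv ℝ f x‖ ≤ ∑ k, |pd k f x| := by
  refine ContinuousLinearMap.opNorm_le_bound _ (Finset.sum_nonneg fun _ _ => abs_nonneg _) fun v => ?_
  rw [fderiv_apply_eq_sum_pd, Finset.sum_mul]
  refine (Finset.abs_sum_le_sum_abs _ _).trans (Finset.sum_le_sum fun k _ => ?_)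
  rw [abs_mul, mul_comm]
  gcongr
  exact abs_coord_le v k

theorem IsHomogeneousKernel.exists_norm_fderiv_le (hK : IsHomogeneousKernel q K) :
    ∃ C, 0 ≤ C ∧ ∀ z, z ≠ 0 → ‖fderiv ℝ K z‖ ≤ C * (‖z‖ ^ (q + 1))⁻¹ := by
  choose C hC0 hC using fun k => (hK.pd k).exists_abs_le
  refine ⟨∑ k, C k, Finset.sum_nonneg fun k _ => hC0 k, fun z hz => ?_⟩
  refine (norm_fderiv_le_sum_pd K z).trans ?_
  rw [Finset.sum_mul]
  exact Finset.sum_le_sum fun k _ => hC k z hz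

/-- Mean value inequality on the ball of radius ‖x‖/2 about x, which avoids the origin; there ‖z‖ ≥
‖x‖/2, whence the factor 2^{q+1}. -/
theorem IsHomogeneousKernel.exists_abs_sub_le (hK : IsHomogeneousKernel q K) :
    ∃ C, 0 ≤ C ∧ ∀ x y, x ≠ 0 → 2 * ‖y‖ ≤ ‖x‖ →
      |K (x - y) - K x| ≤ C * ‖y‖ * (‖x‖ ^ (q + 1))⁻¹ := by
  obtain ⟨C, hC0, hC⟩ := hK.exists_norm_fderiv_le
  refine ⟨C * 2 ^ (q + 1), by positivity, fun x y hx hy => ?_⟩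
  have hn : 0 < ‖x‖ := norm_pos_iff.2 hx
  have hz {z : Eu m} (h : z ∈ Metric.closedBall x (‖x‖ / 2)) : ‖x‖ / 2 ≤ ‖z‖ := by
    rw [Metric.mem_closedBall, dist_eq_norm, norm_sub_rev] at h
    linarith [norm_sub_norm_le x z]
  have hz0 {z : Eu m} (h : z ∈ Metric.closedBall x (‖x‖ / 2)) : z ≠ 0 :=
    norm_pos_iff.1 ((half_pos hn).trans_le (hz h))
  have h := (convex_closedBall x (‖x‖ / 2)).norm_image_sub_le_of_norm_fderiv_le (𝕜 := ℝ) (f := K)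
    (C := C * ((‖x‖ / 2) ^ (q + 1))⁻¹)
    (fun z h => (hK.smooth z (hz0 h)).differentiableAt (by simp)) (fun z h => ?_)
    (Metric.mem_closedBall_self (by positivity))
    (y := x - y) (by rw [Metric.mem_closedBall, dist_eq_norm]; simp; linarith)
  · refine h.trans_eq ?_
    rw [sub_sub_cancel_left, norm_neg, div_pow]
    field_simp
  · refine (hC z (hz0 h)).trans ?_
    have := hz h
    gcongr

variable {f : Eu m → ℝ} {ρ : ℝ}

/-- The singularity y = x lies where f vanishes identically. -/
theorem continuous_smul_comp_sub {E : Type*} [NormedAddCommGroup E] [NormedSpace ℝ E]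
    {g : Eu m → E} (hf : Continuous f) (hρ : ∀ y, ρ < ‖y‖ → f y = 0)
    (hg : ∀ z, z ≠ 0 → ContinuousAt g z) {x : Eu m} (hx : ρ < ‖x‖) :
    Continuous fun y => f y • g (x - y) := by
  refine continuous_iff_continuousAt.2 fun y => ?_
  by_cases hy : ρ < ‖y‖
  · have h : (fun y => f y • g (x - y)) =ᶠ[𝓝 y] fun _ => 0 := by
      filter_upwards [continuous_norm.continuousAt.eventually (lt_mem_nhds hy)] with z hz
      rw [hρ z hz, zero_smul]
    exact continuousAt_const.congr h.symm
  · have h0 : x - y ≠ 0 := fun h => hy (by rwa [← sub_eq_zero.1 h])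
    exact hf.continuousAt.smul ((hg _ h0).comp (f := fun y => x - y) (by fun_prop))

/-- The potential of `f` for the kernel `K`, minus its leading term at infinity. -/
def potentialRemainder (f K : Eu m → ℝ) (x : Eu m) : ℝ := ∫ y, f y * (K (x - y) - K x)

/-- Subtracting K(x) gains one power of ‖x‖, because ‖y‖ ≤ ρ on the support of f. -/
theorem IsHomogeneousKernel.isBigO_potentialRemainder (hK : IsHomogeneousKernel q K)
    (hf : Continuous f) (hρ : ∀ y, ρ < ‖y‖ → f y = 0) :
    potentialRemainder f K =O[Bornology.cobounded (Eu m)] fun x => ‖x‖ ^ (-(q : ℤ) - 1) := by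
  obtain ⟨C, hC0, hC⟩ := hK.exists_abs_sub_le
  have hc : HasCompactSupport f := HasCompactSupport.intro (isCompact_closedBall (0 : Eu m) ρ)
    fun y hy => hρ y (by simpa using hy)
  refine IsBigO.of_bound (∫ y, |f y| * (C * ρ)) ?_
  filter_upwards [eventually_cobounded_ne_zero,
    tendsto_norm_cobounded_atTop.eventually_ge_atTop (2 * ρ)] with x hx0 hx
  rw [← integral_mul_const]
  refine norm_integral_le_of_norm_le (((hf.integrable_of_hasCompactSupport hc).abs.mul_const
    _).mul_const _) (.of_forall fun y => ?_)
  rw [norm_mul, mul_assoc, Real.norm_eq_abs]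
  by_cases hy : ρ < ‖y‖
  · simp [hρ y hy]
  push Not at hy
  gcongr
  refine (hC x y hx0 (by linarith)).trans ?_
  rw [Real.norm_of_nonneg (by positivity), show -(q : ℤ) - 1 = -((q + 1 : ℕ) : ℤ) by push_cast; ring,
    zpow_neg, zpow_natCast]
  gcongr

/-- Derivatives of a remainder are remainders of the differentiated kernel, so the decay of all
derivatives follows from the estimate of values alone. -/
theorem IsHomogeneousKernel.pd_potentialRemainder (hK : IsHomogeneousKernel q K)
    (hf : Continuous f) (hρ0 : 0 ≤ ρ) (hρ : ∀ y, ρ < ‖y‖ → f y = 0) {x : Eu m} (hx : ρ < ‖x‖)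
    (k : Fin m) :
    ADM.pd k (potentialRemainder f K) x = potentialRemainder f (ADM.pd k K) x := by
  obtain ⟨C, hC0, hC⟩ := hK.exists_norm_fderiv_le
  have hc : HasCompactSupport f := HasCompactSupport.intro (isCompact_closedBall (0 : Eu m) ρ)
    fun y hy => hρ y (by simpa using hy)
  -- Half the distance to the support: for x' within s of x, both x' - y and x' stay at distance at
  -- least s from the singularity.
  set s := (‖x‖ - ρ) / 2
  have hs : 0 < s := half_pos (sub_pos.2 hx)
  have hxs : ρ + 2 * s = ‖x‖ := by simp only [s]; ring
  have hball {x' : Eu m} (h : x' ∈ Metric.ball x s) : ρ + s < ‖x'‖ := by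
    rw [Metric.mem_ball, dist_eq_norm, norm_sub_rev] at h
    linarith [norm_sub_norm_le x x']
  have hcont (x' : Eu m) (h : ρ < ‖x'‖) : Continuous fun y => f y * (K (x' - y) - K x') := by
    have h1 := (continuous_smul_comp_sub hf hρ (fun z hz => (hK.smooth z hz).continuousAt) h).sub
      (hf.mul (continuous_const (y := K x')))
    exact h1.congr fun y => by simp [mul_sub]
  have hd (z : Eu m) (hz : z ≠ 0) : DifferentiableAt ℝ K z :=
    (hK.smooth z hz).differentiableAt (by simp)
  have hcont' : Continuous fun y => f y • (fderiv ℝ K (x - y) - fderiv ℝ K x) := by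
    have h1 := (continuous_smul_comp_sub hf hρ (g := fderiv ℝ K) (fun z hz =>
      ((hK.smooth z hz).fderiv_right (m := 0) (by simp)).continuousAt) hx).sub
      (hf.smul (continuous_const (y := fderiv ℝ K x)))
    exact h1.congr fun y => by simp [smul_sub]
  have hint : Integrable fun y => f y • (fderiv ℝ K (x - y) - fderiv ℝ K x) :=
    hcont'.integrable_of_hasCompactSupport hc.smul_right
  have h := hasFDerivAt_integral_of_dominated_of_fderiv_le (𝕜 := ℝ) (μ := volume)
    (F := fun x' y => f y * (K (x' - y) - K x'))
    (F' := fun x' y => f y • (fderiv ℝ K (x' - y) - fderiv ℝ K x'))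
    (bound := fun y => |f y| * (C * (s ^ (q + 1))⁻¹ + C * (s ^ (q + 1))⁻¹))
    (Metric.ball_mem_nhds x hs) ?_ ?_ hcont'.aestronglyMeasurable ?_ ?_ ?_
  · have h1 := h.fderiv
    change fderiv ℝ (potentialRemainder f K) x = _ at h1
    rw [ADM.pd, h1, ContinuousLinearMap.integral_apply hint]
    rfl
  · filter_upwards [Metric.ball_mem_nhds x hs] with x' hx'
    exact (hcont x' (by linarith [hball hx'])).aestronglyMeasurable
  · exact (hcont x hx).integrable_of_hasCompactSupport hc.mul_right
  · refine .of_forall fun y x' hx' => ?_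
    rw [norm_smul, Real.norm_eq_abs]
    by_cases hy : ρ < ‖y‖
    · simp [hρ y hy]
    push Not at hy
    have hx1 := hball hx'
    have h1 : s ≤ ‖x' - y‖ := by linarith [norm_sub_norm_le x' y]
    have h2 : s ≤ ‖x'‖ := by linarith
    gcongr
    refine (norm_sub_le _ _).trans (add_le_add ?_ ?_)
    · refine (hC _ (norm_pos_iff.1 (hs.trans_le h1))).trans ?_
      gcongr
    · refine (hC _ (norm_pos_iff.1 (hs.trans_le h2))).trans ?_
      gcongr
  · exact (hf.integrable_of_hasCompactSupport hc).abs.mul_const _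
  · refine .of_forall fun y x' hx' => ?_
    by_cases hy : ρ < ‖y‖
    · simpa [hρ y hy] using hasFDerivAt_const (0 : ℝ) x'
    have hx1 := hball hx'
    have h0 : x' - y ≠ 0 := fun h => hy (by rw [← sub_eq_zero.1 h]; linarith)
    have h1 : x' ≠ 0 := norm_pos_iff.1 (by linarith)
    exact (((hd _ h0).hasFDerivAt.comp x' ((hasFDerivAt_id x').sub_const y)).sub
      (hd _ h1).hasFDerivAt).const_mul (f y)

end Homogeneous

/-! ### Expansion of harmonic functions at infinity -/

section Expansion

open Asymptotics

variable {m j : ℕ} {p : ℝ}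

/-- `f` decays like `|x|^{-s}`, with the corresponding decay of its derivatives up to order two. -/
structure DecaysC2 (s : ℤ) (f : Eu m → ℝ) : Prop where
  decay : f =O[Bornology.cobounded (Eu m)] fun x => ‖x‖ ^ (-s)
  decay_deriv : ∀ k, pd k f =O[Bornology.cobounded (Eu m)] fun x => ‖x‖ ^ (-s - 1)
  decay_deriv₂ : ∀ k l, pd k (pd l f) =O[Bornology.cobounded (Eu m)] fun x => ‖x‖ ^ (-s - 2)

theorem DecaysC2.congr {s : ℤ} {f g : Eu m → ℝ} (hf : DecaysC2 s f)
    (h : ∀ᶠ x in Bornology.cobounded (Eu m), f =ᶠ[𝓝 x] g) : DecaysC2 s g where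
  decay := hf.decay.congr' (h.mono fun _ hx => hx.self_of_nhds) .rfl
  decay_deriv k := (hf.decay_deriv k).congr' (h.mono fun _ hx => pd_congr hx) .rfl
  decay_deriv₂ k l :=
    (hf.decay_deriv₂ k l).congr' (h.mono fun _ hx => pd_congr (pd_congr_nhds hx)) .rfl

theorem DecaysC2.const_mul {s : ℤ} {f : Eu m → ℝ} (hf : DecaysC2 s f) (c : ℝ) :
    DecaysC2 s fun x => c * f x where
  decay := hf.decay.const_mul_left c
  decay_deriv k := ((hf.decay_deriv k).const_mul_left c).congr_left fun x => (pd_const_mul c f x).symm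
  decay_deriv₂ k l := ((hf.decay_deriv₂ k l).const_mul_left c).congr_left fun x =>
    (pd_pd_const_mul c f x k l).symm

theorem IsHomogeneousKernel.isBigO {q : ℕ} {K : Eu m → ℝ} (hK : IsHomogeneousKernel q K) :
    K =O[Bornology.cobounded (Eu m)] fun x => ‖x‖ ^ (-(q : ℤ)) := by
  obtain ⟨C, -, hC⟩ := hK.exists_abs_le
  refine IsBigO.of_bound C (eventually_cobounded_ne_zero.mono fun x hx => ?_)
  rw [Real.norm_of_nonneg (by positivity : (0 : ℝ) ≤ ‖x‖ ^ (-(q : ℤ))), zpow_neg, zpow_natCast]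
  exact hC x hx

theorem IsHomogeneousKernel.decaysC2 {q : ℕ} {K : Eu m → ℝ} (hK : IsHomogeneousKernel q K) :
    DecaysC2 q K where
  decay := hK.isBigO
  decay_deriv k := by
    refine (hK.pd k).isBigO.congr_right fun x => ?_
    congr 1; push_cast; ring
  decay_deriv₂ k l := by
    refine ((hK.pd l).pd k).isBigO.congr_right fun x => ?_
    congr 1; push_cast; ring

theorem IsHomogeneousKernel.decaysC2_potentialRemainder {q : ℕ} {K f : Eu m → ℝ} {ρ : ℝ}
    (hK : IsHomogeneousKernel q K) (hf : Continuous f) (hρ0 : 0 ≤ ρ)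
    (hρ : ∀ y, ρ < ‖y‖ → f y = 0) : DecaysC2 (q + 1) (potentialRemainder f K) := by
  have hev : ∀ᶠ x in Bornology.cobounded (Eu m), ρ < ‖x‖ :=
    tendsto_norm_cobounded_atTop.eventually_gt_atTop ρ
  refine ⟨?_, fun k => ?_, fun k l => ?_⟩
  · refine (hK.isBigO_potentialRemainder hf hρ).congr_right fun x => ?_
    congr 1; ring
  · refine ((hK.pd k).isBigO_potentialRemainder hf hρ).congr' ?_ (.of_forall fun x => ?_)
    · exact hev.mono fun x hx => (hK.pd_potentialRemainder hf hρ0 hρ hx k).symm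
    · beta_reduce; congr 1
  · refine (((hK.pd l).pd k).isBigO_potentialRemainder hf hρ).congr' ?_ (.of_forall fun x => ?_)
    · refine hev.mono fun x hx => ?_
      have h : ADM.pd l (potentialRemainder f K) =ᶠ[𝓝 x] potentialRemainder f (ADM.pd l K) := by
        filter_upwards [continuous_norm.continuousAt.eventually (lt_mem_nhds hx)] with y hy
          using hK.pd_potentialRemainder hf hρ0 hρ hy l
      rw [pd_congr h, (hK.pd l).pd_potentialRemainder hf hρ0 hρ hx]
    · beta_reduce; congr 1

theorem isHomogeneousKernel_softKernel (hp : 2 * p = j) :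
    IsHomogeneousKernel j (softKernel p 0 : Eu m → ℝ) where
  smooth z hz := contDiffAt_softKernel (by positivity)
  homogeneous t ht z hz := by
    rw [softKernel_zero_eq hp, softKernel_zero_eq hp, norm_smul, Real.norm_of_nonneg ht.le, mul_pow,
      mul_inv]

/-- The coefficient a is the total integral of the Laplacian of W divided by `newtonConst`; what
remains is a potential remainder, one order smaller. -/
theorem exists_decaysC2_sub_softKernel (hp : 2 * p = j) (hm : m = j + 2) (hp0 : 0 < p)
    {W : Eu m → ℝ} (hW : ContDiff ℝ 2 W) (h0 : Tendsto W (Bornology.cobounded (Eu m)) (𝓝 0)) {ρ : ℝ}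
    (hρ0 : 0 ≤ ρ) (hρ : ∀ y, ρ < ‖y‖ → lap W y = 0) :
    ∃ a : ℝ, DecaysC2 (j + 1) fun x => W x - a * softKernel p 0 x := by
  set c := newtonConst m p
  have hc : c ≠ 0 := newtonConst_ne_zero (by rw [hp, hm]; push_cast; ring) hp0
  have hN := isHomogeneousKernel_softKernel (m := m) hp
  have hf := hW.continuous_lap
  have hcs : HasCompactSupport (lap W) := HasCompactSupport.intro
    (isCompact_closedBall (0 : Eu m) ρ) fun y hy => hρ y (by simpa using hy)
  refine ⟨c⁻¹ * ∫ y, lap W y, ((hN.decaysC2_potentialRemainder hf hρ0 hρ).const_mul c⁻¹).congr ?_⟩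
  have key {x : Eu m} (hx : ρ < ‖x‖) : c⁻¹ * potentialRemainder (lap W) (softKernel p 0) x =
      W x - (c⁻¹ * ∫ y, lap W y) * softKernel p 0 x := by
    have h1 := newtonConst_mul_eq_integral hp hm hp0 hW h0 hρ hx
    have hi : Integrable fun y => lap W y * softKernel p 0 (x - y) :=
      (continuous_smul_comp_sub hf hρ (fun z hz => (hN.smooth z hz).continuousAt)
        hx).integrable_of_hasCompactSupport hcs.mul_right
    have h2 : ∫ y, lap W y * softKernel p 0 (y - x) = ∫ y, lap W y * softKernel p 0 (x - y) := by
      simp only [← softKernel_neg (z := _ - x), neg_sub]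
    rw [potentialRemainder]
    simp only [mul_sub]
    rw [integral_sub hi ((hf.integrable_of_hasCompactSupport hcs).mul_const _), ← h2, ← h1,
      integral_mul_const]
    change c⁻¹ * (c * W x - _) = _
    field_simp
  filter_upwards [tendsto_norm_cobounded_atTop.eventually_gt_atTop ρ] with x hx
  filter_upwards [continuous_norm.continuousAt.eventually (lt_mem_nhds hx)] with y hy using key hy

theorem contDiffAt_deriv {f : ℝ → ℝ} {t : ℝ} {n n' : ℕ∞ω} (hf : ContDiffAt ℝ n f t)
    (h : n' + 1 ≤ n) : ContDiffAt ℝ n' (deriv f) t :=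
  (hf.fderiv_right h).clm_apply contDiffAt_const

theorem pd_pd_scomp {f : ℝ → ℝ} {u : Eu m → ℝ} {x : Eu m} (hf : ContDiffAt ℝ 2 f (u x))
    (hu : ContDiffAt ℝ 2 u x) (k l : Fin m) :
    pd k (pd l fun y => f (u y)) x =
      deriv (deriv f) (u x) * pd k u x * pd l u x + deriv f (u x) * pd k (pd l u) x := by
  have h : pd l (fun y => f (u y)) =ᶠ[𝓝 x] fun y => deriv f (u y) * pd l u y := by
    filter_upwards [contDiffAt_eventually_differentiableAt hu,
      hu.continuousAt.eventually (hf.eventually (by simp))] with y h1 h2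
    exact pd_scomp (h2.differentiableAt (by norm_num)) h1
  have hd : DifferentiableAt ℝ (deriv f) (u x) :=
    (contDiffAt_deriv (n' := 1) hf (by norm_num)).differentiableAt (by norm_num)
  have hu1 := hu.differentiableAt (by norm_num)
  rw [pd_congr h, pd_mul (f := fun y => deriv f (u y)) (hd.comp x hu1) (differentiableAt_pd hu l),
    pd_scomp hd hu1]

theorem isBigO_comp_sub_comp {α : Type*} {l : Filter α} {f : ℝ → ℝ} {t : ℝ} {u v : α → ℝ}
    (hf : ContDiffAt ℝ 1 f t) (hu : Tendsto u l (𝓝 t)) (hv : Tendsto v l (𝓝 t)) :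
    (fun x => f (u x) - f (v x)) =O[l] fun x => u x - v x :=
  (hf.hasStrictFDerivAt (by norm_num)).isBigO_sub.comp_tendsto (hu.prodMk_nhds hv)

/-- Every difference is telescoped so that each term contains either a derivative of u - v or a
difference of f, f' or f'' at u and v. Lipschitz control of f'' is the reason for three derivatives;
of v only scale-invariant decay is needed. -/
theorem DecaysC2.comp_sub_comp {s : ℤ} (hs : 0 ≤ s) {f : ℝ → ℝ} {t : ℝ} {u v : Eu m → ℝ}
    (hf : ContDiffAt ℝ 3 f t) (hu : ∀ᶠ x in Bornology.cobounded (Eu m), ContDiffAt ℝ 2 u x)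
    (hv : ∀ᶠ x in Bornology.cobounded (Eu m), ContDiffAt ℝ 2 v x)
    (hut : Tendsto u (Bornology.cobounded (Eu m)) (𝓝 t))
    (hvt : Tendsto v (Bornology.cobounded (Eu m)) (𝓝 t))
    (hvd : DecaysC2 0 fun x => v x - t) (h : DecaysC2 s fun x => u x - v x) :
    DecaysC2 s fun x => f (u x) - f (v x) := by
  set l := Bornology.cobounded (Eu m)
  have hf2 : ∀ᶠ y in 𝓝 t, ContDiffAt ℝ 2 f y :=
    (hf.of_le (by norm_num) : ContDiffAt ℝ 2 f t).eventually (by simp)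
  have hne : ∀ᶠ x in l, 0 < ‖x‖ := tendsto_norm_cobounded_atTop.eventually_gt_atTop 0
  have hf' : ContDiffAt ℝ 2 (deriv f) t := contDiffAt_deriv hf (by norm_num)
  have hf'' : ContDiffAt ℝ 1 (deriv (deriv f)) t := contDiffAt_deriv hf' (by norm_num)
  have e0 := (isBigO_comp_sub_comp (hf.of_le (by norm_num)) hut hvt).trans h.decay
  have e1 := (isBigO_comp_sub_comp (hf'.of_le (by norm_num)) hut hvt).trans h.decay
  have e2 := (isBigO_comp_sub_comp hf'' hut hvt).trans h.decay
  have b1 : (fun x => deriv f (u x)) =O[l] fun _ => (1 : ℝ) :=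
    (hf'.continuousAt.tendsto.comp hut).isBigO_one ℝ
  have b2 : (fun x => deriv (deriv f) (u x)) =O[l] fun _ => (1 : ℝ) :=
    (hf''.continuousAt.tendsto.comp hut).isBigO_one ℝ
  have v1 (k : Fin m) : pd k v =O[l] fun x => ‖x‖ ^ (-1 : ℤ) := by
    refine (hvd.decay_deriv k).congr' (hv.mono fun x hx => ?_) (.of_forall fun x => by simp)
    rw [pd_sub (hx.differentiableAt (by norm_num)) (differentiableAt_const _), pd_const, sub_zero]
  have v2 (k k' : Fin m) : pd k (pd k' v) =O[l] fun x => ‖x‖ ^ (-2 : ℤ) := by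
    refine (hvd.decay_deriv₂ k k').congr' (hv.mono fun x hx => ?_) (.of_forall fun x => by simp)
    rw [pd_pd_sub hx contDiffAt_const, show pd k' (fun _ : Eu m => t) = fun _ => 0 from
      funext fun y => pd_const t, pd_const, sub_zero]
  have u1 (k : Fin m) : pd k u =O[l] fun x => ‖x‖ ^ (-1 : ℤ) := by
    have h1 := ((h.decay_deriv k).trans (isBigO_zpow_of_le (k := -1) tendsto_norm_cobounded_atTop
      (by omega))).add (v1 k)
    refine h1.congr' ?_ .rfl
    filter_upwards [hu, hv] with x hx hx'
    rw [pd_sub (hx.differentiableAt (by norm_num)) (hx'.differentiableAt (by norm_num)),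
      sub_add_cancel]
  have mulz (a b c : ℤ) (hc : a + b = c) :
      (fun x : Eu m => ‖x‖ ^ a * ‖x‖ ^ b) =ᶠ[l] fun x => ‖x‖ ^ c := by
    filter_upwards [hne] with x hx
    rw [← zpow_add₀ hx.ne', hc]
  refine ⟨e0, fun k => ?_, fun k k' => ?_⟩
  · have t1 := (b1.mul (h.decay_deriv k)).congr_right fun x => one_mul _
    have t2 := (e1.mul (v1 k)).congr' .rfl (mulz _ _ (-s - 1) (by ring))
    refine (t1.add t2).congr' ?_ .rfl
    filter_upwards [hu, hv, hut.eventually hf2, hvt.eventually hf2] with x h1 h2 h3 h4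
    have h1' := h1.differentiableAt (by norm_num)
    have h2' := h2.differentiableAt (by norm_num)
    have h3' := h3.differentiableAt (by norm_num)
    have h4' := h4.differentiableAt (by norm_num)
    rw [pd_sub (f := fun x => f (u x)) (g := fun x => f (v x)) (h3'.comp x h1') (h4'.comp x h2'),
      pd_sub h1' h2', pd_scomp h3' h1', pd_scomp h4' h2']
    ring
  · have t1 := ((((b2.mul (h.decay_deriv k)).mul (u1 k')).congr_right fun x => by
      rw [one_mul]).congr' .rfl (mulz _ _ (-s - 2) (by ring)))
    have t2 := ((((b2.mul (v1 k)).mul (h.decay_deriv k')).congr_right fun x => by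
      rw [one_mul]).congr' .rfl (mulz _ _ (-s - 2) (by ring)))
    have t3 := ((e2.mul ((v1 k).mul (v1 k'))).congr' .rfl
      ((Filter.EventuallyEq.rfl.mul (mulz _ _ (-2) (by ring))).trans (mulz _ _ (-s - 2) (by ring))))
    have t4 := (b1.mul (h.decay_deriv₂ k k')).congr_right fun x => one_mul _
    have t5 := (e1.mul (v2 k k')).congr' .rfl (mulz _ _ (-s - 2) (by ring))
    refine ((((t1.add t2).add t3).add t4).add t5).congr' ?_ .rfl
    filter_upwards [hu, hv, hut.eventually hf2, hvt.eventually hf2] with x h1 h2 h3 h4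
    have h1' := h1.differentiableAt (by norm_num)
    have h2' := h2.differentiableAt (by norm_num)
    rw [pd_pd_sub (f := fun x => f (u x)) (g := fun x => f (v x)) (h3.comp x h1) (h4.comp x h2),
      pd_pd_sub h1 h2, pd_sub h1' h2', pd_sub h1' h2', pd_pd_scomp h3 h1, pd_pd_scomp h4 h2]
    ring

end Expansion

/-! ### Harmonically flat coordinate systems -/

section HarmonicallyFlat

open Asymptotics

variable {d : ℕ}

/-- The product vanishes identically on ‖x‖ < r, so the behaviour of U near the core is irrelevant.
-/
theorem contDiff_harmonic_mul_cutoff {m : ℕ} {U : Eu m → ℝ} {r : ℝ} (hr : 0 < r)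
    (hU : ∀ x, r ≤ ‖x‖ → InnerProductSpace.HarmonicAt U x) :
    ContDiff ℝ 2 fun x => (U x - 1) * (1 - cutoff m (r⁻¹ • x)) := by
  refine contDiff_iff_contDiffAt.2 fun x => ?_
  by_cases hx : r ≤ ‖x‖
  · exact ((hU x hx).1.sub contDiffAt_const).mul (contDiffAt_const.sub
      ((cutoff m).contDiff.comp (contDiff_const_smul _)).contDiffAt)
  · refine (contDiffAt_const (c := (0 : ℝ))).congr_of_eventuallyEq ?_
    filter_upwards [continuous_norm.continuousAt.eventually (gt_mem_nhds (not_le.1 hx))] with y hy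
    rw [cutoff_one, sub_self, mul_zero]
    rw [norm_smul, Real.norm_of_nonneg (by positivity), inv_mul_le_iff₀ hr, mul_one]
    exact hy.le

theorem cutoff_inv_smul_eq_zero {m : ℕ} {r : ℝ} (hr : 0 < r) {x : Eu m} (hx : 2 * r < ‖x‖) :
    cutoff m (r⁻¹ • x) = 0 := by
  refine cutoff_zero ?_
  rw [norm_smul, Real.norm_of_nonneg (by positivity), le_inv_mul_iff₀ hr, mul_comm]
  exact hx.le

/-- A harmonic function `U → 1` near infinity is asymptotic to `1 + a |x|^{1-d}`. -/
theorem exists_decaysC2_of_harmonicAt (hd : 2 ≤ d) {U : Eu (d + 1) → ℝ}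
    (hU : ∀ᶠ x in Bornology.cobounded (Eu (d + 1)), InnerProductSpace.HarmonicAt U x)
    (h1 : Tendsto U (Bornology.cobounded (Eu (d + 1))) (𝓝 1)) :
    ∃ a : ℝ, DecaysC2 d fun x => U x - (1 + a * softKernel (((d : ℝ) - 1) / 2) 0 x) := by
  obtain ⟨r₁, -, hr₁⟩ := hasBasis_cobounded_norm.eventually_iff.1 hU
  set r := max r₁ 1
  have hr : 0 < r := lt_max_of_lt_right one_pos
  have hU' (x : Eu (d + 1)) (hx : r ≤ ‖x‖) : InnerProductSpace.HarmonicAt U x :=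
    hr₁ ((le_max_left _ _).trans hx)
  have hW := contDiff_harmonic_mul_cutoff hr hU'
  have hWU {x : Eu (d + 1)} (hx : 2 * r < ‖x‖) :
      (fun x => (U x - 1) * (1 - cutoff (d + 1) (r⁻¹ • x))) =ᶠ[𝓝 x] fun x => U x - 1 := by
    filter_upwards [continuous_norm.continuousAt.eventually (lt_mem_nhds hx)] with y hy
    rw [cutoff_inv_smul_eq_zero hr hy, sub_zero, mul_one]
  have hev : ∀ᶠ x in Bornology.cobounded (Eu (d + 1)), 2 * r < ‖x‖ :=
    tendsto_norm_cobounded_atTop.eventually_gt_atTop _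
  have hW0 : Tendsto (fun x => (U x - 1) * (1 - cutoff (d + 1) (r⁻¹ • x)))
      (Bornology.cobounded (Eu (d + 1))) (𝓝 0) := by
    have h2 := h1.sub_const 1
    rw [sub_self] at h2
    exact h2.congr' (hev.mono fun x hx => (hWU hx).self_of_nhds.symm)
  obtain ⟨hc, -⟩ := two_le_cast hd
  obtain ⟨a, ha⟩ := exists_decaysC2_sub_softKernel (m := d + 1) (j := d - 1)
    (p := ((d : ℝ) - 1) / 2) (by push_cast [Nat.cast_sub (show 1 ≤ d by omega)]; ring) (by omega)
    (by positivity) hW hW0 (ρ := 2 * r) (by positivity) fun y hy => by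
      have hy' := hU' y (by linarith)
      rw [lap_congr (hWU hy)]
      have h2 : lap (fun x => U x - 1) y = lap U y := by
        refine Finset.sum_congr rfl fun k _ => ?_
        rw [pd_pd_sub hy'.1 contDiffAt_const, show pd k (fun _ : Eu (d + 1) => (1 : ℝ)) =
          fun _ => 0 from funext fun y => pd_const 1, pd_const, sub_zero]
      rw [h2, ← laplacian_eq_lap hy'.1]
      exact hy'.2.self_of_nhds
  rw [show ((d - 1 : ℕ) : ℤ) + 1 = d by omega] at ha
  refine ⟨a, ha.congr (hev.mono fun x hx => ?_)⟩
  filter_upwards [hWU hx] with y hy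
  rw [hy]; ring

theorem softKernel_eq_inv_norm_pow (hd : 2 ≤ d) (x : Eu (d + 1)) :
    softKernel (((d : ℝ) - 1) / 2) 0 x = (‖x‖ ^ (d - 1))⁻¹ :=
  softKernel_zero_eq (by push_cast [Nat.cast_sub (show 1 ≤ d by omega)]; ring)

variable {H : Type*} [TopologicalSpace H] {I : ModelWithCorners ℝ (Eu (d + 1)) H}
  {M : Type*} [TopologicalSpace M] [ChartedSpace H M] [IsManifold I ∞ M]
  {g : Bundle.ContMDiffRiemannianMetric I ∞ (Eu (d + 1)) (fun p : M => TangentSpace I p)}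
  {Φ : OpenPartialHomeomorph M (Eu (d + 1))}

/-- Harmonically flat coordinates are asymptotically Schwarzschild. -/
theorem IsHarmonicallyFlatChart.exists_conformalDecay (h : IsHarmonicallyFlatChart g Φ)
    (hd : 2 ≤ d) : ∃ μ, ConformalDecay (metricInChart g Φ) (schwarzschildFactor d μ) := by
  obtain ⟨U, hU, -, hU1, hg⟩ := h.exists_factor
  have ht := h.isEndChart.eventually_mem_target
  have hUh : ∀ᶠ x in Bornology.cobounded (Eu (d + 1)), InnerProductSpace.HarmonicAt U x :=
    ht.mono fun x hx => hU x hx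
  obtain ⟨a, ha⟩ := exists_decaysC2_of_harmonicAt hd hUh hU1
  have hN := isHomogeneousKernel_softKernel (m := d + 1) (j := d - 1) (p := ((d : ℝ) - 1) / 2)
    (by push_cast [Nat.cast_sub (show 1 ≤ d by omega)]; ring)
  set N : Eu (d + 1) → ℝ := softKernel (((d : ℝ) - 1) / 2) 0
  have hN0 : Tendsto N (Bornology.cobounded (Eu (d + 1))) (𝓝 0) :=
    hN.isBigO.trans_tendsto (tendsto_zpow_neg tendsto_norm_cobounded_atTop (by omega))
  have hvt : Tendsto (fun x => 1 + a * N x) (Bornology.cobounded (Eu (d + 1))) (𝓝 1) := by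
    simpa using (hN0.const_mul a).const_add 1
  have hvd : DecaysC2 0 fun x => (1 + a * N x) - 1 := by
    have h1 := hN.decaysC2.const_mul a
    refine DecaysC2.congr (f := fun x => a * N x) ⟨?_, fun k => ?_, fun k l => ?_⟩
      (.of_forall fun x => .of_forall fun y => by ring)
    · exact h1.decay.trans (isBigO_zpow_of_le tendsto_norm_cobounded_atTop (by omega))
    · exact (h1.decay_deriv k).trans (isBigO_zpow_of_le tendsto_norm_cobounded_atTop (by omega))
    · exact (h1.decay_deriv₂ k l).trans
        (isBigO_zpow_of_le tendsto_norm_cobounded_atTop (by omega))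
  have hf : ContDiffAt ℝ 3 (fun t : ℝ => t ^ (4 / ((d : ℝ) - 1))) 1 :=
    contDiffAt_id.rpow_const_of_ne one_ne_zero
  have hD := DecaysC2.comp_sub_comp (by omega) hf (hUh.mono fun x hx => hx.1)
    (eventually_cobounded_ne_zero.mono fun x hx => contDiffAt_const.add (contDiffAt_const.mul
      (contDiffAt_infty.1 (hN.smooth x hx) 2))) hU1 hvt hvd ha
  -- The mass is 2a because the Schwarzschild factor is a power of 1 + (m/2)r^{-(d-1)}.
  have hloc (i j : Fin (d + 1)) : ∀ᶠ x in Bornology.cobounded (Eu (d + 1)),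
      (fun x => if i = j then U x ^ (4 / ((d : ℝ) - 1)) - (1 + a * N x) ^ (4 / ((d : ℝ) - 1))
        else 0) =ᶠ[𝓝 x] fun x => metricInChart g Φ x i j -
          if i = j then schwarzschildFactor d (2 * a) ‖x‖ else 0 := by
    filter_upwards [ht] with x hx
    filter_upwards [Φ.open_target.mem_nhds hx] with y hy
    rw [hg y hy, schwarzschildFactor_eq]
    simp only [N, softKernel_eq_inv_norm_pow hd]
    split_ifs
    · congr 3; ring
    · simp
  have hh (i j : Fin (d + 1)) : DecaysC2 d fun x => metricInChart g Φ x i j -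
      if i = j then schwarzschildFactor d (2 * a) ‖x‖ else 0 := by
    refine DecaysC2.congr ?_ (hloc i j)
    split_ifs
    · exact hD
    · have h0 := hD.const_mul 0
      simpa using h0
  exact ⟨2 * a, {
    tendsto := tendsto_schwarzschildFactor hd _
    smooth_factor := (eventually_base_pos hd _).mono fun r hr =>
      contDiffAt_schwarzschildFactor hr.1 hr.2
    smooth := fun i j => (h.isEndChart.eventually_contDiffAt i j).mono fun x hx =>
      contDiffAt_infty.1 hx 2
    decay := fun i j => (hh i j).decay
    decay_deriv := fun i j k => (hh i j).decay_deriv k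
    decay_deriv₂ := fun i j k l => (hh i j).decay_deriv₂ k l }⟩

end HarmonicallyFlat

end ADM

end

theorem mainTheorem4 {d : ℕ} (hd : 2 ≤ d)
    {H : Type*} [TopologicalSpace H] {I : ModelWithCorners ℝ (ADM.Eu (d + 1)) H}
    {M : Type*} [TopologicalSpace M] [T2Space M] [SecondCountableTopology M] [ConnectedSpace M]
    [ChartedSpace H M] [IsManifold I ∞ M]
    (g : Bundle.ContMDiffRiemannianMetric I ∞ (ADM.Eu (d + 1)) (fun p : M => TangentSpace I p))
    (Φ : OpenPartialHomeomorph M (ADM.Eu (d + 1))) :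
    (∀ m : ℝ, ADM.IsAsymptoticallySchwarzschildChart g Φ m →
      ADM.HasADMMass (ADM.metricInChart g Φ) m ∧
      Tendsto (fun r : ℝ => ADM.F (ADM.metricInChart g Φ) r) atTop (𝓝 m) ∧
      (∃ C r₀ : ℝ, 0 < r₀ ∧ ∀ r : ℝ, r₀ ≤ r → ∀ θ : ADM.USphere d,
        |ADM.sphereScalarCurvature (ADM.metricInChart g Φ) r θ
          - ((d : ℝ) * (d - 1) / r ^ 2 - 2 * d * m / r ^ (d + 1))| ≤ C / r ^ (d + 2)) ∧
      (∃ C r₀ : ℝ, 0 < r₀ ∧ ∀ r : ℝ, r₀ ≤ r → ∀ θ : ADM.USphere d,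
        |ADM.meanCurvature (ADM.metricInChart g Φ) (r • (θ : ADM.Eu (d + 1)))
          - ((d : ℝ) / r - (d : ℝ) ^ 2 * m / ((d - 1) * r ^ d))| ≤ C / r ^ (d + 1))) ∧
    (ADM.IsHarmonicallyFlatChart g Φ →
      ∃ μ : ℝ, ADM.HasADMMass (ADM.metricInChart g Φ) μ ∧
        Tendsto (fun r : ℝ => ADM.F (ADM.metricInChart g Φ) r) atTop (𝓝 μ)) := by
  refine ⟨fun m h => ?_, fun h => ?_⟩
  · have hG := h.conformalDecay hd
    exact ⟨hG.hasADMMass hd, hG.tendsto_F hd, hG.exists_bound_scalar hd, hG.exists_bound_mean hd⟩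
  · obtain ⟨μ, hG⟩ := h.exists_conformalDecay hd
    exact ⟨μ, hG.hasADMMass hd, hG.tendsto_F hd⟩
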